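/- Let $n\ge 1$. **Notation.** For an abelian group $A$, $T(n,A)$ is the set of skew-symmetric $n\times n$ matrices over $A$ with zero diagonal. For $m\ge1$ regard $\mathbb Z/m$ as a subgroup of $\mathbb Q/\mathbb Z$ through $a\mapsto[a/m]$, so that $T(n,\mathbb Z/m)\subset T(n,\mathbb Q/\mathbb Z)$. For an $n\times n$ matrix $D$ over $\mathbb Q/\mathbb Z$ let $R(D)\subset(\mathbb Q/\mathbb Z)^n$ be the $\mathbb Z$-submodule generated by the rows of $D$, and $\sigma(D)=\sqrt{|R(D)|}$. Let $$N(n,m)=|\{D\in T(n,\mathbb Z/m):\ \sigma(D)\text{ is an integer dividing } m\}|.$$ Let $B_n(U(m))\subset U(m)^n$ be the space of $n$-tuples $(A_1,\dots,A_n)$ of unitary $m\times m$ matrices all of whose commutators $[A_i,A_j]$ lie in the center of $U(m)$. For $k\ge1$ let $J(n,k)$ be the set of all partitions $\alpha$ of some integer $k'$ with $1\le k'\le k$ into at most $n/2$ parts. Write $\alpha=\sum_{i=1}^j t_ia_i$, with distinct parts $a_1>\dots>a_j>0$ of multiplicities $t_1,\dots,t_j$, and put $s_i=n-2\sum_{l=1}^i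 t_l$ for $0\le i\le j$. For a prime $p$ let $$N_p(\alpha)=\frac{p^{\sum_{i=1}^j t_ia_i(s_{i-1}+s_i-1)}\prod_{l=s_j+1}^n\left(1-\frac1{p^l}\right)}{\prod_{i=1}^j\prod_{l=1}^{t_i}\left(1-\frac1{p^{2l}}\right)}.$$ For elements $d_1,\dots,d_t$ of an abelian group with $2t\le n$, let $D_n(d_1,\dots,d_t)$ be the $n\times n$ matrix with entry $d_i$ in position $(i+t,i)$ and $-d_i$ in position $(i,i+t)$ for $1\le i\le t$, and zeros elsewhere. For $q=p^k$ and $\alpha\in J(n,k)$ let $D_\alpha\in T(n,\mathbb Z/q)$ be the matrix $D_n(p^{k-a_1},\dots,p^{k-a_1},\dots,p^{k-a_j},\dots,p^{k-a_j})$, in which each $p^{k-a_i}\in\mathbb Z/q$ is listed $t_i$ times. Matrices $D,D'\in T(n,\mathbb Z/q)$ are congruent if $D'=A^TDA$ for some $A\in GL(n,\mathbb Z/q)$. **Theorem.** 1. Let $p$ be a prime, $k\ge1$ and $q=p^k$. For every $\alpha\in J(n,k)$ the number of matrices in $T(n,\mathbb Z/q)$ congruent to $D_\alpha$ is $N_p(\alpha)$.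 Moreover $$N(n,q)=1+\sum_{\alpha\in J(n,k)}N_p(\alpha).$$ 2. Let $m_1,m_2$ be relatively prime positive integers and $D_i\in T(n,\mathbb Z/m_i)$ for $i=1,2$. Then $D_1+D_2\in T(n,\mathbb Z/m_1m_2)$ and $\sigma(D_1+D_2)=\sigma(D_1)\sigma(D_2)$. Moreover $N(n,m_1m_2)=N(n,m_1)N(n,m_2)$. 3. Let $p_1,\dots,p_r$ be distinct primes, $k_1,\dots,k_r\ge1$ and $m=\prod_{i=1}^r p_i^{k_i}$. Then the number of path components of $B_n(U(m))$ is $$N(n,m)=\prod_{i=1}^r\left(1+\sum_{\alpha\in J(n,k_i)}N_{p_i}(\alpha)\right).$$ -/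

import Mathlib

open scoped Matrix

noncomputable section

namespace AlmostCommuting

/-- The set of `K`-almost commuting `n`-tuples in a group `G`: all commutators lie in `K`.
With the topology of `G ^ n` it is a subspace of `Fin n → G`. -/
def almostCommutingTuples (n : ℕ) (G : Type*) [Group G] (K : Subgroup G) : Set (Fin n → G) :=
  {A | ∀ i j, A i * A j * (A i)⁻¹ * (A j)⁻¹ ∈ K}

/-- The set `B_n(U(m))` of `n`-tuples of unitary `m × m` matrices with pairwise central
commutators. -/
def BU (n m : ℕ) : Set (Fin n → Matrix.unitaryGroup (Fin m) ℂ) :=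
  almostCommutingTuples n (Matrix.unitaryGroup (Fin m) ℂ)
    (Subgroup.center (Matrix.unitaryGroup (Fin m) ℂ))

/-- The group `ℚ/ℤ`. -/
abbrev QmodZ : Type := AddCircle (1 : ℚ)

/-- `T(n, A)`: skew-symmetric `n × n` matrices with entries in `A`. As usual for matrices of
skew-symmetric (alternating) bilinear forms, the diagonal is zero; this has to be asked
separately when `A` has elements of order two. -/
def T (n : ℕ) (A : Type*) [AddCommGroup A] : Set (Matrix (Fin n) (Fin n) A) :=
  {D | (∀ i j, D i j = -D j i) ∧ ∀ i, D i i = 0}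

lemma nsmul_one_div_eq_zero (m : ℕ) :
    zmultiplesHom QmodZ (((1 / (m : ℚ) : ℚ)) : QmodZ) (m : ℤ) = 0 := by
  rw [zmultiplesHom_apply, ← AddCircle.coe_zsmul, AddCircle.coe_eq_zero_iff]
  rcases Nat.eq_zero_or_pos m with h | h
  · exact ⟨0, by simp [h]⟩
  · refine ⟨1, ?_⟩
    have : (m : ℚ) ≠ 0 := by positivity
    simp [this]

/-- The inclusion `ℤ/m ⊂ ℚ/ℤ`, `a ↦ [a/m]` (for `m ≥ 1`). -/
def incl (m : ℕ) : ZMod m →+ QmodZ :=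
  ZMod.lift m ⟨zmultiplesHom QmodZ (((1 / (m : ℚ) : ℚ)) : QmodZ), nsmul_one_div_eq_zero m⟩

/-- The row space: the `ℤ`-submodule of `(ℚ/ℤ)^n` generated by the rows. -/
def rowSpace {n : ℕ} (D : Matrix (Fin n) (Fin n) QmodZ) : Submodule ℤ (Fin n → QmodZ) :=
  Submodule.span ℤ (Set.range fun i => D i)

/-- `σ(D)` is the square root of the cardinality of the row space (which is always finite). -/
def sigma {n : ℕ} (D : Matrix (Fin n) (Fin n) QmodZ) : ℝ :=
  Real.sqrt (Nat.card (rowSpace D))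

/-- The number `σ(D)` is a natural number that divides `m`. -/
def SigmaDvd {n : ℕ} (D : Matrix (Fin n) (Fin n) QmodZ) (m : ℕ) : Prop :=
  ∃ s : ℕ, sigma D = s ∧ s ∣ m

/-- `N(n, m)`: the number of `D ∈ T(n, ℤ/m)` such that `σ(D)` divides `m`. -/
def N (n m : ℕ) : ℕ :=
  Nat.card {D : Matrix (Fin n) (Fin n) (ZMod m) // D ∈ T n (ZMod m) ∧ SigmaDvd (D.map (incl m)) m}

/-- Congruence of matrices over a commutative ring: `D' = Aᵀ D A` with `A` invertible. -/
def Congruent {n : ℕ} {R : Type*} [CommRing R] (D D' : Matrix (Fin n) (Fin n) R) : Prop :=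
  ∃ A : GL (Fin n) R, D' = (A : Matrix (Fin n) (Fin n) R)ᵀ * D * (A : Matrix (Fin n) (Fin n) R)

/-- `D_n(d_1, …, d_t)`: its only non-zero entries are `d_k` in position `(k + t, k)` and `-d_k` in
position `(k, k + t)`. (Rows, columns and the list `d` are indexed from zero here.) -/
def stdSkew (n : ℕ) {A : Type*} [AddCommGroup A] (d : List A) : Matrix (Fin n) (Fin n) A :=
  Matrix.of fun i j =>
    if h : (j : ℕ) < d.length ∧ (i : ℕ) = j + d.length then d[(j : ℕ)]'h.1
    else if h : (i : ℕ) < d.length ∧ (j : ℕ) = i + d.length then -d[(i : ℕ)]'h.1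
    else 0

/-- `J'(n, k)`: partitions of `k` with at most `n / 2` parts. -/
def J' (n k : ℕ) : Finset k.Partition :=
  Finset.univ.filter fun α => 2 * α.parts.card ≤ n

/-- `J(n, k)`: partitions of the numbers `1, …, k` with at most `n / 2` parts. -/
def J (n k : ℕ) : Finset (Σ k' : ℕ, k'.Partition) :=
  (Finset.Icc 1 k).sigma fun k' => J' n k'

/-- The matrix `D_α` over `ℤ/p^k`: the standard skew matrix with the entries `p ^ (k - a)`, where
`a` runs through the parts of `α` (with multiplicity) in decreasing order. -/
def Dalpha (n p k : ℕ) (α : Multiset ℕ) : Matrix (Fin n) (Fin n) (ZMod (p ^ k)) :=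
  stdSkew n ((α.sort (· ≥ ·)).map fun a => (p : ZMod (p ^ k)) ^ (k - a))

/-- For the `i`-th largest distinct part `a = a_i` of `α`, this is
`s_i = n - 2 (t_1 + ⋯ + t_i)`, where `t_l` is the multiplicity of `a_l`. -/
def sAt (n : ℕ) (α : Multiset ℕ) (a : ℕ) : ℕ :=
  n - 2 * (α.filter fun b => a ≤ b).card

/-- For the `i`-th largest distinct part `a = a_i` of `α`, this is
`s_{i-1} = n - 2 (t_1 + ⋯ + t_{i-1})`. -/
def sBefore (n : ℕ) (α : Multiset ℕ) (a : ℕ) : ℕ :=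
  n - 2 * (α.filter fun b => a < b).card

/-- The number `N_p(α)`. Products and sums over `i = 1, …, j` run over the distinct parts `a = a_i`
of `α`, and `t_i` is `α.count a`; the last `s_j` is `n - 2 * α.card`. For partitions with at most
`n / 2` parts (and `a` a part) no subtraction of natural numbers here is truncated. -/
def Np (n p : ℕ) (α : Multiset ℕ) : ℚ :=
  (p : ℚ) ^ (∑ a ∈ α.toFinset, α.count a * a * (sBefore n α a + sAt n α a - 1)) *
      (∏ l ∈ Finset.Icc (n - 2 * α.card + 1) n, (1 - 1 / (p : ℚ) ^ l)) /
    ∏ a ∈ α.toFinset, ∏ l ∈ Finset.Icc 1 (α.count a), (1 - 1 / (p : ℚ) ^ (2 * l))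

end AlmostCommuting

end

/-!
The count of components and the count of matrices are tied together by commutators. If all the
commutators of a tuple `A` of unitary `m × m` matrices are scalar, they have determinant one, so
`A i * A j = ω ^ D i j • A j * A i` for a primitive `m`-th root of unity `ω` and a unique alternating
matrix `D` over `ℤ/m` (`exists_hasRelations`). Since `D` takes values in a discrete set, it is
constant on path components (`HasRelations.eq_of_joinedIn`). It remains to see that `D` occurs
exactly when `σ(D)` divides `m`, and that the tuples with a given `D` are all joined by paths.

For both, a tuple is regarded as a representation of the free group whose operators commute up to
the scalars `β` given by `D`. A Lagrangian subgroup of `(ℤ/m)^n` for the form `D` pulls back to a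
subgroup `Λ` of the free group that is its own `β`-orthogonal complement, and whose index is `σ(D)`
(`exists_isSelfOrthogonal`). The operators of `Λ` commute, so they have joint eigenvectors; a group
element outside `Λ` moves a joint eigenvector to one with a different character of `Λ`. Hence a joint
eigenvector generates a representation of dimension `σ(D)` on which the operators are monomial
matrices determined by the character, and every representation is an orthogonal sum of such blocks
(`exists_frame`). So `σ(D)` divides `m`, and conversely sums of copies of one block have every
dimension divisible by `σ(D)` (`exists_isTwisted_of_sigmaDvd`). Any two characters that occur differ
by a character of the free group, because the operators of commutators are scalars determined by `D`.
A path of characters, acting by scalars on each block, makes the characters of two tuples with the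
same `D` agree. Then the tuples are unitarily equivalent (`Frame.exists_intertwiner`), and
conjugation along a path in the connected group `U(m)` joins them (`HasRelations.joinedIn`).

The number of matrices is multiplicative since the row space of `D₁ + D₂` is the direct sum of the
row spaces when these have coprime exponents (`N_mul`). Over `ℤ/p^k`, an alternating matrix is an
orthogonal sum of blocks `p ^ (k - a) J₂` (`IsAlt.exists_cong_fromBlocks`). The exponents `a` form its
type, a multiset that can be read off from the orders of the images of the matrices `p ^ i D`; so the
type is a complete congruence invariant (`HasType.unique`, `HasType.cong`). Moreover `σ(D)` is
`p ^ |α|` for a matrix of type `α`. The number of matrices of type `a ::ₘ s`, with `a` the largest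
part, is expressed by the number of those of type `s` by counting in two ways the pairs of such a
matrix `D` and two vectors on which the form `D` takes the value `p ^ (k - a)` (`typeCount_cons`).
The numbers `Np` satisfy the same recursion (`Np_cons`).
-/


set_option linter.unusedSectionVars false

namespace AlmostCommuting

/-! ### Alternating matrices, congruence and types -/

section CongruenceAndImage

variable {R : Type*} [CommRing R] {ι κ μ : Type*} [Fintype ι] [Fintype κ] [Fintype μ]

/-- A matrix is alternating when it is skew-symmetric with zero diagonal. -/
def IsAlt {R ι : Type*} [AddCommGroup R] (D : Matrix ι ι R) : Prop :=
  (∀ i j, D i j = -D j i) ∧ ∀ i, D i i = 0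

/-- Congruence of square matrices over possibly different index types: `D' = Pᵀ D P` for an
invertible matrix `P`. -/
def Cong [DecidableEq ι] [DecidableEq κ] (D : Matrix ι ι R) (D' : Matrix κ κ R) : Prop :=
  ∃ (P : Matrix ι κ R) (Q : Matrix κ ι R), P * Q = 1 ∧ Q * P = 1 ∧ D' = Pᵀ * D * P

section

variable [DecidableEq ι] [DecidableEq κ] [DecidableEq μ]
  {D : Matrix ι ι R} {D' : Matrix κ κ R} {D'' : Matrix μ μ R}

lemma Cong.refl (D : Matrix ι ι R) : Cong D D := ⟨1, 1, by simp, by simp, by simp⟩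

lemma Cong.symm (h : Cong D D') : Cong D' D := by
  obtain ⟨P, Q, h1, h2, rfl⟩ := h
  refine ⟨Q, P, h2, h1, ?_⟩
  have h3 : Qᵀ * Pᵀ = 1 := by rw [← Matrix.transpose_mul, h1, Matrix.transpose_one]
  calc D = (Qᵀ * Pᵀ) * D * (P * Q) := by rw [h1, h3]; simp
    _ = _ := by simp only [Matrix.mul_assoc]

lemma Cong.trans (h : Cong D D') (h' : Cong D' D'') : Cong D D'' := by
  obtain ⟨P, Q, h1, h2, rfl⟩ := h
  obtain ⟨P', Q', h3, h4, rfl⟩ := h'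
  refine ⟨P * P', Q' * Q, ?_, ?_, ?_⟩
  · calc P * P' * (Q' * Q) = P * (P' * Q') * Q := by simp only [Matrix.mul_assoc]
      _ = 1 := by rw [h3, Matrix.mul_one, h1]
  · calc Q' * Q * (P * P') = Q' * (Q * P) * P' := by simp only [Matrix.mul_assoc]
      _ = 1 := by rw [h2, Matrix.mul_one, h4]
  · simp only [Matrix.transpose_mul, Matrix.mul_assoc]

lemma Cong.smul (h : Cong D D') (c : R) : Cong (c • D) (c • D') := by
  obtain ⟨P, Q, h1, h2, rfl⟩ := h
  exact ⟨P, Q, h1, h2, by simp⟩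

lemma Cong.fromBlocks_right {E : Matrix κ κ R} {E' : Matrix μ μ R} (h : Cong E E')
    (A : Matrix ι ι R) :
    Cong (Matrix.fromBlocks A 0 0 E) (Matrix.fromBlocks A 0 0 E') := by
  obtain ⟨P, Q, h1, h2, rfl⟩ := h
  refine ⟨Matrix.fromBlocks 1 0 0 P, Matrix.fromBlocks 1 0 0 Q, ?_, ?_, ?_⟩ <;>
  simp [Matrix.fromBlocks_multiply, Matrix.fromBlocks_transpose, h1, h2]

end

lemma IsAlt.dotProduct_mulVec_self {D : Matrix ι ι R} (hD : IsAlt D) (v : ι → R) :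
    v ⬝ᵥ D *ᵥ v = 0 := by
  classical
  have : v ⬝ᵥ D *ᵥ v = ∑ x : ι × ι, v x.1 * (D x.1 x.2 * v x.2) := by
    rw [Fintype.sum_prod_type]
    simp [dotProduct, Matrix.mulVec, Finset.mul_sum]
  rw [this]
  refine Finset.sum_involution (fun x _ => x.swap) ?_ ?_ (by simp) (by simp)
  · rintro ⟨i, j⟩ -
    simp only [Prod.swap]
    rw [hD.1 j i]; ring
  · rintro ⟨i, j⟩ - h e
    simp only [Prod.swap, Prod.mk.injEq] at e
    simp [e.1, hD.2] at h

lemma IsAlt.dotProduct_mulVec_swap {D : Matrix ι ι R} (hD : IsAlt D) (v w : ι → R) :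
    v ⬝ᵥ D *ᵥ w = -(w ⬝ᵥ D *ᵥ v) := by
  have hT : Dᵀ = -D := by ext i j; simpa using hD.1 j i
  rw [Matrix.dotProduct_mulVec, ← Matrix.mulVec_transpose, hT, Matrix.neg_mulVec,
    neg_dotProduct, dotProduct_comm]

lemma transpose_mul_mul_apply (D : Matrix ι ι R) (P : Matrix ι κ R) (i j : κ) :
    (Pᵀ * D * P) i j = (P.col i) ⬝ᵥ D *ᵥ (P.col j) := by
  rw [Matrix.mul_assoc]
  simp only [Matrix.mul_apply, dotProduct, Matrix.mulVec, Matrix.transpose_apply, Matrix.col_apply]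

lemma IsAlt.transpose_mul_mul {D : Matrix ι ι R} (hD : IsAlt D) (P : Matrix ι κ R) :
    IsAlt (Pᵀ * D * P) := by
  refine ⟨fun i j => ?_, fun i => ?_⟩
  · rw [transpose_mul_mul_apply, transpose_mul_mul_apply, hD.dotProduct_mulVec_swap]
  · rw [transpose_mul_mul_apply, hD.dotProduct_mulVec_self]

lemma Cong.isAlt [DecidableEq ι] [DecidableEq κ] {D : Matrix ι ι R} {D' : Matrix κ κ R}
    (h : Cong D D') (hD : IsAlt D) : IsAlt D' := by
  obtain ⟨P, Q, -, -, rfl⟩ := h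
  exact hD.transpose_mul_mul P

/-- The number of vectors in the image of a matrix. -/
noncomputable def imCard (D : Matrix ι κ R) : ℕ := Nat.card (LinearMap.range D.mulVecLin)

lemma Cong.imCard_eq [DecidableEq ι] [DecidableEq κ] {D : Matrix ι ι R} {D' : Matrix κ κ R}
    (h : Cong D D') : imCard D = imCard D' := by
  obtain ⟨P, Q, h1, h2, rfl⟩ := h
  have h3 : Qᵀ * Pᵀ = 1 := by rw [← Matrix.transpose_mul, h1, Matrix.transpose_one]
  refine Nat.card_congr (Equiv.ofBijective
    (fun x => ⟨Pᵀ *ᵥ x.1, ?_⟩) ⟨?_, ?_⟩)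
  · obtain ⟨_, v, rfl⟩ := x
    refine ⟨Q *ᵥ v, ?_⟩
    simp only [Matrix.mulVecLin_apply, Matrix.mulVec_mulVec, Matrix.mul_assoc, h1, Matrix.mul_one]
  · rintro ⟨x, _⟩ ⟨y, _⟩ h
    simp only [Subtype.mk.injEq] at h ⊢
    simpa [Matrix.mulVec_mulVec, h3] using congrArg (fun z => Qᵀ *ᵥ z) h
  · rintro ⟨_, v, rfl⟩
    refine ⟨⟨D *ᵥ (P *ᵥ v), ⟨P *ᵥ v, rfl⟩⟩, ?_⟩
    simp only [Matrix.mulVecLin_apply, Matrix.mulVec_mulVec, Matrix.mul_assoc]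

lemma imCard_fromBlocks_zero (A : Matrix ι ι R) (B : Matrix κ κ R) :
    imCard (Matrix.fromBlocks A 0 0 B) = imCard A * imCard B := by
  rw [imCard, imCard, imCard, ← Nat.card_prod]
  refine Nat.card_congr (Equiv.ofBijective
    (fun x => ⟨⟨x.1 ∘ Sum.inl, ?_⟩, ⟨x.1 ∘ Sum.inr, ?_⟩⟩) ⟨?_, ?_⟩)
  · obtain ⟨_, v, rfl⟩ := x
    refine ⟨v ∘ Sum.inl, ?_⟩
    ext i
    simp [Matrix.fromBlocks_mulVec]
  · obtain ⟨_, v, rfl⟩ := x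
    refine ⟨v ∘ Sum.inr, ?_⟩
    ext i
    simp [Matrix.fromBlocks_mulVec]
  · rintro ⟨x, _⟩ ⟨y, _⟩ h
    simp only [Prod.mk.injEq, Subtype.mk.injEq] at h ⊢
    ext (i | i)
    · exact congrFun h.1 i
    · exact congrFun h.2 i
  · rintro ⟨⟨_, v, rfl⟩, ⟨_, w, rfl⟩⟩
    refine ⟨⟨_, Sum.elim v w, rfl⟩, ?_⟩
    ext i <;> simp [Matrix.fromBlocks_mulVec]

lemma imCard_eq_one_iff [Finite R] [DecidableEq κ] (D : Matrix ι κ R) : imCard D = 1 ↔ D = 0 := by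
  rw [imCard]
  constructor
  · intro h
    have := (Nat.card_eq_one_iff_unique.1 h).1
    have h2 : LinearMap.range D.mulVecLin = ⊥ := (Submodule.subsingleton_iff_eq_bot).1 this
    rw [LinearMap.range_eq_bot] at h2
    refine Matrix.ext_of_mulVec_single fun i => ?_
    rw [Matrix.zero_mulVec]
    exact LinearMap.congr_fun h2 (Pi.single i 1)
  · rintro rfl
    rw [Matrix.mulVecLin_zero, LinearMap.range_zero]
    simp

lemma card_ker_mul_imCard [Finite R] (D : Matrix ι κ R) :
    Nat.card (LinearMap.ker D.mulVecLin) * imCard D = Nat.card R ^ Fintype.card κ := by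
  rw [imCard, mul_comm, ← Nat.card_congr D.mulVecLin.quotKerEquivRange.toEquiv, mul_comm,
    ← Submodule.card_eq_card_quotient_mul_card, Nat.card_fun, Nat.card_eq_fintype_card (α := κ)]

end CongruenceAndImage

section PrimePower

variable {p k : ℕ}

lemma natCast_prime_pow_eq_zero_iff (hp : p.Prime) {j : ℕ} :
    ((p : ZMod (p ^ k)) ^ j) = 0 ↔ k ≤ j := by
  have : ((p : ZMod (p ^ k)) ^ j) = ((p ^ j : ℕ) : ZMod (p ^ k)) := by push_cast; rfl
  rw [this, ZMod.natCast_eq_zero_iff, Nat.pow_dvd_pow_iff_le_right hp.one_lt]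

/-- The ideal generated by `p^j` in `ℤ/p^k` has `p^(k-j)` elements; truncated subtraction covers
the case `k ≤ j`, where the ideal is zero. -/
lemma card_range_mul_pow (hp : p.Prime) (j : ℕ) :
    Nat.card (LinearMap.range (LinearMap.mulLeft (ZMod (p ^ k)) ((p : ZMod (p ^ k)) ^ j))) =
      p ^ (k - j) := by
  have h1 : ((p : ZMod (p ^ k)) ^ j) = ((p ^ j : ℕ) : ZMod (p ^ k)) := by push_cast; rfl
  have h2 : Nat.card (LinearMap.range (LinearMap.mulLeft (ZMod (p ^ k)) ((p : ZMod (p ^ k)) ^ j)))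
      = Nat.card (AddSubgroup.zmultiples ((p ^ j : ℕ) : ZMod (p ^ k))) := by
    refine Nat.card_congr (Equiv.subtypeEquivRight fun x => ?_)
    rw [AddSubgroup.mem_zmultiples_iff, LinearMap.mem_range, h1]
    constructor
    · rintro ⟨y, rfl⟩
      obtain ⟨z, rfl⟩ := ZMod.intCast_surjective y
      exact ⟨z, by simp [mul_comm]⟩
    · rintro ⟨z, rfl⟩
      exact ⟨z, by simp [mul_comm]⟩
  have hk : p ^ k ≠ 0 := pow_ne_zero _ hp.ne_zero
  rw [h2, Nat.card_zmultiples, ZMod.addOrderOf_coe _ hk]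
  rcases le_total j k with h | h
  · rw [Nat.gcd_eq_right (pow_dvd_pow p h), Nat.pow_div h hp.pos]
  · rw [Nat.gcd_eq_left (pow_dvd_pow p h), Nat.div_self (Nat.pos_of_ne_zero hk),
      Nat.sub_eq_zero_of_le h, pow_zero]

/-- The standard `2 × 2` alternating matrix. -/
def J₂ (R : Type*) [CommRing R] : Matrix (Fin 2) (Fin 2) R := !![0, 1; -1, 0]

lemma isAlt_smul_J₂ {R : Type*} [CommRing R] (c : R) : IsAlt (c • J₂ R) := by
  refine ⟨fun i j => ?_, fun i => ?_⟩
  · fin_cases i <;> fin_cases j <;> simp [J₂]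
  · fin_cases i <;> simp [J₂]

lemma imCard_smul_J₂ {R : Type*} [CommRing R] (c : R) :
    imCard (c • J₂ R) = Nat.card (LinearMap.range (LinearMap.mulLeft R c)) ^ 2 := by
  rw [sq, ← Nat.card_prod, imCard]
  refine Nat.card_congr (Equiv.ofBijective
    (fun x => (⟨x.1 0, ?_⟩, ⟨x.1 1, ?_⟩)) ⟨?_, ?_⟩)
  · obtain ⟨_, v, rfl⟩ := x
    exact ⟨v 1, by simp [J₂, Matrix.mulVec, dotProduct]⟩
  · obtain ⟨_, v, rfl⟩ := x
    exact ⟨-v 0, by simp [J₂, Matrix.mulVec, dotProduct]⟩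
  · rintro ⟨x, _⟩ ⟨y, _⟩ h
    simp only [Prod.mk.injEq, Subtype.mk.injEq] at h ⊢
    ext i; fin_cases i
    exacts [h.1, h.2]
  · rintro ⟨⟨_, a, rfl⟩, ⟨_, b, rfl⟩⟩
    refine ⟨⟨_, ![-b, a], rfl⟩, ?_⟩
    ext <;> simp [J₂, Matrix.mulVec, dotProduct]

/-- An alternating matrix `D` over `ℤ/p^k` has type `s` when the images of its multiples `p^i D`
have the sizes of those of the orthogonal sum of the `2 × 2` blocks with entries `± p^(k-a)`,
`a ∈ s`. This is visibly invariant under congruence, and truncated subtraction is intended. -/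
def HasType {ι : Type*} [Fintype ι] (D : Matrix ι ι (ZMod (p ^ k))) (s : Multiset ℕ) : Prop :=
  ∀ i, imCard ((p : ZMod (p ^ k)) ^ i • D) = p ^ (2 * (s.map (· - i)).sum)

variable {ι κ : Type*} [Fintype ι] [Fintype κ] [DecidableEq ι] [DecidableEq κ]

lemma HasType.of_cong {D : Matrix ι ι (ZMod (p ^ k))} {D' : Matrix κ κ (ZMod (p ^ k))}
    {s : Multiset ℕ} (hD : HasType D s) (h : Cong D D') : HasType D' s := fun i => by
  rw [← hD i, (h.smul _).imCard_eq]

lemma Cong.hasType_iff {D : Matrix ι ι (ZMod (p ^ k))} {D' : Matrix κ κ (ZMod (p ^ k))}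
    {s : Multiset ℕ} (h : Cong D D') : HasType D s ↔ HasType D' s :=
  ⟨fun hD => hD.of_cong h, fun hD => hD.of_cong h.symm⟩

lemma imCard_pow_smul_block (hp : p.Prime) {a : ℕ} (ha : a ≤ k) (E : Matrix κ κ (ZMod (p ^ k)))
    (i : ℕ) :
    imCard ((p : ZMod (p ^ k)) ^ i •
      Matrix.fromBlocks ((p : ZMod (p ^ k)) ^ (k - a) • J₂ _) 0 0 E) =
      p ^ (2 * (a - i)) * imCard ((p : ZMod (p ^ k)) ^ i • E) := by
  rw [Matrix.fromBlocks_smul, smul_zero, smul_zero, imCard_fromBlocks_zero, smul_smul, ← pow_add,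
    imCard_smul_J₂, card_range_mul_pow hp, ← pow_mul]
  congr 2
  omega

lemma hasType_cons_iff (hp : p.Prime) {a : ℕ} (ha : a ≤ k) (E : Matrix κ κ (ZMod (p ^ k)))
    (s : Multiset ℕ) :
    HasType (Matrix.fromBlocks ((p : ZMod (p ^ k)) ^ (k - a) • J₂ _) 0 0 E) (a ::ₘ s) ↔
      HasType E s := by
  refine forall_congr' fun i => ?_
  rw [imCard_pow_smul_block hp ha, Multiset.map_cons, Multiset.sum_cons, mul_add, pow_add,
    Nat.mul_right_inj (pow_ne_zero _ hp.ne_zero)]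

lemma hasType_zero_iff (hp : p.Prime) (E : Matrix κ κ (ZMod (p ^ k))) :
    HasType E 0 ↔ E = 0 := by
  have : NeZero (p ^ k) := ⟨pow_ne_zero _ hp.ne_zero⟩
  constructor
  · intro h
    have := h 0
    simpa [imCard_eq_one_iff] using this
  · rintro rfl i
    rw [smul_zero]
    simp [(imCard_eq_one_iff (0 : Matrix κ κ (ZMod (p ^ k)))).2 rfl]

lemma sum_map_sub_eq_zero {s : Multiset ℕ} {a : ℕ} (hs : ∀ b ∈ s, b ≤ a) :
    (s.map (· - a)).sum = 0 := by
  rw [Multiset.sum_eq_zero_iff]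
  intro x hx
  obtain ⟨b, hb, rfl⟩ := Multiset.mem_map.1 hx
  have := hs b hb
  omega

/-- The largest element of the type is the exponent of the annihilator of the matrix. -/
lemma HasType.pow_smul_eq_zero_iff (hp : p.Prime) {D : Matrix ι ι (ZMod (p ^ k))}
    {s : Multiset ℕ} (hD : HasType D s) (a : ℕ) :
    (p : ZMod (p ^ k)) ^ a • D = 0 ↔ ∀ b ∈ s, b ≤ a := by
  have : NeZero (p ^ k) := ⟨pow_ne_zero _ hp.ne_zero⟩
  rw [← imCard_eq_one_iff, hD a]
  constructor
  · intro h b hb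
    have h2 : 2 * (s.map (· - a)).sum = 0 := by
      by_contra h0
      exact absurd h (Nat.one_lt_pow h0 hp.one_lt).ne'
    have h3 : (s.map (· - a)).sum = 0 := by omega
    rw [Multiset.sum_eq_zero_iff] at h3
    have := h3 _ (Multiset.mem_map_of_mem _ hb)
    omega
  · intro h
    rw [sum_map_sub_eq_zero h, mul_zero, pow_zero]

lemma sum_map_sub_sub (s : Multiset ℕ) (i : ℕ) :
    (s.map (· - i)).sum = (s.map (· - (i + 1))).sum + (s.filter fun b => i < b).card := by
  induction s using Multiset.induction_on with
  | empty => simp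
  | cons a s ih =>
    simp only [Multiset.map_cons, Multiset.sum_cons, ih]
    by_cases h : i < a
    · rw [Multiset.filter_cons_of_pos (p := fun b => i < b) _ h, Multiset.card_cons]; omega
    · rw [Multiset.filter_cons_of_neg (p := fun b => i < b) _ h]; omega

lemma card_filter_lt_succ (s : Multiset ℕ) (i : ℕ) :
    (s.filter fun b => i < b).card = (s.filter fun b => i + 1 < b).card + s.count (i + 1) := by
  induction s using Multiset.induction_on with
  | empty => simp
  | cons a s ih =>
    simp only [Multiset.filter_cons, Multiset.card_add, ih, Multiset.count_cons]
    split_ifs <;> simp <;> omega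

/-- The second differences in `i` of the truncated sums `∑ max(a - i, 0)` are the multiplicities,
so that the type is determined by the matrix. -/
lemma HasType.unique (hp : p.Prime) {D : Matrix ι ι (ZMod (p ^ k))} {s t : Multiset ℕ}
    (hs : HasType D s) (ht : HasType D t) (hs0 : 0 ∉ s) (ht0 : 0 ∉ t) : s = t := by
  have h1 (i) : (s.map (· - i)).sum = (t.map (· - i)).sum := by
    have := (hs i).symm.trans (ht i)
    have := Nat.pow_right_injective hp.two_le this
    omega
  have h2 (i) : (s.filter fun b => i < b).card = (t.filter fun b => i < b).card := by
    have e1 := sum_map_sub_sub s i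
    have e2 := sum_map_sub_sub t i
    have := h1 i
    have := h1 (i + 1)
    omega
  ext a
  rcases a with _ | a
  · rw [Multiset.count_eq_zero_of_notMem hs0, Multiset.count_eq_zero_of_notMem ht0]
  · have e1 := card_filter_lt_succ s a
    have e2 := card_filter_lt_succ t a
    have := h2 a
    have := h2 (a + 1)
    omega

end PrimePower

/-! ### Normal forms over prime power moduli -/

section Splitting

variable {p k : ℕ} [Fact p.Prime]

lemma exists_eq_pow_sub_mul {a : ℕ} (ha : a ≤ k) {x : ZMod (p ^ k)}
    (hx : (p : ZMod (p ^ k)) ^ a * x = 0) : ∃ y, x = (p : ZMod (p ^ k)) ^ (k - a) * y := by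
  have hp : p.Prime := Fact.out
  obtain ⟨n, rfl⟩ := ZMod.natCast_zmod_surjective x
  have h1 : ((p ^ a * n : ℕ) : ZMod (p ^ k)) = 0 := by push_cast; exact hx
  rw [ZMod.natCast_eq_zero_iff] at h1
  have h2 : p ^ (k - a) ∣ n := by
    have : p ^ a * p ^ (k - a) ∣ p ^ a * n := by rwa [← pow_add, Nat.add_sub_cancel' ha]
    exact Nat.dvd_of_mul_dvd_mul_left (pow_pos hp.pos a) this
  obtain ⟨m, rfl⟩ := h2
  exact ⟨m, by push_cast; rfl⟩

/-- Reduction modulo `p`. -/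
def redHom (p : ℕ) {k : ℕ} (hk : 1 ≤ k) : ZMod (p ^ k) →+* ZMod p :=
  ZMod.castHom (dvd_pow_self p (by omega)) (ZMod p)

variable (hk : 1 ≤ k)

lemma redHom_surjective : Function.Surjective (redHom p hk) :=
  ZMod.ringHom_surjective _

lemma redHom_eq_zero_iff {x : ZMod (p ^ k)} :
    redHom p hk x = 0 ↔ ∃ y, x = p * y := by
  constructor
  · intro h
    obtain ⟨n, rfl⟩ := ZMod.natCast_zmod_surjective x
    rw [map_natCast, ZMod.natCast_eq_zero_iff] at h
    obtain ⟨m, rfl⟩ := h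
    exact ⟨m, by push_cast; rfl⟩
  · rintro ⟨y, rfl⟩
    rw [map_mul, map_natCast, CharP.cast_eq_zero, zero_mul]

lemma isUnit_iff_redHom_ne_zero {x : ZMod (p ^ k)} : IsUnit x ↔ redHom p hk x ≠ 0 := by
  have hp : p.Prime := Fact.out
  obtain ⟨n, rfl⟩ := ZMod.natCast_zmod_surjective x
  rw [map_natCast, Ne, ZMod.natCast_eq_zero_iff, ZMod.isUnit_iff_coprime,
    Nat.coprime_pow_right_iff (by omega), Nat.coprime_comm, hp.coprime_iff_not_dvd]

/-- If the annihilator of `p^(k-a) y` is exactly `p^a`, then `y` is a unit. -/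
lemma isUnit_of_pow_mul_ne_zero {a : ℕ} (ha : 1 ≤ a) (hak : a ≤ k) {y : ZMod (p ^ k)}
    (h : (p : ZMod (p ^ k)) ^ (a - 1) * ((p : ZMod (p ^ k)) ^ (k - a) * y) ≠ 0) : IsUnit y := by
  have hp : p.Prime := Fact.out
  rw [isUnit_iff_redHom_ne_zero (ha.trans hak), Ne, redHom_eq_zero_iff]
  rintro ⟨z, rfl⟩
  apply h
  have : (p : ZMod (p ^ k)) ^ k = 0 := (natCast_prime_pow_eq_zero_iff hp).2 le_rfl
  calc _ = (p : ZMod (p ^ k)) ^ (a - 1 + (k - a) + 1) * z := by ring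
    _ = 0 := by rw [show a - 1 + (k - a) + 1 = k by omega, this, zero_mul]

variable {ι κ : Type*} [Fintype ι] [Fintype κ] [DecidableEq ι] [DecidableEq κ]

/-- Two vectors over `ℤ/p^k` that are linearly independent modulo `p` are the first two columns of
an invertible matrix. -/
lemma exists_invertible_extension {n : ℕ} (hn : Fintype.card ι = n + 2)
    {v : Fin 2 → ι → ZMod (p ^ k)}
    (hv : LinearIndependent (ZMod p) fun i => redHom p hk ∘ v i) :
    ∃ (P : Matrix ι (Fin 2 ⊕ Fin n) (ZMod (p ^ k))) (Q : Matrix (Fin 2 ⊕ Fin n) ι (ZMod (p ^ k))),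
      P * Q = 1 ∧ Q * P = 1 ∧ ∀ i, P.col (Sum.inl i) = v i := by
  classical
  -- extend to a basis modulo `p` and lift its further vectors arbitrarily
  let b := Module.Basis.sumExtend hv
  have hfin : Finite (Module.Basis.sumExtendIndex hv) := by
    have := Module.Finite.finite_basis b
    exact Finite.of_injective _ (Sum.inr_injective (α := Fin 2))
  have : Fintype (Module.Basis.sumExtendIndex hv) := Fintype.ofFinite _
  have hcard : Fintype.card (Module.Basis.sumExtendIndex hv) = n := by
    have h1 := Module.finrank_eq_card_basis b
    rw [Module.finrank_fintype_fun_eq_card, hn, Fintype.card_sum, Fintype.card_fin] at h1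
    omega
  let e : Module.Basis.sumExtendIndex hv ≃ Fin n := Fintype.equivFinOfCardEq hcard
  let b' := b.reindex (Equiv.sumCongr (Equiv.refl (Fin 2)) e)
  have hb' (i : Fin 2) : b' (Sum.inl i) = redHom p hk ∘ v i := by
    simp [b', b, Module.Basis.sumExtend]
    rfl
  let r := Function.surjInv (redHom_surjective (p := p) hk)
  have hr (x) : redHom p hk (r x) = x := Function.surjInv_eq _ x
  let P : Matrix ι (Fin 2 ⊕ Fin n) (ZMod (p ^ k)) :=
    Matrix.of fun i j => Sum.elim (fun c => v c i) (fun c => r (b' (Sum.inr c) i)) j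
  have hP : P.map (redHom p hk) = Matrix.of fun i j => b' j i := by
    ext i (j | j)
    · simp [P, hb']
    · simp [P, hr]
  let ε : ι ≃ Fin 2 ⊕ Fin n := Fintype.equivOfCardEq (by simp [hn, add_comm])
  let P' : Matrix (Fin 2 ⊕ Fin n) (Fin 2 ⊕ Fin n) (ZMod (p ^ k)) := P.submatrix ε.symm id
  have hdet : IsUnit P'.det := by
    rw [isUnit_iff_redHom_ne_zero hk, RingHom.map_det, ← isUnit_iff_ne_zero,
      ← Matrix.isUnit_iff_isUnit_det, ← Matrix.linearIndependent_cols_iff_isUnit]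
    have h2 : LinearIndependent (ZMod p) (LinearEquiv.funCongrLeft (ZMod p) (ZMod p) ε.symm ∘ b') :=
      b'.linearIndependent.map' _ (LinearEquiv.ker _)
    convert h2 using 1
    ext j i
    have := congrFun (congrFun hP (ε.symm i)) j
    simpa [P', LinearMap.funLeft] using this
  have hPP : P = P'.submatrix ε id := by ext i j; simp [P']
  refine ⟨P, P'⁻¹.submatrix id ε, ?_, ?_, fun i => rfl⟩
  · rw [hPP]
    have := Matrix.submatrix_mul_equiv P' P'⁻¹ ε (Equiv.refl _) ε
    simp only [Equiv.coe_refl] at this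
    rw [this, Matrix.mul_nonsing_inv _ hdet, Matrix.submatrix_one_equiv]
  · rw [hPP, Matrix.submatrix_mul_equiv, Matrix.nonsing_inv_mul _ hdet, Matrix.submatrix_id_id]

lemma dotProduct_mulVec_smul_eq_zero {R : Type*} [CommRing R] {D : Matrix ι ι R} {c : R}
    (hD : c • D = 0) (v w : ι → R) : c * (v ⬝ᵥ D *ᵥ w) = 0 := by
  rw [← smul_eq_mul, ← dotProduct_smul, ← Matrix.smul_mulVec, hD, Matrix.zero_mulVec,
    dotProduct_zero]

/-- If `p^a` kills an alternating form, two vectors on which it takes the value `p^(k-a)` are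
linearly independent modulo `p`: for a combination of them that is divisible by `p`, pairing with
either vector shows that the coefficients are divisible by `p`. -/
lemma linearIndependent_redHom {D : Matrix ι ι (ZMod (p ^ k))} (hD : IsAlt D) {a : ℕ}
    (ha : 1 ≤ a) (hak : a ≤ k) (hDa : (p : ZMod (p ^ k)) ^ a • D = 0)
    {v : Fin 2 → ι → ZMod (p ^ k)}
    (hv : v 0 ⬝ᵥ D *ᵥ v 1 = (p : ZMod (p ^ k)) ^ (k - a)) :
    LinearIndependent (ZMod p) fun i => redHom p (ha.trans hak) ∘ v i := by
  have hp : p.Prime := Fact.out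
  have hk := ha.trans hak
  -- if `T p^(k-a)` is a value of the form times `p`, then it is killed by `p^(a-1)`
  have key (T x : ZMod (p ^ k)) (y z : ι → ZMod (p ^ k))
      (hx : T * (p : ZMod (p ^ k)) ^ (k - a) = p * (y ⬝ᵥ D *ᵥ z)) : redHom p hk T = 0 := by
    by_contra h
    rw [← Ne, ← isUnit_iff_redHom_ne_zero] at h
    have h1 : T * (p : ZMod (p ^ k)) ^ (k - 1) = 0 := by
      calc _ = (p : ZMod (p ^ k)) ^ (a - 1) * (T * (p : ZMod (p ^ k)) ^ (k - a)) := by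
            rw [show k - 1 = (a - 1) + (k - a) by omega]; ring
        _ = (p : ZMod (p ^ k)) ^ (a - 1 + 1) * (y ⬝ᵥ D *ᵥ z) := by rw [hx]; ring
        _ = 0 := by
          rw [show a - 1 + 1 = a by omega]; exact dotProduct_mulVec_smul_eq_zero hDa _ _
    rw [h.mul_right_eq_zero, natCast_prime_pow_eq_zero_iff hp] at h1
    omega
  have hpair : (fun i => redHom p hk ∘ v i) = ![redHom p hk ∘ v 0, redHom p hk ∘ v 1] := by
    funext i; fin_cases i <;> rfl
  rw [hpair, LinearIndependent.pair_iff]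
  intro s t hst
  obtain ⟨S, rfl⟩ := redHom_surjective hk s
  obtain ⟨T, rfl⟩ := redHom_surjective hk t
  have h1 : ∀ i, ∃ y, S * v 0 i + T * v 1 i = p * y := fun i => by
    rw [← redHom_eq_zero_iff hk]
    simpa using congrFun hst i
  choose w hw using h1
  have hw' : S • v 0 + T • v 1 = (p : ZMod (p ^ k)) • w := funext hw
  constructor
  · refine key S 0 w (v 1) ?_
    have : (S • v 0 + T • v 1) ⬝ᵥ D *ᵥ v 1 = p * (w ⬝ᵥ D *ᵥ v 1) := by
      rw [hw', smul_dotProduct, smul_eq_mul]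
    rw [← this, add_dotProduct, smul_dotProduct, smul_dotProduct, hv,
      hD.dotProduct_mulVec_self]
    simp
  · refine key T 0 (v 0) w ?_
    have : v 0 ⬝ᵥ D *ᵥ (S • v 0 + T • v 1) = p * (v 0 ⬝ᵥ D *ᵥ w) := by
      rw [hw', Matrix.mulVec_smul, dotProduct_smul, smul_eq_mul]
    rw [← this, Matrix.mulVec_add, dotProduct_add, Matrix.mulVec_smul, Matrix.mulVec_smul,
      dotProduct_smul, dotProduct_smul, hv, hD.dotProduct_mulVec_self]
    simp

lemma J₂_mul_J₂ (R : Type*) [CommRing R] : J₂ R * J₂ R = -1 := by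
  ext i j; fin_cases i <;> fin_cases j <;> simp [J₂]

lemma J₂_transpose (R : Type*) [CommRing R] : (J₂ R)ᵀ = -J₂ R := by
  ext i j; fin_cases i <;> fin_cases j <;> simp [J₂]

/-- Clearing the first two rows and columns of an alternating matrix whose leading block is
`d J₂` and whose first two rows are divisible by `d`. -/
lemma cong_fromBlocks {R : Type*} [CommRing R] (d : R) (X : Matrix (Fin 2) κ R)
    (E : Matrix κ κ R) :
    Cong (Matrix.fromBlocks (d • J₂ R) (d • X) (-(d • X)ᵀ) E)
      (Matrix.fromBlocks (d • J₂ R) 0 0 (E - d • (Xᵀ * J₂ R * X))) := by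
  refine ⟨Matrix.fromBlocks 1 (J₂ R * X) 0 1, Matrix.fromBlocks 1 (-(J₂ R * X)) 0 1, ?_, ?_, ?_⟩
  · simp [Matrix.fromBlocks_multiply]
  · simp [Matrix.fromBlocks_multiply]
  · have h1 : J₂ R * (J₂ R * X) = -X := by rw [← Matrix.mul_assoc, J₂_mul_J₂]; simp
    have h2 : Xᵀ * J₂ R * J₂ R = -Xᵀ := by rw [Matrix.mul_assoc, J₂_mul_J₂]; simp
    simp [Matrix.fromBlocks_multiply, Matrix.fromBlocks_transpose, J₂_transpose, h1, h2,
      Matrix.mul_assoc]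
    abel

lemma IsAlt.eq_fromBlocks {R : Type*} [CommRing R] {D : Matrix (Fin 2 ⊕ κ) (Fin 2 ⊕ κ) R}
    (hD : IsAlt D) {d : R} (hd : D (Sum.inl 0) (Sum.inl 1) = d) :
    D = Matrix.fromBlocks (d • J₂ R) D.toBlocks₁₂ (-D.toBlocks₁₂ᵀ) D.toBlocks₂₂ := by
  conv_lhs => rw [← Matrix.fromBlocks_toBlocks D]
  congr 1
  · ext i j
    have := hD.1 (Sum.inl 1) (Sum.inl 0)
    fin_cases i <;> fin_cases j <;> simp_all [J₂, hD.2, Matrix.toBlocks₁₁]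
  · ext i j
    simpa [Matrix.toBlocks₂₁, Matrix.toBlocks₁₂] using hD.1 _ _

lemma isAlt_fromBlocks_zero_iff {R : Type*} [CommRing R] {d : R} {E : Matrix κ κ R} :
    IsAlt (Matrix.fromBlocks (d • J₂ R) 0 0 E) ↔ IsAlt E := by
  constructor
  · intro h
    exact ⟨fun i j => by simpa using h.1 (Sum.inr i) (Sum.inr j),
      fun i => by simpa using h.2 (Sum.inr i)⟩
  · intro h
    refine ⟨?_, ?_⟩
    · rintro (i | i) (j | j)
      · simpa using (isAlt_smul_J₂ d).1 i j
      · simp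
      · simp
      · simpa using h.1 i j
    · rintro (i | i)
      · simpa using (isAlt_smul_J₂ d).2 i
      · simpa using h.2 i

/-- A matrix over `ℤ/p^k` that is killed by `p^a` is divisible by `p^(k-a)`. -/
lemma exists_smul_of_pow_smul_eq_zero {m n : Type*} {a : ℕ} (hak : a ≤ k)
    {Z : Matrix m n (ZMod (p ^ k))} (h : ∀ i j, (p : ZMod (p ^ k)) ^ a * Z i j = 0) :
    ∃ X, Z = (p : ZMod (p ^ k)) ^ (k - a) • X := by
  choose X hX using fun i j => exists_eq_pow_sub_mul hak (h i j)
  exact ⟨Matrix.of X, by ext i j; simpa using hX i j⟩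

/-- A non-zero alternating matrix over `ℤ/p^k` is congruent to an orthogonal sum of
`p^(k-a) J₂`, with `p^a` its annihilator, and a smaller alternating matrix. -/
lemma IsAlt.exists_cong_fromBlocks {D : Matrix ι ι (ZMod (p ^ k))} (hD : IsAlt D) (h0 : D ≠ 0) :
    ∃ (n a : ℕ) (E : Matrix (Fin n) (Fin n) (ZMod (p ^ k))), Fintype.card ι = n + 2 ∧
      1 ≤ a ∧ a ≤ k ∧ (p : ZMod (p ^ k)) ^ a • D = 0 ∧ IsAlt E ∧
      Cong D (Matrix.fromBlocks ((p : ZMod (p ^ k)) ^ (k - a) • J₂ _) 0 0 E) := by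
  have hp : p.Prime := Fact.out
  have hex : ∃ a, (p : ZMod (p ^ k)) ^ a • D = 0 :=
    ⟨k, by rw [(natCast_prime_pow_eq_zero_iff hp).2 le_rfl, zero_smul]⟩
  classical
  let a := Nat.find hex
  have hDa : (p : ZMod (p ^ k)) ^ a • D = 0 := Nat.find_spec hex
  have hak : a ≤ k :=
    Nat.find_min' hex (by rw [(natCast_prime_pow_eq_zero_iff hp).2 le_rfl, zero_smul])
  have ha : 1 ≤ a := by
    by_contra h
    have : a = 0 := by omega
    rw [this, pow_zero, one_smul] at hDa
    exact h0 hDa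
  have hDa' : (p : ZMod (p ^ k)) ^ (a - 1) • D ≠ 0 := Nat.find_min hex (by omega : a - 1 < a)
  obtain ⟨i, j, hij⟩ : ∃ i j, (p : ZMod (p ^ k)) ^ (a - 1) * D i j ≠ 0 := by
    by_contra! h
    exact hDa' (by ext i j; simpa using h i j)
  obtain ⟨y, hy⟩ : ∃ y, D i j = (p : ZMod (p ^ k)) ^ (k - a) * y :=
    exists_eq_pow_sub_mul hak (by simpa using congrFun (congrFun hDa i) j)
  have hyu : IsUnit y := isUnit_of_pow_mul_ne_zero ha hak (by rwa [← hy])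
  obtain ⟨u, rfl⟩ := hyu
  -- two vectors on which the form takes the value `p^(k-a)` exactly
  let v : Fin 2 → ι → ZMod (p ^ k) := ![Pi.single i 1, (↑u⁻¹ : ZMod (p ^ k)) • Pi.single j 1]
  have hv : v 0 ⬝ᵥ D *ᵥ v 1 = (p : ZMod (p ^ k)) ^ (k - a) := by
    simp [v, Matrix.mulVec_smul, hy]
    rw [mul_comm, mul_assoc, Units.mul_inv, mul_one]
  have hind := linearIndependent_redHom hD ha hak hDa hv
  have hcard : ∃ n, Fintype.card ι = n + 2 := by
    have := hind.fintype_card_le_finrank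
    rw [Module.finrank_fintype_fun_eq_card, Fintype.card_fin] at this
    exact ⟨_, (Nat.sub_add_cancel this).symm⟩
  obtain ⟨n, hn⟩ := hcard
  obtain ⟨P, Q, hPQ, hQP, hP⟩ := exists_invertible_extension _ hn hind
  have hc : Cong D (Pᵀ * D * P) := ⟨P, Q, hPQ, hQP, rfl⟩
  set D' := Pᵀ * D * P with hD'
  have hD'alt : IsAlt D' := hc.isAlt hD
  have hD'a : (p : ZMod (p ^ k)) ^ a • D' = 0 := by
    rw [hD', ← Matrix.smul_mul, ← Matrix.mul_smul, hDa]; simp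
  have h01 : D' (Sum.inl 0) (Sum.inl 1) = (p : ZMod (p ^ k)) ^ (k - a) := by
    rw [hD', transpose_mul_mul_apply, hP, hP, hv]
  have hblock := hD'alt.eq_fromBlocks h01
  obtain ⟨X, hX⟩ := exists_smul_of_pow_smul_eq_zero (Z := D'.toBlocks₁₂) hak
    (fun i j => congrFun (congrFun hD'a (Sum.inl i)) (Sum.inr j))
  rw [hX] at hblock
  have hc2 := cong_fromBlocks ((p : ZMod (p ^ k)) ^ (k - a)) X D'.toBlocks₂₂
  rw [← hblock] at hc2
  exact ⟨n, a, _, hn, ha, hak, hDa, isAlt_fromBlocks_zero_iff.1 (hc2.isAlt hD'alt), hc.trans hc2⟩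

end Splitting

section TypeTheory

variable {p k : ℕ} [Fact p.Prime]
variable {ι κ : Type*} [Fintype ι] [Fintype κ] [DecidableEq ι] [DecidableEq κ]

/-- Every alternating matrix has a type, by splitting off blocks. -/
lemma IsAlt.exists_hasType {N : ℕ} {D : Matrix (Fin N) (Fin N) (ZMod (p ^ k))} (hD : IsAlt D) :
    ∃ s : Multiset ℕ, HasType D s ∧ (∀ b ∈ s, 1 ≤ b ∧ b ≤ k) ∧ 2 * s.card ≤ N := by
  have hp : p.Prime := Fact.out
  induction N using Nat.strong_induction_on with
  | _ N ih =>
    by_cases h0 : D = 0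
    · exact ⟨0, (hasType_zero_iff hp D).2 h0, by simp, by simp⟩
    · obtain ⟨n, a, E, hn, ha, hak, -, hE, hc⟩ := hD.exists_cong_fromBlocks h0
      rw [Fintype.card_fin] at hn
      obtain ⟨s, hs, hsk, hsn⟩ := ih n (by omega) hE
      refine ⟨a ::ₘ s, (hc.hasType_iff).2 ((hasType_cons_iff hp hak E s).2 hs), ?_, ?_⟩
      · intro b hb
        rcases Multiset.mem_cons.1 hb with rfl | hb
        exacts [⟨ha, hak⟩, hsk b hb]
      · rw [Multiset.card_cons]; omega

/-- Alternating matrices of the same size and of the same type are congruent: the blocks that split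
off both belong to the largest element of the type, and the complements have the same type. -/
lemma HasType.cong {N : ℕ} {D D' : Matrix (Fin N) (Fin N) (ZMod (p ^ k))} (hD : IsAlt D)
    (hD' : IsAlt D') {s : Multiset ℕ} (hs0 : 0 ∉ s) (hs : HasType D s) (hs' : HasType D' s) :
    Cong D D' := by
  have hp : p.Prime := Fact.out
  induction N using Nat.strong_induction_on generalizing s with
  | _ N ih =>
    by_cases hs00 : s = 0
    · subst hs00
      rw [hasType_zero_iff hp] at hs hs'
      rw [hs, hs']
      exact Cong.refl 0
    · have hne {D : Matrix (Fin N) (Fin N) (ZMod (p ^ k))} (hs : HasType D s) : D ≠ 0 := fun h0 =>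
        hs00 (hs.unique hp ((hasType_zero_iff hp D).2 h0) hs0 (by simp))
      obtain ⟨n, a, E, hn, ha, hak, hDa, hE, hc⟩ := hD.exists_cong_fromBlocks (hne hs)
      obtain ⟨n', a', E', hn', ha', hak', hDa', hE', hc'⟩ := hD'.exists_cong_fromBlocks (hne hs')
      rw [Fintype.card_fin] at hn hn'
      obtain rfl : n = n' := by omega
      obtain ⟨t, ht, htk, -⟩ := hE.exists_hasType
      obtain ⟨t', ht', htk', -⟩ := hE'.exists_hasType
      have e1 : s = a ::ₘ t := hs.unique hp
        (hc.hasType_iff.2 ((hasType_cons_iff hp hak E t).2 ht)) hs0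
        (fun h => by
          rcases Multiset.mem_cons.1 h with h | h
          · omega
          · have := (htk 0 h).1; omega)
      have e2 : s = a' ::ₘ t' := hs'.unique hp
        (hc'.hasType_iff.2 ((hasType_cons_iff hp hak' E' t').2 ht')) hs0
        (fun h => by
          rcases Multiset.mem_cons.1 h with h | h
          · omega
          · have := (htk' 0 h).1; omega)
      have l1 := (hs.pow_smul_eq_zero_iff hp a).1 hDa
      have l2 := (hs'.pow_smul_eq_zero_iff hp a').1 hDa'
      obtain rfl : a = a' := le_antisymm (l2 a (by rw [e1]; simp)) (l1 a' (by rw [e2]; simp))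
      obtain rfl : t = t' := Multiset.cons_inj_right a |>.1 (e1.symm.trans e2)
      have hEE' : Cong E E' := ih n (by omega) hE hE'
        (fun h => by have := (htk 0 h).1; omega) ht ht'
      exact hc.trans ((hEE'.fromBlocks_right _).trans hc'.symm)

end TypeTheory

/-! ### Counting the matrices of a given type -/

section Counting

/-- All non-empty fibres of an additive homomorphism have the size of the kernel. -/
lemma card_fiber_mul_card_range {A B : Type*} [AddCommGroup A] [AddCommGroup B] [Finite A]
    (f : A →+ B) {b : B} (hb : b ∈ f.range) :
    Nat.card {a // f a = b} * Nat.card f.range = Nat.card A := by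
  obtain ⟨a, rfl⟩ := hb
  have h1 : Nat.card {x // f x = f a} = Nat.card f.ker := Nat.card_congr (f.fiberEquivKer a)
  rw [h1, ← Nat.card_congr (QuotientAddGroup.quotientKerEquivRange f).toEquiv, mul_comm,
    ← AddSubgroup.card_eq_card_quotient_mul_card_addSubgroup]

variable {p k : ℕ} [Fact p.Prime]
variable {ι κ : Type*} [Fintype ι] [Fintype κ] [DecidableEq ι] [DecidableEq κ]

instance instNeZeroPrimePow : NeZero (p ^ k) := ⟨pow_ne_zero _ (Fact.out : p.Prime).ne_zero⟩

/-- The number of alternating matrices of a given type. -/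
noncomputable def typeCount (p k n : ℕ) (s : Multiset ℕ) : ℕ :=
  Nat.card {D : Matrix (Fin n) (Fin n) (ZMod (p ^ k)) // IsAlt D ∧ HasType D s}

lemma card_zmod_pow : Nat.card (ZMod (p ^ k)) = p ^ k := by
  rw [Nat.card_zmod]

/-- The number of solutions `f` of the linear equation `f ⬝ᵥ w = p^(k-a)` when the annihilator of
`w` is exactly `p^a`: the values of `f ⬝ᵥ w` are then the multiples of `p^(k-a)`. -/
lemma card_dotProduct_eq {a : ℕ} (ha : 1 ≤ a) (hak : a ≤ k) {w : ι → ZMod (p ^ k)}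
    (hw : (p : ZMod (p ^ k)) ^ a • w = 0) (hw' : (p : ZMod (p ^ k)) ^ (a - 1) • w ≠ 0) :
    Nat.card {f : ι → ZMod (p ^ k) // f ⬝ᵥ w = (p : ZMod (p ^ k)) ^ (k - a)} * p ^ a =
      (p ^ k) ^ Fintype.card ι := by
  have hp : p.Prime := Fact.out
  let φ : (ι → ZMod (p ^ k)) →+ ZMod (p ^ k) :=
    AddMonoidHom.mk' (fun f => f ⬝ᵥ w) (fun f g => add_dotProduct f g w)
  obtain ⟨j, hj⟩ : ∃ j, (p : ZMod (p ^ k)) ^ (a - 1) * w j ≠ 0 := by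
    by_contra! h
    exact hw' (by ext i; simpa using h i)
  choose y hy using fun i => exists_eq_pow_sub_mul hak (by simpa using congrFun hw i)
  obtain ⟨u, hu⟩ : IsUnit (y j) := isUnit_of_pow_mul_ne_zero ha hak (by rwa [← hy])
  have hrange (x : ZMod (p ^ k)) : x ∈ φ.range ↔
      x ∈ LinearMap.range (LinearMap.mulLeft (ZMod (p ^ k)) ((p : ZMod (p ^ k)) ^ (k - a))) := by
    constructor
    · rintro ⟨f, rfl⟩
      refine ⟨f ⬝ᵥ y, ?_⟩
      have : w = (p : ZMod (p ^ k)) ^ (k - a) • y := funext hy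
      simp only [LinearMap.mulLeft_apply, φ, AddMonoidHom.mk'_apply]
      rw [this, dotProduct_smul, smul_eq_mul]
    · rintro ⟨z, rfl⟩
      refine ⟨Pi.single j (z * ↑u⁻¹), ?_⟩
      simp only [LinearMap.mulLeft_apply, φ, AddMonoidHom.mk'_apply, single_dotProduct]
      rw [hy j, ← hu]
      calc _ = (p : ZMod (p ^ k)) ^ (k - a) * z * (↑u⁻¹ * ↑u) := by ring
        _ = _ := by rw [Units.inv_mul, mul_one]
  have h1 : Nat.card φ.range = p ^ a := by
    rw [Nat.card_congr (Equiv.subtypeEquivRight hrange), card_range_mul_pow hp]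
    congr 1; omega
  have h2 := card_fiber_mul_card_range φ
    ((hrange ((p : ZMod (p ^ k)) ^ (k - a))).2 ⟨1, by simp⟩)
  rw [h1, Nat.card_fun, card_zmod_pow, Nat.card_eq_fintype_card (α := ι)] at h2
  exact h2

lemma sum_map_sub_pred {s : Multiset ℕ} {a : ℕ} (ha : 1 ≤ a) (hs : ∀ b ∈ s, b ≤ a) :
    (s.map (· - (a - 1))).sum = s.count a := by
  induction s using Multiset.induction_on with
  | empty => simp
  | cons b s ih =>
    rw [Multiset.map_cons, Multiset.sum_cons, ih (fun c hc => hs c (Multiset.mem_cons_of_mem hc)),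
      Multiset.count_cons]
    have := hs b (Multiset.mem_cons_self b s)
    split_ifs <;> omega

/-- For a fixed alternating matrix `D` whose type has no element above `a`, the number of pairs of
vectors on which the form takes the value `p^(k-a)`: the first vector `e` has to satisfy
`p^(a-1) D e ≠ 0`, and the second one is then a solution of one linear equation. -/
lemma card_pairs_of_hasType {D : Matrix ι ι (ZMod (p ^ k))} (hD : IsAlt D) {s : Multiset ℕ}
    (hs : HasType D s) {a : ℕ} (ha : 1 ≤ a) (hak : a ≤ k) (hsa : ∀ b ∈ s, b ≤ a) :
    Nat.card {v : Fin 2 → ι → ZMod (p ^ k) //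
      v 0 ⬝ᵥ D *ᵥ v 1 = (p : ZMod (p ^ k)) ^ (k - a)} * p ^ (2 * s.count a) * p ^ a =
    (p ^ k) ^ (2 * Fintype.card ι) * (p ^ (2 * s.count a) - 1) := by
  classical
  have hp : p.Prime := Fact.out
  have hDa := (hs.pow_smul_eq_zero_iff hp a).2 hsa
  let W : Set (ι → ZMod (p ^ k)) := {e | (p : ZMod (p ^ k)) ^ (a - 1) • D *ᵥ e ≠ 0}
  let F (e : ι → ZMod (p ^ k)) : ℕ :=
    Nat.card {f : ι → ZMod (p ^ k) // f ⬝ᵥ -(D *ᵥ e) = (p : ZMod (p ^ k)) ^ (k - a)}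
  have hF (e : ι → ZMod (p ^ k)) : F e * p ^ a = if e ∈ W then (p ^ k) ^ Fintype.card ι else 0 := by
    have hz : (p : ZMod (p ^ k)) ^ a • -(D *ᵥ e) = 0 := by
      rw [smul_neg, ← Matrix.smul_mulVec, hDa, Matrix.zero_mulVec, neg_zero]
    split_ifs with h
    · exact card_dotProduct_eq ha hak hz (by rw [smul_neg]; exact neg_ne_zero.2 h)
    · have : IsEmpty {f : ι → ZMod (p ^ k) //
          f ⬝ᵥ -(D *ᵥ e) = (p : ZMod (p ^ k)) ^ (k - a)} := by
        refine ⟨fun ⟨f, hf⟩ => ?_⟩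
        have h0 : (p : ZMod (p ^ k)) ^ (a - 1) • D *ᵥ e = 0 := not_not.1 h
        have h1 : (p : ZMod (p ^ k)) ^ (a - 1) * (p : ZMod (p ^ k)) ^ (k - a) = 0 := by
          rw [← hf, dotProduct_neg, mul_neg, ← smul_eq_mul, ← dotProduct_smul, h0,
            dotProduct_zero, neg_zero]
        rw [← pow_add, natCast_prime_pow_eq_zero_iff hp] at h1
        omega
      simp only [F]
      rw [Nat.card_of_isEmpty, zero_mul]
  have hW : Nat.card W * p ^ (2 * s.count a) =
      (p ^ k) ^ Fintype.card ι * (p ^ (2 * s.count a) - 1) := by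
    have h1 := card_ker_mul_imCard ((p : ZMod (p ^ k)) ^ (a - 1) • D)
    rw [hs (a - 1), sum_map_sub_pred ha hsa, card_zmod_pow] at h1
    have h2 : Nat.card (LinearMap.ker ((p : ZMod (p ^ k)) ^ (a - 1) • D).mulVecLin) =
        Nat.card (Wᶜ : Set (ι → ZMod (p ^ k))) := by
      refine Nat.card_congr (Equiv.subtypeEquivRight fun e => ?_)
      simp [W]
    have h3 : Nat.card W + Nat.card (Wᶜ : Set (ι → ZMod (p ^ k))) =
        (p ^ k) ^ Fintype.card ι := by
      rw [Nat.card_coe_set_eq, Nat.card_coe_set_eq, Set.ncard_add_ncard_compl, Nat.card_fun,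
        card_zmod_pow, Nat.card_eq_fintype_card (α := ι)]
    rw [h2] at h1
    rw [Nat.mul_sub, mul_one]
    nth_rewrite 1 [← h3]
    rw [← h1, add_mul, Nat.add_sub_cancel]
  have hsum : Nat.card {v : Fin 2 → ι → ZMod (p ^ k) //
      v 0 ⬝ᵥ D *ᵥ v 1 = (p : ZMod (p ^ k)) ^ (k - a)} = ∑ e, F e := by
    rw [← Nat.card_sigma]
    refine Nat.card_congr ⟨fun v => ⟨v.1 0, v.1 1, ?_⟩, fun x => ⟨![x.1, x.2.1], ?_⟩, ?_, ?_⟩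
    · rw [dotProduct_neg, ← hD.dotProduct_mulVec_swap, v.2]
    · have := x.2.2
      rwa [dotProduct_neg, ← hD.dotProduct_mulVec_swap] at this
    · rintro ⟨v, hv⟩
      refine Subtype.ext (funext fun i => ?_)
      fin_cases i <;> rfl
    · rintro ⟨e, f, hf⟩
      rfl
  calc _ = (∑ e, F e * p ^ a) * p ^ (2 * s.count a) := by rw [hsum, ← Finset.sum_mul]; ring
    _ = Nat.card W * p ^ (2 * s.count a) * (p ^ k) ^ Fintype.card ι := by
      simp only [hF]
      rw [← Finset.sum_filter, Finset.sum_const, smul_eq_mul, Nat.card_eq_fintype_card,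
        ← Set.toFinset_card]
      have : Finset.univ.filter (· ∈ W) = W.toFinset := by ext; simp
      rw [this]; ring
    _ = _ := by rw [hW]; ring

lemma card_dvd_matrices {a n : ℕ} (hak : a ≤ k) :
    Nat.card (Fin 2 → Fin n →
      LinearMap.range (LinearMap.mulLeft (ZMod (p ^ k)) ((p : ZMod (p ^ k)) ^ (k - a)))) =
      p ^ (2 * a * n) := by
  rw [Nat.card_fun, Nat.card_fun, card_range_mul_pow Fact.out]
  simp only [Nat.card_eq_fintype_card, Fintype.card_fin]
  rw [← pow_mul, ← pow_mul, show k - (k - a) = a by omega]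
  ring_nf

/-- For the first two basis vectors, the alternating matrices of type `a ::ₘ s` with value
`p^(k-a)` on this pair are given by the remaining entries of the first two rows, which are
arbitrary multiples of `p^(k-a)`, and an alternating matrix of type `s`. -/
lemma card_block_matrices {a n : ℕ} (hak : a ≤ k) {s : Multiset ℕ} (hsa : ∀ b ∈ s, b ≤ a) :
    Nat.card {D : Matrix (Fin 2 ⊕ Fin n) (Fin 2 ⊕ Fin n) (ZMod (p ^ k)) //
      (IsAlt D ∧ HasType D (a ::ₘ s)) ∧
        D (Sum.inl 0) (Sum.inl 1) = (p : ZMod (p ^ k)) ^ (k - a)} =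
    p ^ (2 * a * n) * typeCount p k n s := by
  have hp : p.Prime := Fact.out
  rw [← card_dvd_matrices hak, typeCount, ← Nat.card_prod]
  symm
  set d := (p : ZMod (p ^ k)) ^ (k - a) with hd
  -- an arbitrary choice of quotients by `d`; only `d • X Z` matters
  let X (Z : Fin 2 → Fin n → LinearMap.range (LinearMap.mulLeft (ZMod (p ^ k)) d)) :
    Matrix (Fin 2) (Fin n) (ZMod (p ^ k)) := Matrix.of fun i j => (Z i j).2.choose
  have hX (Z) : d • X Z = Matrix.of fun i j => (Z i j : ZMod (p ^ k)) := by
    ext i j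
    exact (Z i j).2.choose_spec
  let B (Z : Fin 2 → Fin n → LinearMap.range (LinearMap.mulLeft (ZMod (p ^ k)) d)) :
      Matrix (Fin n) (Fin n) (ZMod (p ^ k)) :=
    Matrix.transpose (X Z) * J₂ (ZMod (p ^ k)) * X Z
  let G (Z : Fin 2 → Fin n → LinearMap.range (LinearMap.mulLeft (ZMod (p ^ k)) d))
    (E : Matrix (Fin n) (Fin n) (ZMod (p ^ k))) :=
    Matrix.fromBlocks (d • J₂ _) (d • X Z) (-(d • X Z)ᵀ) (E + d • B Z)
  have hG (Z E) : Cong (G Z E) (Matrix.fromBlocks (d • J₂ _) 0 0 E) := by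
    have := cong_fromBlocks d (X Z) (E + d • B Z)
    rwa [show E + d • B Z - d • (Matrix.transpose (X Z) * J₂ (ZMod (p ^ k)) * X Z) = E from
      add_sub_cancel_right _ _] at this
  have hGp (Z E) : (IsAlt (G Z E) ∧ HasType (G Z E) (a ::ₘ s)) ↔ (IsAlt E ∧ HasType E s) := by
    refine and_congr ?_ ?_
    · rw [← isAlt_fromBlocks_zero_iff (d := d) (E := E)]
      exact ⟨(hG Z E).isAlt, (hG Z E).symm.isAlt⟩
    · rw [(hG Z E).hasType_iff, hasType_cons_iff hp hak]
  refine Nat.card_congr (Equiv.ofBijective (fun x => ⟨G x.1 x.2.1, (hGp _ _).2 x.2.2, ?_⟩) ⟨?_, ?_⟩)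
  · simp [G, J₂]
  · rintro ⟨Z, E, hE⟩ ⟨Z', E', hE'⟩ h
    simp only [Subtype.mk.injEq, G, Matrix.fromBlocks_inj] at h
    obtain ⟨-, h1, -, h2⟩ := h
    have hZ : Z = Z' := by
      rw [hX, hX] at h1
      funext i j
      exact Subtype.ext (congrFun (congrFun h1 i) j)
    subst hZ
    simpa using h2
  · rintro ⟨D, ⟨hDalt, hDtype⟩, hD01⟩
    have hDa : (p : ZMod (p ^ k)) ^ a • D = 0 := (hDtype.pow_smul_eq_zero_iff hp a).2 (by
      intro b hb
      rcases Multiset.mem_cons.1 hb with rfl | hb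
      exacts [le_rfl, hsa b hb])
    obtain ⟨Y, hY⟩ := exists_smul_of_pow_smul_eq_zero (Z := D.toBlocks₁₂) hak
      (fun i j => congrFun (congrFun hDa (Sum.inl i)) (Sum.inr j))
    let Z : Fin 2 → Fin n → LinearMap.range (LinearMap.mulLeft (ZMod (p ^ k)) d) :=
      fun i j => ⟨D.toBlocks₁₂ i j, Y i j, by rw [hY]; rfl⟩
    have hZ : d • X Z = D.toBlocks₁₂ := by rw [hX]; rfl
    have hGZ : G Z (D.toBlocks₂₂ - d • B Z) = D := by
      simp only [G]
      rw [hZ, sub_add_cancel]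
      exact (hDalt.eq_fromBlocks hD01).symm
    refine ⟨⟨Z, _, (hGp Z _).1 ?_⟩, Subtype.ext hGZ⟩
    rw [hGZ]
    exact ⟨hDalt, hDtype⟩

/-- The count for the first two basis vectors carries over to every pair that is linearly independent
modulo `p`, by a change of basis. -/
lemma card_matrices_of_pair {a n : ℕ} (ha : 1 ≤ a) (hak : a ≤ k) {s : Multiset ℕ}
    (hsa : ∀ b ∈ s, b ≤ a) (hn : Fintype.card ι = n + 2) {v : Fin 2 → ι → ZMod (p ^ k)}
    (hv : LinearIndependent (ZMod p) fun i => redHom p (ha.trans hak) ∘ v i) :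
    Nat.card {D : Matrix ι ι (ZMod (p ^ k)) //
      (IsAlt D ∧ HasType D (a ::ₘ s)) ∧ v 0 ⬝ᵥ D *ᵥ v 1 = (p : ZMod (p ^ k)) ^ (k - a)} =
    p ^ (2 * a * n) * typeCount p k n s := by
  rw [← card_block_matrices hak hsa]
  obtain ⟨P, Q, hPQ, hQP, hP⟩ := exists_invertible_extension _ hn hv
  have hQP' : Pᵀ * Qᵀ = 1 := by rw [← Matrix.transpose_mul, hQP, Matrix.transpose_one]
  have hPQ' : Qᵀ * Pᵀ = 1 := by rw [← Matrix.transpose_mul, hPQ, Matrix.transpose_one]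
  have hcong (D : Matrix ι ι (ZMod (p ^ k))) : Cong D (Pᵀ * D * P) := ⟨P, Q, hPQ, hQP, rfl⟩
  refine Nat.card_congr (Equiv.subtypeEquiv
    ⟨fun D => Pᵀ * D * P, fun D => Qᵀ * D * Q,
      fun D => by
        calc Qᵀ * (Pᵀ * D * P) * Q = (Qᵀ * Pᵀ) * D * (P * Q) := by simp only [Matrix.mul_assoc]
          _ = D := by rw [hPQ, hPQ']; simp,
      fun D => by
        calc Pᵀ * (Qᵀ * D * Q) * P = (Pᵀ * Qᵀ) * D * (Q * P) := by simp only [Matrix.mul_assoc]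
          _ = D := by rw [hQP, hQP']; simp⟩ fun D => ?_)
  refine and_congr (and_congr ⟨(hcong D).isAlt, (hcong D).symm.isAlt⟩ (hcong D).hasType_iff) ?_
  simp only [Equiv.coe_fn_mk]
  rw [transpose_mul_mul_apply, hP, hP]

/-- Pairs of vectors over `ℤ/p^k` that are linearly independent modulo `p`: the linearly independent
pairs over the field `ℤ/p`, each with all of its lifts. -/
lemma card_linearIndependent_redHom (hk : 1 ≤ k) {n : ℕ} (hn : Fintype.card ι = n + 2) :
    Nat.card {v : Fin 2 → ι → ZMod (p ^ k) //
      LinearIndependent (ZMod p) fun i => redHom p hk ∘ v i} =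
    (p ^ (k - 1)) ^ (2 * (n + 2)) * ((p ^ (n + 2) - 1) * (p ^ (n + 2) - p)) := by
  have hp : p.Prime := Fact.out
  have h1 (x : ZMod p) : Nat.card {y // redHom p hk y = x} = p ^ (k - 1) := by
    have hr : (redHom p hk).toAddMonoidHom.range = ⊤ :=
      AddMonoidHom.range_eq_top.2 (redHom_surjective hk)
    have := card_fiber_mul_card_range (redHom p hk).toAddMonoidHom (b := x) (by rw [hr]; trivial)
    rw [hr, AddSubgroup.card_top, card_zmod_pow, Nat.card_zmod] at this
    have h2 : p ^ k = p ^ (k - 1) * p := by rw [← pow_succ]; congr 1; omega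
    exact Nat.eq_of_mul_eq_mul_right hp.pos (this.trans h2)
  let e : ZMod (p ^ k) ≃ ZMod p × Fin (p ^ (k - 1)) :=
    (Equiv.sigmaFiberEquiv (redHom p hk)).symm.trans
      ((Equiv.sigmaCongrRight fun x => Finite.equivFinOfCardEq (h1 x)).trans
        (Equiv.sigmaEquivProd _ _))
  have he (y) : (e y).1 = redHom p hk y := rfl
  let Φ : (Fin 2 → ι → ZMod (p ^ k)) ≃
      (Fin 2 → ι → ZMod p) × (Fin 2 → ι → Fin (p ^ (k - 1))) :=
    ⟨fun v => (fun i j => (e (v i j)).1, fun i j => (e (v i j)).2),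
      fun x i j => e.symm (x.1 i j, x.2 i j), fun v => by simp, fun x => by simp⟩
  have h2 : Nat.card {v : Fin 2 → ι → ZMod (p ^ k) //
      LinearIndependent (ZMod p) fun i => redHom p hk ∘ v i} =
      Nat.card ({v : Fin 2 → ι → ZMod p // LinearIndependent (ZMod p) v} ×
        (Fin 2 → ι → Fin (p ^ (k - 1)))) := by
    refine Nat.card_congr ((Equiv.subtypeEquiv Φ fun v => ?_).trans
      (Equiv.prodSubtypeFstEquivSubtypeProd (p := fun v => LinearIndependent (ZMod p) v)))
    rfl
  have hfr : Module.finrank (ZMod p) (ι → ZMod p) = n + 2 := by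
    rw [Module.finrank_fintype_fun_eq_card, hn]
  rw [h2, Nat.card_prod, card_linearIndependent (by omega), hfr, Nat.card_fun, Nat.card_fun]
  simp only [Nat.card_eq_fintype_card, Fintype.card_fin, ZMod.card, hn, Fin.prod_univ_two,
    Fin.val_zero, Fin.val_one, pow_zero, pow_one]
  rw [← pow_mul]
  ring

/-- The recursion for the number of alternating matrices of a given type, by double counting of
the triples of a matrix and two vectors on which the form takes the value `p^(k-a)`. -/
lemma typeCount_cons {a n : ℕ} (ha : 1 ≤ a) (hak : a ≤ k) {s : Multiset ℕ}
    (hsa : ∀ b ∈ s, b ≤ a) :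
    typeCount p k (n + 2) (a ::ₘ s) *
        ((p ^ k) ^ (2 * (n + 2)) * (p ^ (2 * (s.count a + 1)) - 1)) =
      (p ^ (k - 1)) ^ (2 * (n + 2)) * ((p ^ (n + 2) - 1) * (p ^ (n + 2) - p)) *
        (p ^ (2 * a * n) * typeCount p k n s) * p ^ (2 * (s.count a + 1)) * p ^ a := by
  classical
  have hp : p.Prime := Fact.out
  have hk := ha.trans hak
  have hsa' : ∀ b ∈ a ::ₘ s, b ≤ a := by
    intro b hb
    rcases Multiset.mem_cons.1 hb with rfl | hb
    exacts [le_rfl, hsa b hb]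
  let S : Finset (Matrix (Fin (n + 2)) (Fin (n + 2)) (ZMod (p ^ k))) :=
    Finset.univ.filter fun D => IsAlt D ∧ HasType D (a ::ₘ s)
  -- the pairs that occur are linearly independent modulo `p`, by `linearIndependent_redHom`
  let V : Finset (Fin 2 → Fin (n + 2) → ZMod (p ^ k)) :=
    Finset.univ.filter fun v => LinearIndependent (ZMod p) fun i => redHom p hk ∘ v i
  let r (D : Matrix (Fin (n + 2)) (Fin (n + 2)) (ZMod (p ^ k)))
    (v : Fin 2 → Fin (n + 2) → ZMod (p ^ k)) : Prop :=
    v 0 ⬝ᵥ D *ᵥ v 1 = (p : ZMod (p ^ k)) ^ (k - a)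
  have hS : S.card = typeCount p k (n + 2) (a ::ₘ s) := by
    rw [typeCount, Nat.card_eq_fintype_card, Fintype.card_subtype]
  have hV : V.card = (p ^ (k - 1)) ^ (2 * (n + 2)) * ((p ^ (n + 2) - 1) * (p ^ (n + 2) - p)) := by
    rw [← card_linearIndependent_redHom (ι := Fin (n + 2)) hk (by simp),
      Nat.card_eq_fintype_card, Fintype.card_subtype]
  have h1 (D) (hD : D ∈ S) : (V.bipartiteAbove r D).card * (p ^ (2 * (s.count a + 1)) * p ^ a) =
      (p ^ k) ^ (2 * (n + 2)) * (p ^ (2 * (s.count a + 1)) - 1) := by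
    obtain ⟨hD1, hD2⟩ := (Finset.mem_filter.1 hD).2
    have h := card_pairs_of_hasType hD1 hD2 ha hak hsa'
    rw [Multiset.count_cons_self, Fintype.card_fin] at h
    rw [← h, mul_assoc]
    congr 1
    rw [Nat.card_eq_fintype_card, Fintype.card_subtype]
    congr 1
    ext v
    simp only [Finset.mem_bipartiteAbove, V, Finset.mem_filter, Finset.mem_univ, true_and, r,
      and_iff_right_iff_imp]
    exact linearIndependent_redHom hD1 ha hak ((hD2.pow_smul_eq_zero_iff hp a).2 hsa')
  have h2 (v) (hv : v ∈ V) : (S.bipartiteBelow r v).card =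
      p ^ (2 * a * n) * typeCount p k n s := by
    rw [← card_matrices_of_pair ha hak hsa (by simp) (Finset.mem_filter.1 hv).2,
      Nat.card_eq_fintype_card, Fintype.card_subtype]
    congr 1
    ext D
    simp [Finset.mem_bipartiteBelow, S, r]
  have h3 := Finset.sum_card_bipartiteAbove_eq_sum_card_bipartiteBelow (s := S) (t := V) r
  rw [Finset.sum_congr rfl h2, Finset.sum_const, smul_eq_mul, hV] at h3
  have h4 := congrArg (· * (p ^ (2 * (s.count a + 1)) * p ^ a)) h3
  simp only [Finset.sum_mul] at h4
  rw [Finset.sum_congr rfl h1, Finset.sum_const, smul_eq_mul, hS] at h4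
  rw [h4]; ring

lemma typeCount_zero (n : ℕ) : typeCount p k n 0 = 1 := by
  rw [typeCount, Nat.card_eq_one_iff_unique]
  refine ⟨⟨fun x y => Subtype.ext ?_⟩,
    ⟨⟨0, ⟨by simp, by simp⟩, (hasType_zero_iff Fact.out _).2 rfl⟩⟩⟩
  rw [(hasType_zero_iff Fact.out _).1 x.2.2, (hasType_zero_iff Fact.out _).1 y.2.2]

end Counting

/-! ### The closed formula and the standard matrices -/

section Formula

lemma card_filter_le_eq_count {s : Multiset ℕ} {a : ℕ} (hsa : ∀ b ∈ s, b ≤ a) :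
    (s.filter fun b => a ≤ b).card = s.count a := by
  rw [Multiset.count_eq_card_filter_eq]
  congr 1
  exact Multiset.filter_congr fun b hb => ⟨fun h => le_antisymm h (hsa b hb), fun h => h.le⟩

lemma card_filter_lt_eq_zero {s : Multiset ℕ} {a : ℕ} (hsa : ∀ b ∈ s, b ≤ a) :
    (s.filter fun b => a < b).card = 0 := by
  rw [Multiset.card_eq_zero, Multiset.filter_eq_nil]
  exact fun b hb => not_lt.2 (hsa b hb)

lemma sBefore_cons_of_lt {n a b : ℕ} (s : Multiset ℕ) (h : b < a) :
    sBefore (n + 2) (a ::ₘ s) b = sBefore n s b := by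
  rw [sBefore, sBefore, Multiset.filter_cons_of_pos (p := fun c => b < c) _ h, Multiset.card_cons]
  omega

lemma sAt_cons_of_le {n a b : ℕ} (s : Multiset ℕ) (h : b ≤ a) :
    sAt (n + 2) (a ::ₘ s) b = sAt n s b := by
  rw [sAt, sAt, Multiset.filter_cons_of_pos (p := fun c => b ≤ c) _ h, Multiset.card_cons]
  omega

/-- The exponent of `p` in `Np` changes only in the summand of the largest part `a`. For a new part
`a` the summand of `s` is zero, although its last factor may be a truncated difference. -/
lemma exponent_cons {n a : ℕ} {s : Multiset ℕ} (hsa : ∀ b ∈ s, b ≤ a) (hn : 2 * s.card ≤ n) :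
    ∑ b ∈ (a ::ₘ s).toFinset, (a ::ₘ s).count b * b *
        (sBefore (n + 2) (a ::ₘ s) b + sAt (n + 2) (a ::ₘ s) b - 1) =
      a * (2 * n + 1) + ∑ b ∈ s.toFinset, s.count b * b * (sBefore n s b + sAt n s b - 1) := by
  have hins : ∑ b ∈ s.toFinset, s.count b * b * (sBefore n s b + sAt n s b - 1) =
      ∑ b ∈ insert a s.toFinset, s.count b * b * (sBefore n s b + sAt n s b - 1) := by
    refine Finset.sum_subset (Finset.subset_insert _ _) fun b _ hb => ?_
    rw [Multiset.mem_toFinset] at hb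
    rw [Multiset.count_eq_zero_of_notMem hb, zero_mul, zero_mul]
  have hmem : a ∈ insert a s.toFinset := Finset.mem_insert_self _ _
  rw [hins, Multiset.toFinset_cons, ← Finset.add_sum_erase _ _ hmem,
    ← Finset.add_sum_erase (insert a s.toFinset)
      (fun b => s.count b * b * (sBefore n s b + sAt n s b - 1)) hmem, ← add_assoc]
  congr 1
  · have hc : s.count a ≤ s.card := Multiset.count_le_card _ _
    rw [Multiset.count_cons_self, sAt_cons_of_le s le_rfl, sBefore, sBefore, sAt,
      card_filter_le_eq_count hsa, card_filter_lt_eq_zero hsa,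
      Multiset.filter_cons_of_neg (p := fun b => a < b) _ (lt_irrefl a),
      card_filter_lt_eq_zero hsa]
    generalize s.count a = c at hc
    obtain ⟨r, rfl⟩ : ∃ r, n = 2 * c + r := ⟨n - 2 * c, by omega⟩
    rcases c with _ | c
    · simp only [Nat.mul_zero, Nat.zero_add, Nat.sub_zero, zero_mul, one_mul, Nat.add_zero]
      congr 1
      omega
    · rw [show 2 * (c + 1) + r + 2 - 2 * 0 + (2 * (c + 1) + r - 2 * (c + 1)) - 1 =
        2 * c + 2 * r + 3 by omega, show 2 * (c + 1) + r - 2 * 0 +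
        (2 * (c + 1) + r - 2 * (c + 1)) - 1 = 2 * c + 2 * r + 1 by omega]
      ring
  · refine Finset.sum_congr rfl fun b hb => ?_
    obtain ⟨hba, hb⟩ := Finset.mem_erase.1 hb
    have hbs : b ∈ s := by simpa [hba] using hb
    have hlt : b < a := lt_of_le_of_ne (hsa b hbs) hba
    rw [Multiset.count_cons_of_ne hba, sBefore_cons_of_lt s hlt, sAt_cons_of_le s hlt.le]

lemma denominator_cons {p a : ℕ} (s : Multiset ℕ) :
    ∏ b ∈ (a ::ₘ s).toFinset, ∏ l ∈ Finset.Icc 1 ((a ::ₘ s).count b), (1 - 1 / (p : ℚ) ^ (2 * l)) =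
      (∏ b ∈ s.toFinset, ∏ l ∈ Finset.Icc 1 (s.count b), (1 - 1 / (p : ℚ) ^ (2 * l))) *
        (1 - 1 / (p : ℚ) ^ (2 * (s.count a + 1))) := by
  have hins : ∏ b ∈ s.toFinset, ∏ l ∈ Finset.Icc 1 (s.count b), (1 - 1 / (p : ℚ) ^ (2 * l)) =
      ∏ b ∈ insert a s.toFinset, ∏ l ∈ Finset.Icc 1 (s.count b), (1 - 1 / (p : ℚ) ^ (2 * l)) := by
    refine Finset.prod_subset (Finset.subset_insert _ _) fun b _ hb => ?_
    rw [Multiset.mem_toFinset] at hb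
    rw [Multiset.count_eq_zero_of_notMem hb]
    simp
  have hmem : a ∈ insert a s.toFinset := Finset.mem_insert_self _ _
  rw [hins, Multiset.toFinset_cons, ← Finset.mul_prod_erase _ _ hmem,
    ← Finset.mul_prod_erase (insert a s.toFinset)
      (fun b => ∏ l ∈ Finset.Icc 1 (s.count b), (1 - 1 / (p : ℚ) ^ (2 * l))) hmem,
    Multiset.count_cons_self, Finset.prod_Icc_succ_top (by omega)]
  have : ∏ b ∈ (insert a s.toFinset).erase a,
      ∏ l ∈ Finset.Icc 1 ((a ::ₘ s).count b), (1 - 1 / (p : ℚ) ^ (2 * l)) =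
      ∏ b ∈ (insert a s.toFinset).erase a,
      ∏ l ∈ Finset.Icc 1 (s.count b), (1 - 1 / (p : ℚ) ^ (2 * l)) :=
    Finset.prod_congr rfl fun b hb => by
      rw [Multiset.count_cons_of_ne (Finset.mem_erase.1 hb).1]
  rw [this]; ring

lemma one_sub_one_div_pow_ne_zero {p l : ℕ} (hp : p.Prime) (hl : l ≠ 0) :
    (1 - 1 / (p : ℚ) ^ l) ≠ 0 := by
  have h1 : (1 : ℚ) < (p : ℚ) ^ l := one_lt_pow₀ (by exact_mod_cast hp.one_lt) hl
  have h2 : 1 / (p : ℚ) ^ l < 1 := by rw [div_lt_one (by linarith)]; exact h1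
  linarith

/-- The numbers `N_p(α)` satisfy the same recursion as the numbers of alternating matrices of a
given type. -/
lemma Np_cons {n p a : ℕ} (hp : p.Prime) {s : Multiset ℕ} (hsa : ∀ b ∈ s, b ≤ a)
    (hn : 2 * s.card ≤ n) :
    Np (n + 2) p (a ::ₘ s) * (1 - 1 / (p : ℚ) ^ (2 * (s.count a + 1))) =
      (p : ℚ) ^ (a * (2 * n + 1)) * (1 - 1 / (p : ℚ) ^ (n + 1)) * (1 - 1 / (p : ℚ) ^ (n + 2)) *
        Np n p s := by
  rw [Np, Np, exponent_cons hsa hn, denominator_cons, Multiset.card_cons,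
    show n + 2 - 2 * (s.card + 1) + 1 = n - 2 * s.card + 1 by omega,
    Finset.prod_Icc_succ_top (by omega), Finset.prod_Icc_succ_top (by omega), pow_add]
  have h1 := one_sub_one_div_pow_ne_zero (l := 2 * (s.count a + 1)) hp (by omega)
  have h2 : ∏ b ∈ s.toFinset, ∏ l ∈ Finset.Icc 1 (s.count b), (1 - 1 / (p : ℚ) ^ (2 * l)) ≠ 0 :=
    Finset.prod_ne_zero_iff.2 fun b _ => Finset.prod_ne_zero_iff.2 fun l hl =>
      one_sub_one_div_pow_ne_zero hp (by have := (Finset.mem_Icc.1 hl).1; omega)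
  generalize (1 - 1 / (p : ℚ) ^ (2 * (s.count a + 1))) = x at *
  generalize (∏ b ∈ s.toFinset, ∏ l ∈ Finset.Icc 1 (s.count b), (1 - 1 / (p : ℚ) ^ (2 * l))) = y
    at *
  rw [← div_div, div_mul_cancel₀ _ h1]
  ring

lemma Np_zero (n p : ℕ) : Np n p 0 = 1 := by simp [Np]

variable {p k : ℕ} [Fact p.Prime]

lemma typeCount_cons_rat {a n : ℕ} (ha : 1 ≤ a) (hak : a ≤ k) {s : Multiset ℕ}
    (hsa : ∀ b ∈ s, b ≤ a) :
    (typeCount p k (n + 2) (a ::ₘ s) : ℚ) * (1 - 1 / (p : ℚ) ^ (2 * (s.count a + 1))) =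
      (p : ℚ) ^ (a * (2 * n + 1)) * (1 - 1 / (p : ℚ) ^ (n + 1)) * (1 - 1 / (p : ℚ) ^ (n + 2)) *
        typeCount p k n s := by
  have hp : p.Prime := Fact.out
  have hp0 : (p : ℚ) ≠ 0 := by exact_mod_cast hp.ne_zero
  have h := congrArg (Nat.cast : ℕ → ℚ) (typeCount_cons (p := p) (k := k) (n := n) ha hak hsa)
  have e1 : p ≤ p ^ (n + 2) := Nat.le_self_pow (by omega) p
  push_cast [Nat.cast_sub e1, Nat.cast_sub (Nat.one_le_pow _ p hp.pos)] at h
  obtain ⟨k, rfl⟩ : ∃ k', k = k' + 1 := ⟨k - 1, by omega⟩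
  rw [Nat.add_sub_cancel, pow_succ, mul_pow] at h
  have hq : ((p : ℚ) ^ k) ^ (2 * (n + 2)) ≠ 0 := pow_ne_zero _ (pow_ne_zero _ hp0)
  have hP : (p : ℚ) ^ (2 * (s.count a + 1)) ≠ 0 := pow_ne_zero _ hp0
  have e2 : (p : ℚ) ^ (2 * a * n) * (p : ℚ) ^ a = (p : ℚ) ^ (a * (2 * n + 1)) := by
    rw [← pow_add]; ring_nf
  have h2 : ((p : ℚ) ^ k) ^ (2 * (n + 2)) * (typeCount p (k + 1) (n + 2) (a ::ₘ s) *
      (p ^ (2 * (n + 2)) * ((p : ℚ) ^ (2 * (s.count a + 1)) - 1))) =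
      ((p : ℚ) ^ k) ^ (2 * (n + 2)) * (((p : ℚ) ^ (n + 2) - 1) * ((p : ℚ) ^ (n + 2) - p) *
        (p : ℚ) ^ (a * (2 * n + 1)) * typeCount p (k + 1) n s *
        (p : ℚ) ^ (2 * (s.count a + 1))) := by
    rw [← e2]; linear_combination h
  have h3 := mul_left_cancel₀ hq h2
  have e3 : (p : ℚ) ^ (2 * (n + 2)) = (p : ℚ) ^ (n + 2) * (p * (p : ℚ) ^ (n + 1)) := by ring
  have e4 : (p : ℚ) ^ (n + 2) - p = p * ((p : ℚ) ^ (n + 1) - 1) := by ring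
  rw [e3, e4] at h3
  generalize (p : ℚ) ^ (2 * (s.count a + 1)) = P at *
  have h5 : (p : ℚ) ^ (n + 2) ≠ 0 := pow_ne_zero _ hp0
  have h6 : (p : ℚ) ^ (n + 1) ≠ 0 := pow_ne_zero _ hp0
  generalize (p : ℚ) ^ (n + 2) = X at *
  generalize (p : ℚ) ^ (n + 1) = Y at *
  generalize (p : ℚ) ^ (a * (2 * n + 1)) = Z at *
  field_simp
  refine mul_left_cancel₀ hp0 ?_
  linear_combination h3

lemma exists_eq_cons_max {s : Multiset ℕ} (hs : s ≠ 0) :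
    ∃ a t, s = a ::ₘ t ∧ ∀ b ∈ t, b ≤ a := by
  obtain ⟨c, hc⟩ := Multiset.exists_mem_of_ne_zero hs
  have hne : s.toFinset.Nonempty := ⟨c, by simpa using hc⟩
  have ha : s.toFinset.max' hne ∈ s := by simpa using s.toFinset.max'_mem hne
  refine ⟨_, s.erase (s.toFinset.max' hne), (Multiset.cons_erase ha).symm, fun b hb => ?_⟩
  exact s.toFinset.le_max' b (by simpa using Multiset.mem_of_mem_erase hb)

/-- Induction on the type, removing the largest element. -/
theorem typeCount_eq_Np {n : ℕ} {s : Multiset ℕ} (hs : ∀ b ∈ s, 1 ≤ b ∧ b ≤ k)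
    (hn : 2 * s.card ≤ n) : (typeCount p k n s : ℚ) = Np n p s := by
  have hp : p.Prime := Fact.out
  induction hc : s.card generalizing s n with
  | zero =>
    rw [Multiset.card_eq_zero.1 hc, typeCount_zero, Np_zero, Nat.cast_one]
  | succ c ih =>
    have hs0 : s ≠ 0 := by rintro rfl; simp at hc
    obtain ⟨a, t, rfl, ht⟩ := exists_eq_cons_max hs0
    rw [Multiset.card_cons] at hc hn
    obtain ⟨m, rfl⟩ : ∃ m, n = m + 2 := ⟨n - 2, by omega⟩
    obtain ⟨ha, hak⟩ := hs a (Multiset.mem_cons_self a t)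
    have h := ih (n := m) (fun b hb => hs b (Multiset.mem_cons_of_mem hb)) (by omega) (by omega)
    refine mul_right_cancel₀
      (one_sub_one_div_pow_ne_zero (l := 2 * (t.count a + 1)) hp (by omega)) ?_
    rw [typeCount_cons_rat ha hak ht, Np_cons hp ht (by omega), h]

end Formula

section StandardForm

variable {R : Type*} [CommRing R]

/-- The image of a monomial matrix is the product of the principal ideals of its entries. -/
lemma imCard_monomial {ι : Type*} [Fintype ι] [DecidableEq ι] (π : Equiv.Perm ι) (c : ι → R)
    {D : Matrix ι ι R} (hD : ∀ i j, D i j = if j = π i then c i else 0) :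
    imCard D = ∏ i, Nat.card (LinearMap.range (LinearMap.mulLeft R (c i))) := by
  have hmv (v : ι → R) (i : ι) : (D *ᵥ v) i = c i * v (π i) := by
    simp [Matrix.mulVec, dotProduct, hD]
  rw [imCard, ← Nat.card_pi]
  refine Nat.card_congr (Equiv.ofBijective (fun x i => ⟨x.1 i, ?_⟩) ⟨?_, ?_⟩)
  · obtain ⟨_, v, rfl⟩ := x
    exact ⟨v (π i), (hmv v i).symm⟩
  · rintro ⟨x, _⟩ ⟨y, _⟩ h
    refine Subtype.ext (funext fun i => ?_)
    exact congrArg Subtype.val (congrFun h i)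
  · intro x
    choose w hw using fun i => (x i).2
    refine ⟨⟨_, fun i => w (π.symm i), rfl⟩, ?_⟩
    funext i
    refine Subtype.ext ?_
    rw [← hw i]
    simp [hmv]

lemma isAlt_stdSkew (n : ℕ) {A : Type*} [AddCommGroup A] (d : List A) : IsAlt (stdSkew n d) := by
  refine ⟨fun i j => ?_, fun i => ?_⟩
  · simp only [stdSkew, Matrix.of_apply]
    by_cases h1 : (j : ℕ) < d.length ∧ (i : ℕ) = j + d.length
    · simp [h1]
    · by_cases h2 : (i : ℕ) < d.length ∧ (j : ℕ) = i + d.length <;> simp [h1, h2]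
  · have h1 : ¬((i : ℕ) < d.length ∧ (i : ℕ) = i + d.length) := by omega
    rw [stdSkew, Matrix.of_apply, dif_neg h1, dif_neg h1]

/-- The involution of `Fin n` that exchanges `i` and `i + t` for `i < t`. -/
def swapPerm (n t : ℕ) (h : 2 * t ≤ n) : Equiv.Perm (Fin n) :=
  Function.Involutive.toPerm
    (fun i => ⟨if (i : ℕ) < t then i + t else if (i : ℕ) < 2 * t then i - t else i, by
      split_ifs <;> omega⟩)
    (fun i => by ext; simp only; split_ifs <;> omega)

lemma swapPerm_val {n t : ℕ} (h : 2 * t ≤ n) (i : Fin n) :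
    ((swapPerm n t h i : Fin n) : ℕ) =
      if (i : ℕ) < t then (i : ℕ) + t else if (i : ℕ) < 2 * t then i - t else i := rfl

/-- The standard skew matrix is monomial. -/
lemma stdSkew_apply {n : ℕ} (d : List R) (h : 2 * d.length ≤ n) (i j : Fin n) :
    stdSkew n d i j = if j = swapPerm n d.length h i then
      (if (i : ℕ) < d.length then -d.getD i 0 else d.getD (i - d.length) 0) else 0 := by
  simp only [stdSkew, Matrix.of_apply, Fin.ext_iff, swapPerm_val]
  by_cases h1 : (i : ℕ) < d.length
  · have h2 : ¬((j : ℕ) < d.length ∧ (i : ℕ) = j + d.length) := by omega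
    by_cases h3 : (j : ℕ) = i + d.length <;> simp [h1, h2, h3]
  · by_cases h2 : (i : ℕ) < 2 * d.length
    · by_cases h3 : (j : ℕ) = i - d.length
      · have h4 : (j : ℕ) < d.length ∧ (i : ℕ) = j + d.length := by omega
        rw [dif_pos h4, if_neg h1, if_pos h2, if_pos h3, if_neg h1, ← h3,
          List.getD_eq_getElem _ _ h4.1]
      · have h4 : ¬((j : ℕ) < d.length ∧ (i : ℕ) = j + d.length) := by omega
        simp [h1, h2, h3, h4]
    · have h4 : ¬((j : ℕ) < d.length ∧ (i : ℕ) = j + d.length) := by omega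
      have h5 : d.length ≤ (i : ℕ) - d.length := by omega
      simp [h1, h4, List.getElem?_eq_none h5]

lemma card_range_mulLeft_neg (x : R) :
    Nat.card (LinearMap.range (LinearMap.mulLeft R (-x))) =
      Nat.card (LinearMap.range (LinearMap.mulLeft R x)) := by
  refine Nat.card_congr (Equiv.subtypeEquivRight fun y => ?_)
  constructor
  · rintro ⟨z, rfl⟩; exact ⟨-z, by simp⟩
  · rintro ⟨z, rfl⟩; exact ⟨-z, by simp⟩

lemma card_range_mulLeft_zero :
    Nat.card (LinearMap.range (LinearMap.mulLeft R (0 : R))) = 1 := by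
  rw [LinearMap.mulLeft_zero_eq_zero, LinearMap.range_zero]
  simp

lemma imCard_smul_stdSkew {n : ℕ} (c : R) (d : List R) (h : 2 * d.length ≤ n) :
    imCard (c • stdSkew n d) =
      (d.map fun x => Nat.card (LinearMap.range (LinearMap.mulLeft R (c * x)))).prod ^ 2 := by
  rw [imCard_monomial (swapPerm n d.length h) (fun i => c *
    (if (i : ℕ) < d.length then -d.getD i 0 else d.getD (i - d.length) 0)) (fun i j => by
      rw [Matrix.smul_apply, stdSkew_apply d h, smul_eq_mul, mul_ite, mul_zero])]
  obtain ⟨r, hr⟩ : ∃ r, n = d.length + d.length + r := ⟨n - 2 * d.length, by omega⟩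
  rw [Finset.prod_fin_eq_prod_range]
  rw [Finset.prod_congr rfl (g := fun x => Nat.card (LinearMap.range (LinearMap.mulLeft R
    (c * if x < d.length then -d.getD x 0 else d.getD (x - d.length) 0)))) (fun x hx => by
      rw [dif_pos (Finset.mem_range.1 hx)]), hr, Finset.prod_range_add, Finset.prod_range_add]
  have h1 : ∏ x ∈ Finset.range d.length, Nat.card (LinearMap.range (LinearMap.mulLeft R
      (c * d.getD x 0))) =
      (d.map fun x => Nat.card (LinearMap.range (LinearMap.mulLeft R (c * x)))).prod := by
    rw [← Fin.prod_univ_fun_getElem, Finset.prod_range]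
    refine Finset.prod_congr rfl fun i _ => ?_
    simp
  rw [sq, ← h1, Finset.prod_eq_one (s := Finset.range r), mul_one]
  · congr 1
    · refine Finset.prod_congr rfl fun x hx => ?_
      rw [if_pos (Finset.mem_range.1 hx), mul_neg, card_range_mulLeft_neg]
    · refine Finset.prod_congr rfl fun x hx => ?_
      rw [if_neg (by omega), Nat.add_sub_cancel_left]
  · intro x hx
    rw [if_neg (by omega), List.getD_eq_default _ _ (by omega), mul_zero, card_range_mulLeft_zero]

lemma hasType_Dalpha {p k n : ℕ} (hp : p.Prime) {s : Multiset ℕ} (hs : ∀ b ∈ s, b ≤ k)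
    (hn : 2 * s.card ≤ n) : HasType (Dalpha n p k s) s := by
  intro i
  rw [Dalpha, imCard_smul_stdSkew _ _ (by simpa using hn), List.map_map]
  have : List.map ((fun x => Nat.card (LinearMap.range (LinearMap.mulLeft (ZMod (p ^ k))
      ((p : ZMod (p ^ k)) ^ i * x)))) ∘ fun a => (p : ZMod (p ^ k)) ^ (k - a))
      (s.sort (· ≥ ·)) = (s.sort (· ≥ ·)).map fun a => p ^ (a - i) := by
    refine List.map_congr_left fun a ha => ?_
    have := hs a (by simpa using ha)
    simp only [Function.comp]
    rw [← pow_add, card_range_mul_pow hp]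
    congr 1; omega
  rw [this, mul_comm 2, pow_mul]
  congr 1
  conv_rhs => rw [← Multiset.sort_eq s (· ≥ ·)]
  rw [Multiset.map_coe, Multiset.sum_coe]
  generalize s.sort (· ≥ ·) = l
  induction l with
  | nil => simp
  | cons a l ih => simp [ih, pow_add]

end StandardForm

/-! ### Row spaces and coprime moduli -/

section RowSpace

lemma incl_intCast (m : ℕ) (z : ℤ) : incl m (z : ZMod m) = ((z / m : ℚ) : QmodZ) := by
  rw [incl, ZMod.lift_coe]
  change z • (((1 / (m : ℚ) : ℚ)) : QmodZ) = _
  rw [← AddCircle.coe_zsmul]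
  congr 1
  rw [zsmul_eq_mul]; ring

lemma incl_injective {m : ℕ} (hm : 1 ≤ m) : Function.Injective (incl m) := by
  have hm0 : (m : ℚ) ≠ 0 := by exact_mod_cast (by omega : m ≠ 0)
  rw [injective_iff_map_eq_zero]
  intro a ha
  obtain ⟨z, rfl⟩ := ZMod.intCast_surjective a
  rw [incl_intCast, AddCircle.coe_eq_zero_iff] at ha
  obtain ⟨n, hn⟩ := ha
  rw [zsmul_eq_mul, mul_one, eq_div_iff hm0] at hn
  have : z = n * m := by exact_mod_cast hn.symm
  rw [this]; simp

/-- The inclusion of `ℤ/m` in `ℚ/ℤ` identifies the row space of `D` with the image of `Dᵀ`. -/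
lemma card_rowSpace_eq_imCard {n m : ℕ} (hm : 1 ≤ m) (D : Matrix (Fin n) (Fin n) (ZMod m)) :
    Nat.card (rowSpace (D.map (incl m))) = imCard Dᵀ := by
  let f : (Fin n → ZMod m) →ₗ[ℤ] (Fin n → QmodZ) := (incl m).toIntLinearMap.compLeft (Fin n)
  have hf : Function.Injective f := fun v w h => funext fun i =>
    incl_injective hm (congrFun h i)
  have h1 : rowSpace (D.map (incl m)) =
      Submodule.map f (Submodule.span ℤ (Set.range fun i => D i)) := by
    rw [rowSpace, Submodule.map_span, ← Set.range_comp]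
    rfl
  have h2 : Submodule.restrictScalars ℤ (LinearMap.range Dᵀ.mulVecLin) =
      Submodule.span ℤ (Set.range fun i => D i) := by
    rw [Matrix.range_mulVecLin, Submodule.restrictScalars_span]
    · rfl
    · exact ZMod.intCast_surjective
  rw [h1, ← h2]
  exact Nat.card_congr (Submodule.equivMapOfInjective f hf _).toEquiv.symm

lemma imCard_neg {R ι κ : Type*} [CommRing R] [Fintype ι] [Fintype κ] (D : Matrix ι κ R) :
    imCard (-D) = imCard D := by
  refine Nat.card_congr (Equiv.subtypeEquivRight fun y => ?_)
  constructor
  · rintro ⟨z, rfl⟩; exact ⟨-z, by simp [Matrix.mulVec_neg]⟩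
  · rintro ⟨z, rfl⟩; exact ⟨-z, by simp [Matrix.mulVec_neg]⟩

lemma mem_T_iff {n : ℕ} {A : Type*} [AddCommGroup A] {D : Matrix (Fin n) (Fin n) A} :
    D ∈ T n A ↔ IsAlt D := Iff.rfl

lemma IsAlt.card_rowSpace {n m : ℕ} (hm : 1 ≤ m) {D : Matrix (Fin n) (Fin n) (ZMod m)}
    (hD : IsAlt D) : Nat.card (rowSpace (D.map (incl m))) = imCard D := by
  have hT : Dᵀ = -D := by ext i j; simpa using hD.1 j i
  rw [card_rowSpace_eq_imCard hm, hT, imCard_neg]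

lemma sigmaDvd_iff {n : ℕ} {D : Matrix (Fin n) (Fin n) QmodZ} {m : ℕ} :
    SigmaDvd D m ↔ ∃ s : ℕ, Nat.card (rowSpace D) = s ^ 2 ∧ s ∣ m := by
  refine exists_congr fun s => and_congr_left fun _ => ?_
  rw [sigma, Real.sqrt_eq_iff_eq_sq (by positivity) (by positivity)]
  exact_mod_cast Iff.rfl

end RowSpace

section PrimePowerCount

variable {p k : ℕ}

lemma congruent_iff_cong {n : ℕ} {R : Type*} [CommRing R] {D D' : Matrix (Fin n) (Fin n) R} :
    Congruent D D' ↔ Cong D D' := by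
  constructor
  · rintro ⟨A, rfl⟩
    exact ⟨A, ↑A⁻¹, A.mul_inv, A.inv_mul, rfl⟩
  · rintro ⟨P, Q, h1, h2, rfl⟩
    exact ⟨⟨P, Q, h1, h2⟩, rfl⟩

lemma mem_J_iff {n : ℕ} {α : Σ k' : ℕ, k'.Partition} :
    α ∈ J n k ↔ (1 ≤ α.1 ∧ α.1 ≤ k) ∧ 2 * α.2.parts.card ≤ n := by
  rw [J, Finset.mem_sigma, Finset.mem_Icc, J', Finset.mem_filter]
  simp

lemma parts_bounds {n : ℕ} {α : Σ k' : ℕ, k'.Partition} (hα : α ∈ J n k) :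
    ∀ b ∈ α.2.parts, 1 ≤ b ∧ b ≤ k := by
  intro b hb
  refine ⟨α.2.parts_pos hb, ?_⟩
  have h1 := Multiset.single_le_sum (fun x _ => Nat.zero_le x) b hb
  rw [α.2.parts_sum] at h1
  exact h1.trans (mem_J_iff.1 hα).1.2

/-- The matrices congruent to `D_α` are the alternating matrices of type `α`. -/
theorem card_congruent_Dalpha {n : ℕ} [Fact p.Prime] {α : Σ k' : ℕ, k'.Partition}
    (hα : α ∈ J n k) :
    (Nat.card {D : Matrix (Fin n) (Fin n) (ZMod (p ^ k)) //
      D ∈ T n (ZMod (p ^ k)) ∧ Congruent (Dalpha n p k α.2.parts) D} : ℚ) =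
      Np n p α.2.parts := by
  have hp : p.Prime := Fact.out
  have hb := parts_bounds hα
  have hn := (mem_J_iff.1 hα).2
  rw [← typeCount_eq_Np (k := k) hb hn, typeCount]
  have htype : HasType (Dalpha n p k α.2.parts) α.2.parts :=
    hasType_Dalpha hp (fun b h => (hb b h).2) hn
  congr 1
  refine Nat.card_congr (Equiv.subtypeEquivRight fun D => ?_)
  rw [mem_T_iff, congruent_iff_cong]
  refine and_congr_right fun hD => ⟨fun h => htype.of_cong h, fun h => ?_⟩
  exact HasType.cong (isAlt_stdSkew n _) hD
    (fun h0 => by have := (hb 0 h0).1; omega) htype h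

/-- A matrix of type `s` has `σ(D) = p^|s|`. -/
lemma HasType.sigmaDvd_iff [Fact p.Prime] {n : ℕ} {D : Matrix (Fin n) (Fin n) (ZMod (p ^ k))}
    (hD : IsAlt D) {s : Multiset ℕ} (hs : HasType D s) :
    SigmaDvd (D.map (incl (p ^ k))) (p ^ k) ↔ s.sum ≤ k := by
  have hp : p.Prime := Fact.out
  have h0 := hs 0
  simp only [pow_zero, one_smul, Nat.sub_zero, Multiset.map_id'] at h0
  rw [AlmostCommuting.sigmaDvd_iff, hD.card_rowSpace (Nat.one_le_pow _ _ hp.pos), h0]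
  constructor
  · rintro ⟨t, ht, hd⟩
    rw [mul_comm, pow_mul] at ht
    rw [← Nat.pow_left_injective (n := 2) (by norm_num) ht] at hd
    exact (Nat.pow_dvd_pow_iff_le_right hp.one_lt).1 hd
  · intro h
    exact ⟨p ^ s.sum, by rw [← pow_mul, mul_comm], pow_dvd_pow p h⟩

/-- The matrices that `N` counts are classified by their types, which are the partitions in `J n k`
and the empty type of the zero matrix. -/
theorem N_prime_pow {n : ℕ} [Fact p.Prime] :
    (N n (p ^ k) : ℚ) = 1 + ∑ α ∈ J n k, Np n p α.2.parts := by
  classical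
  have hp : p.Prime := Fact.out
  let S : Finset (Matrix (Fin n) (Fin n) (ZMod (p ^ k))) :=
    Finset.univ.filter fun D => D ∈ T n (ZMod (p ^ k)) ∧ SigmaDvd (D.map (incl (p ^ k))) (p ^ k)
  let 𝒯 : Finset (Multiset ℕ) := (J n k).image fun α => α.2.parts
  have h0 : (0 : Multiset ℕ) ∉ 𝒯 := by
    intro h
    obtain ⟨α, hα, h⟩ := Finset.mem_image.1 h
    have h1 := α.2.parts_sum
    rw [h, Multiset.sum_zero] at h1
    have := (mem_J_iff.1 hα).1.1
    omega
  have hinj : Set.InjOn (fun α : Σ k' : ℕ, k'.Partition => α.2.parts) (J n k) := by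
    rintro ⟨a, α⟩ - ⟨b, β⟩ - h
    have hab : a = b := by rw [← α.parts_sum, ← β.parts_sum]; exact congrArg _ h
    subst hab
    exact congrArg _ (Nat.Partition.ext h)
  have hmem (s : Multiset ℕ) (hs : s ∈ insert 0 𝒯) :
      (∀ b ∈ s, 1 ≤ b ∧ b ≤ k) ∧ 2 * s.card ≤ n ∧ s.sum ≤ k := by
    rcases Finset.mem_insert.1 hs with rfl | hs
    · simp
    · obtain ⟨α, hα, rfl⟩ := Finset.mem_image.1 hs
      refine ⟨parts_bounds hα, (mem_J_iff.1 hα).2, ?_⟩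
      rw [α.2.parts_sum]
      exact (mem_J_iff.1 hα).1.2
  have hmem' (s : Multiset ℕ) (h1 : ∀ b ∈ s, 1 ≤ b) (h2 : 2 * s.card ≤ n) (h3 : s.sum ≤ k) :
      s ∈ insert 0 𝒯 := by
    by_cases hs : s = 0
    · simp [hs]
    · refine Finset.mem_insert_of_mem (Finset.mem_image.2
        ⟨⟨s.sum, ⟨s, fun {i} hi => h1 i hi, rfl⟩⟩, mem_J_iff.2 ⟨⟨?_, h3⟩, h2⟩, rfl⟩)
      obtain ⟨a, ha⟩ := Multiset.exists_mem_of_ne_zero hs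
      exact (h1 a ha).trans (Multiset.single_le_sum (fun x _ => Nat.zero_le x) a ha)
  -- the type of an alternating matrix, with a junk value for other matrices
  let τ (D : Matrix (Fin n) (Fin n) (ZMod (p ^ k))) : Multiset ℕ :=
    if h : IsAlt D then h.exists_hasType.choose else 0
  have hτ {D : Matrix (Fin n) (Fin n) (ZMod (p ^ k))} (h : IsAlt D) :
      HasType D (τ D) ∧ (∀ b ∈ τ D, 1 ≤ b ∧ b ≤ k) ∧ 2 * (τ D).card ≤ n := by
    simp only [τ, dif_pos h]
    exact h.exists_hasType.choose_spec
  have hmaps : Set.MapsTo τ S (insert 0 𝒯 : Finset (Multiset ℕ)) := by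
    intro D hD
    obtain ⟨hD1, hD2⟩ := (Finset.mem_filter.1 hD).2
    obtain ⟨h1, h2, h3⟩ := hτ hD1
    exact hmem' _ (fun b hb => (h2 b hb).1) h3 ((h1.sigmaDvd_iff hD1).1 hD2)
  have hfib (s) (hs : s ∈ insert 0 𝒯) : ((S.filter fun D => τ D = s).card : ℚ) = Np n p s := by
    obtain ⟨h1, h2, h3⟩ := hmem s hs
    rw [← typeCount_eq_Np (k := k) h1 h2, typeCount, Nat.card_eq_fintype_card,
      Fintype.card_subtype]
    congr 2
    ext D
    simp only [S, Finset.mem_filter, Finset.mem_univ, true_and]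
    constructor
    · rintro ⟨⟨hD, -⟩, rfl⟩
      exact ⟨hD, (hτ hD).1⟩
    · rintro ⟨hD, hDs⟩
      refine ⟨⟨hD, (hDs.sigmaDvd_iff hD).2 h3⟩, (hτ hD).1.unique hp hDs ?_ ?_⟩
      · intro h; have := ((hτ hD).2.1 0 h).1; omega
      · intro h; have := (h1 0 h).1; omega
  have hN : N n (p ^ k) = S.card := by
    rw [N, Nat.card_eq_fintype_card, Fintype.card_subtype]
  rw [hN, Finset.card_eq_sum_card_fiberwise hmaps, Nat.cast_sum, Finset.sum_congr rfl hfib,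
    Finset.sum_insert h0, Np_zero, Finset.sum_image hinj]

end PrimePowerCount

section Coprime

variable {n m₁ m₂ : ℕ}

lemma zsmul_map_incl (m : ℕ) (D : Matrix (Fin n) (Fin n) (ZMod m)) :
    (m : ℤ) • D.map (incl m) = 0 := by
  ext i j
  rw [Matrix.smul_apply, Matrix.map_apply, ← map_zsmul, zsmul_eq_mul]
  simp

lemma zsmul_mem_rowSpace {E : Matrix (Fin n) (Fin n) QmodZ} {m : ℤ} (hE : m • E = 0)
    {x : Fin n → QmodZ} (hx : x ∈ rowSpace E) : m • x = 0 := by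
  have : rowSpace E ≤ LinearMap.ker (LinearMap.lsmul ℤ (Fin n → QmodZ) m) := by
    rw [rowSpace, Submodule.span_le]
    rintro _ ⟨i, rfl⟩
    exact congrFun hE i
  exact this hx

lemma rowSpace_le_of_isCoprime {E₁ E₂ : Matrix (Fin n) (Fin n) QmodZ} {a b : ℤ}
    (h₁ : a • E₁ = 0) (h₂ : b • E₂ = 0) (hab : IsCoprime a b) :
    rowSpace E₁ ≤ rowSpace (E₁ + E₂) := by
  obtain ⟨u, v, huv⟩ := hab
  rw [rowSpace, Submodule.span_le]
  rintro _ ⟨i, rfl⟩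
  -- multiplication by `v b ≡ 1 mod a` maps the rows of `E₁ + E₂` to those of `E₁`
  have h3 : (v * b) • (E₁ + E₂) = E₁ := by
    have e1 : (v * b) • E₂ = 0 := by rw [mul_smul, h₂, smul_zero]
    have e2 : (v * b) • E₁ = E₁ := by
      rw [show v * b = 1 - u * a by linarith, sub_smul, one_smul, mul_smul, h₁, smul_zero, sub_zero]
    rw [smul_add, e1, e2, add_zero]
  have h4 : E₁ i = (v * b) • ((E₁ + E₂) i) := (congrFun h3 i).symm
  rw [SetLike.mem_coe]
  change E₁ i ∈ _
  rw [h4]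
  exact Submodule.smul_mem _ _ (Submodule.subset_span ⟨i, rfl⟩)

/-- The row space of a sum of matrices with coprime exponents is the direct sum of the row
spaces. -/
lemma card_rowSpace_add {E₁ E₂ : Matrix (Fin n) (Fin n) QmodZ} {a b : ℤ}
    (h₁ : a • E₁ = 0) (h₂ : b • E₂ = 0) (hab : IsCoprime a b) :
    Nat.card (rowSpace (E₁ + E₂)) = Nat.card (rowSpace E₁) * Nat.card (rowSpace E₂) := by
  have le₁ := rowSpace_le_of_isCoprime h₁ h₂ hab
  have le₂ := rowSpace_le_of_isCoprime h₂ h₁ hab.symm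
  rw [add_comm] at le₂
  have hle : rowSpace (E₁ + E₂) ≤ rowSpace E₁ ⊔ rowSpace E₂ := by
    rw [rowSpace, Submodule.span_le]
    rintro _ ⟨i, rfl⟩
    exact Submodule.add_mem_sup (Submodule.subset_span ⟨i, rfl⟩) (Submodule.subset_span ⟨i, rfl⟩)
  have hzero {x : Fin n → QmodZ} (hx₁ : x ∈ rowSpace E₁) (hx₂ : x ∈ rowSpace E₂) : x = 0 := by
    obtain ⟨u, v, huv⟩ := hab
    rw [← one_smul ℤ x, ← huv, add_smul, mul_smul, mul_smul, zsmul_mem_rowSpace h₁ hx₁,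
      zsmul_mem_rowSpace h₂ hx₂, smul_zero, smul_zero, add_zero]
  rw [← Nat.card_prod]
  symm
  refine Nat.card_congr (Equiv.ofBijective
    (fun x => ⟨x.1.1 + x.2.1, add_mem (le₁ x.1.2) (le₂ x.2.2)⟩) ⟨?_, ?_⟩)
  · rintro ⟨⟨x, hx⟩, ⟨y, hy⟩⟩ ⟨⟨x', hx'⟩, ⟨y', hy'⟩⟩ h
    simp only [Subtype.mk.injEq] at h
    have h5 : x - x' = y' - y := by
      rw [sub_eq_sub_iff_add_eq_add, h, add_comm]
    have h6 : x - x' = 0 := hzero (sub_mem hx hx') (h5 ▸ sub_mem hy' hy)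
    have h7 : y' - y = 0 := h5 ▸ h6
    rw [sub_eq_zero] at h6 h7
    simp [h6, h7]
  · rintro ⟨z, hz⟩
    obtain ⟨x, hx, y, hy, rfl⟩ := Submodule.mem_sup.1 (hle hz)
    exact ⟨⟨⟨x, hx⟩, ⟨y, hy⟩⟩, rfl⟩

/-- The prime factors of the order of the row space divide `m`, since `m` kills the row space. -/
lemma coprime_card_rowSpace {m c : ℕ} (hm : 1 ≤ m) (hc : Nat.Coprime m c)
    (D : Matrix (Fin n) (Fin n) (ZMod m)) :
    Nat.Coprime (Nat.card (rowSpace (D.map (incl m)))) c := by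
  have : NeZero m := ⟨by omega⟩
  have hfin : Finite (rowSpace (D.map (incl m))) := by
    refine Nat.finite_of_card_ne_zero ?_
    rw [card_rowSpace_eq_imCard hm, imCard]
    exact Nat.card_pos.ne'
  refine Nat.Coprime.symm (Nat.coprime_of_dvd fun ℓ hℓ h1 h2 => ?_)
  have : Fact ℓ.Prime := ⟨hℓ⟩
  obtain ⟨x, hx⟩ := exists_prime_addOrderOf_dvd_card' ℓ h2
  have h3 : (m : ℤ) • x = 0 := Subtype.ext (zsmul_mem_rowSpace (zsmul_map_incl m D) x.2)
  rw [natCast_zsmul] at h3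
  have h4 : ℓ ∣ m := by rw [← hx]; exact addOrderOf_dvd_of_nsmul_eq_zero h3
  exact hℓ.one_lt.ne' (Nat.eq_one_of_dvd_coprimes hc h4 h1)

/-- The canonical embedding `ℤ/m₁ → ℤ/m₁m₂`, which is multiplication by `m₂`. -/
def inclMul (m₁ m₂ : ℕ) : ZMod m₁ →+ ZMod (m₁ * m₂) :=
  ZMod.lift m₁ ⟨zmultiplesHom (ZMod (m₁ * m₂)) (m₂ : ZMod (m₁ * m₂)), by
    rw [zmultiplesHom_apply, zsmul_eq_mul]
    exact_mod_cast ZMod.natCast_self (m₁ * m₂)⟩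

lemma incl_inclMul (h₂ : 1 ≤ m₂) (a : ZMod m₁) :
    incl (m₁ * m₂) (inclMul m₁ m₂ a) = incl m₁ a := by
  obtain ⟨z, rfl⟩ := ZMod.intCast_surjective a
  have hm0 : (m₂ : ℚ) ≠ 0 := by exact_mod_cast (by omega : m₂ ≠ 0)
  have : inclMul m₁ m₂ (z : ZMod m₁) = ((z * m₂ : ℤ) : ZMod (m₁ * m₂)) := by
    rw [inclMul, ZMod.lift_coe]
    simp
  rw [this, incl_intCast, incl_intCast]
  congr 1
  push_cast
  exact mul_div_mul_right _ _ hm0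

/-- The decomposition of `ℤ/m₁m₂` inside `ℚ/ℤ` as the sum of `ℤ/m₁` and `ℤ/m₂`. -/
lemma exists_addEquiv_prod (h₁ : 1 ≤ m₁) (h₂ : 1 ≤ m₂) (h : Nat.Coprime m₁ m₂) :
    ∃ e : ZMod m₁ × ZMod m₂ ≃+ ZMod (m₁ * m₂),
      ∀ x, incl (m₁ * m₂) (e x) = incl m₁ x.1 + incl m₂ x.2 := by
  have : NeZero m₁ := ⟨by omega⟩
  have : NeZero m₂ := ⟨by omega⟩
  have : NeZero (m₁ * m₂) := ⟨mul_ne_zero (by omega) (by omega)⟩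
  let c : ZMod (m₂ * m₁) →+ ZMod (m₁ * m₂) :=
    (ZMod.ringEquivCongr (mul_comm m₂ m₁)).toAddMonoidHom
  have hc (x) : incl (m₁ * m₂) (c x) = incl (m₂ * m₁) x := by
    obtain ⟨z, rfl⟩ := ZMod.intCast_surjective x
    have : c (z : ZMod (m₂ * m₁)) = (z : ZMod (m₁ * m₂)) :=
      map_intCast (ZMod.ringEquivCongr (mul_comm m₂ m₁)) z
    rw [this, incl_intCast, incl_intCast, mul_comm m₁ m₂]
  let J : ZMod m₁ × ZMod m₂ →+ ZMod (m₁ * m₂) :=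
    AddMonoidHom.coprod (inclMul m₁ m₂) (c.comp (inclMul m₂ m₁))
  have hJ (x) : incl (m₁ * m₂) (J x) = incl m₁ x.1 + incl m₂ x.2 := by
    rw [AddMonoidHom.coprod_apply, map_add, AddMonoidHom.comp_apply, hc, incl_inclMul h₂,
      incl_inclMul h₁]
  have hinj : Function.Injective J := by
    rw [injective_iff_map_eq_zero]
    rintro ⟨x, y⟩ hxy
    have h3 : incl m₁ x + incl m₂ y = 0 := by rw [← hJ (x, y), hxy, map_zero]
    have hx : (m₁ : ℤ) • incl m₁ x = 0 := by rw [← map_zsmul, zsmul_eq_mul]; simp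
    have hy : (m₂ : ℤ) • incl m₂ y = 0 := by rw [← map_zsmul, zsmul_eq_mul]; simp
    obtain ⟨u, v, huv⟩ := Nat.isCoprime_iff_coprime.2 h
    have h4 : incl m₁ x = 0 := by
      rw [← one_smul ℤ (incl m₁ x), ← huv, add_smul, mul_smul, hx, smul_zero, zero_add,
        eq_neg_of_add_eq_zero_left h3, smul_neg, mul_smul, hy, smul_zero, neg_zero]
    have h5 : incl m₂ y = 0 := by rwa [h4, zero_add] at h3
    rw [incl_injective h₁ (h4.trans (map_zero _).symm),
      incl_injective h₂ (h5.trans (map_zero _).symm)]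
    rfl
  have hbij : Function.Bijective J := by
    rw [Fintype.bijective_iff_injective_and_card]
    exact ⟨hinj, by simp [ZMod.card]⟩
  exact ⟨AddEquiv.ofBijective J hbij, hJ⟩

lemma sigma_add (h : Nat.Coprime m₁ m₂) (D₁ : Matrix (Fin n) (Fin n) (ZMod m₁))
    (D₂ : Matrix (Fin n) (Fin n) (ZMod m₂)) :
    sigma (D₁.map (incl m₁) + D₂.map (incl m₂)) =
      sigma (D₁.map (incl m₁)) * sigma (D₂.map (incl m₂)) := by
  rw [sigma, sigma, sigma, card_rowSpace_add (zsmul_map_incl m₁ D₁) (zsmul_map_incl m₂ D₂)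
    (Nat.isCoprime_iff_coprime.2 h), Nat.cast_mul, Real.sqrt_mul (by positivity)]

lemma sigmaDvd_add_iff (h₁ : 1 ≤ m₁) (h₂ : 1 ≤ m₂) (h : Nat.Coprime m₁ m₂)
    (D₁ : Matrix (Fin n) (Fin n) (ZMod m₁)) (D₂ : Matrix (Fin n) (Fin n) (ZMod m₂)) :
    SigmaDvd (D₁.map (incl m₁) + D₂.map (incl m₂)) (m₁ * m₂) ↔
      SigmaDvd (D₁.map (incl m₁)) m₁ ∧ SigmaDvd (D₂.map (incl m₂)) m₂ := by
  simp only [sigmaDvd_iff]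
  rw [card_rowSpace_add (zsmul_map_incl m₁ D₁) (zsmul_map_incl m₂ D₂)
    (Nat.isCoprime_iff_coprime.2 h)]
  have c1 := coprime_card_rowSpace h₁ h D₁
  have c2 := coprime_card_rowSpace h₂ h.symm D₂
  have c3 := coprime_card_rowSpace h₂ c1.symm D₂
  generalize Nat.card (rowSpace (D₁.map (incl m₁))) = r₁ at *
  generalize Nat.card (rowSpace (D₂.map (incl m₂))) = r₂ at *
  constructor
  · rintro ⟨s, hs, hd⟩
    obtain ⟨a, rfl⟩ := exists_eq_pow_of_mul_eq_pow (Nat.isUnit_iff.2 c3.symm) hs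
    obtain ⟨b, rfl⟩ := exists_eq_pow_of_mul_eq_pow (Nat.isUnit_iff.2 c3) ((mul_comm _ _).trans hs)
    have hsab : s = a * b := by
      rw [← mul_pow] at hs
      exact (Nat.pow_left_injective (n := 2) (by norm_num) hs).symm
    subst hsab
    refine ⟨⟨a, rfl, ?_⟩, ⟨b, rfl, ?_⟩⟩
    · exact (Nat.Coprime.coprime_dvd_left (dvd_pow_self a two_ne_zero) c1).dvd_of_dvd_mul_right
        ((dvd_mul_right a b).trans hd)
    · exact (Nat.Coprime.coprime_dvd_left (dvd_pow_self b two_ne_zero) c2).dvd_of_dvd_mul_left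
        ((dvd_mul_left b a).trans hd)
  · rintro ⟨⟨a, rfl, ha⟩, ⟨b, rfl, hb⟩⟩
    exact ⟨a * b, by rw [mul_pow], mul_dvd_mul ha hb⟩

lemma isAlt_prod_iff (e : ZMod m₁ × ZMod m₂ ≃+ ZMod (m₁ * m₂))
    (D₁ : Matrix (Fin n) (Fin n) (ZMod m₁)) (D₂ : Matrix (Fin n) (Fin n) (ZMod m₂)) :
    IsAlt (Matrix.of fun i j => e (D₁ i j, D₂ i j)) ↔ IsAlt D₁ ∧ IsAlt D₂ := by
  simp only [IsAlt, Matrix.of_apply, ← map_neg, e.injective.eq_iff,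
    map_eq_zero_iff e e.injective, Prod.neg_mk, Prod.mk.injEq, Prod.mk_eq_zero, forall_and]
  tauto

theorem N_mul (h₁ : 1 ≤ m₁) (h₂ : 1 ≤ m₂) (h : Nat.Coprime m₁ m₂) :
    N n (m₁ * m₂) = N n m₁ * N n m₂ := by
  obtain ⟨e, he⟩ := exists_addEquiv_prod h₁ h₂ h
  rw [N, N, N, ← Nat.card_prod]
  symm
  refine Nat.card_congr (Equiv.ofBijective
    (fun x => ⟨Matrix.of fun i j => e (x.1.1 i j, x.2.1 i j), ?_⟩) ⟨?_, ?_⟩)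
  · obtain ⟨⟨D₁, h1, h1'⟩, ⟨D₂, h2, h2'⟩⟩ := x
    refine ⟨(isAlt_prod_iff e D₁ D₂).2 ⟨h1, h2⟩, ?_⟩
    have : (Matrix.of fun i j => e (D₁ i j, D₂ i j)).map (incl (m₁ * m₂)) =
        D₁.map (incl m₁) + D₂.map (incl m₂) := by
      ext i j; exact he _
    rw [this]
    exact (sigmaDvd_add_iff h₁ h₂ h D₁ D₂).2 ⟨h1', h2'⟩
  · rintro ⟨⟨D₁, h1⟩, ⟨D₂, h2⟩⟩ ⟨⟨D₁', h1'⟩, ⟨D₂', h2'⟩⟩ hx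
    have hx' := congrArg Subtype.val hx
    have hij (i j) : (D₁ i j, D₂ i j) = (D₁' i j, D₂' i j) :=
      e.injective (congrFun (congrFun hx' i) j)
    have e1 : D₁ = D₁' := by ext i j; exact congrArg Prod.fst (hij i j)
    have e2 : D₂ = D₂' := by ext i j; exact congrArg Prod.snd (hij i j)
    subst e1 e2
    rfl
  · rintro ⟨D, hD, hD'⟩
    let D₁ : Matrix (Fin n) (Fin n) (ZMod m₁) := Matrix.of fun i j => (e.symm (D i j)).1
    let D₂ : Matrix (Fin n) (Fin n) (ZMod m₂) := Matrix.of fun i j => (e.symm (D i j)).2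
    have hDe : (Matrix.of fun i j => e (D₁ i j, D₂ i j)) = D := by
      ext i j; simp [D₁, D₂]
    have hmap : D.map (incl (m₁ * m₂)) = D₁.map (incl m₁) + D₂.map (incl m₂) := by
      rw [← hDe]; ext i j; exact he _
    have hA : IsAlt D₁ ∧ IsAlt D₂ := (isAlt_prod_iff e D₁ D₂).1 (by rw [hDe]; exact hD)
    have hS := (sigmaDvd_add_iff h₁ h₂ h D₁ D₂).1 (by rw [← hmap]; exact hD')
    exact ⟨⟨⟨D₁, hA.1, hS.1⟩, ⟨D₂, hA.2, hS.2⟩⟩, Subtype.ext hDe⟩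

lemma exists_mem_T_map_eq_add (h₁ : 1 ≤ m₁) (h₂ : 1 ≤ m₂) (h : Nat.Coprime m₁ m₂)
    {D₁ : Matrix (Fin n) (Fin n) (ZMod m₁)} (hD₁ : D₁ ∈ T n (ZMod m₁))
    {D₂ : Matrix (Fin n) (Fin n) (ZMod m₂)} (hD₂ : D₂ ∈ T n (ZMod m₂)) :
    ∃ D ∈ T n (ZMod (m₁ * m₂)),
      D.map (incl (m₁ * m₂)) = D₁.map (incl m₁) + D₂.map (incl m₂) := by
  obtain ⟨e, he⟩ := exists_addEquiv_prod h₁ h₂ h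
  refine ⟨_, (isAlt_prod_iff e D₁ D₂).2 ⟨hD₁, hD₂⟩, ?_⟩
  ext i j
  exact he _

lemma N_one : N n 1 = 1 := by
  rw [N, Nat.card_eq_one_iff_unique]
  refine ⟨⟨fun x y => Subtype.ext (Subsingleton.elim _ _)⟩, ⟨⟨0, ⟨by simp, by simp⟩, ?_⟩⟩⟩
  rw [sigmaDvd_iff]
  refine ⟨1, ?_, dvd_rfl⟩
  rw [card_rowSpace_eq_imCard le_rfl, imCard_eq_one_iff _ |>.2 (Subsingleton.elim _ _), one_pow]

theorem N_prod {ι : Type*} (s : Finset ι) (p k : ι → ℕ) (hp : ∀ i, (p i).Prime)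
    (hinj : Function.Injective p) :
    (N n (∏ i ∈ s, p i ^ k i) : ℚ) =
      ∏ i ∈ s, (1 + ∑ α ∈ J n (k i), Np n (p i) α.2.parts) := by
  classical
  induction s using Finset.induction_on with
  | empty => simp [N_one]
  | insert i s hi ih =>
    have : Fact (p i).Prime := ⟨hp i⟩
    have hcop : Nat.Coprime (p i ^ k i) (∏ j ∈ s, p j ^ k j) := by
      refine Nat.Coprime.prod_right fun j hj => Nat.Coprime.pow _ _ ?_
      rw [Nat.coprime_primes (hp i) (hp j)]
      intro h
      exact hi (hinj h ▸ hj)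
    rw [Finset.prod_insert hi, Finset.prod_insert hi,
      N_mul (Nat.one_le_pow _ _ (hp i).pos)
        (Finset.one_le_prod' fun j _ => Nat.one_le_pow _ _ (hp j).pos) hcop,
      Nat.cast_mul, ih, N_prime_pow]

end Coprime

/-! ### Lagrangian subgroups and frames of joint eigenvectors -/

section Lagrangian

variable {m : ℕ} [NeZero m]

/-- A finite abelian group has at most as many homomorphisms to `ℤ/m` as elements, because it has
exactly that many characters. -/
lemma card_addMonoidHom_zmod_le (A : Type*) [AddCommGroup A] [Finite A] :
    Nat.card (A →+ ZMod m) ≤ Nat.card A := by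
  have h := CommGroup.card_monoidHom_of_hasEnoughRootsOfUnity (Multiplicative A) Circle
  rw [← Nat.card_congr (Multiplicative.ofAdd (α := A)).symm, ← h]
  have hfin : Finite (Multiplicative A →* Circleˣ) :=
    Nat.finite_of_card_ne_zero (by rw [h]; exact Nat.card_pos.ne')
  refine Nat.card_le_card_of_injective
    (fun f => toUnits.toMonoidHom.comp (ZMod.toCircle.toMonoidHom.comp f.toMultiplicative)) ?_
  intro f g hfg
  ext a
  have := congrArg (fun u : Circleˣ => (u : Circle))
    (DFunLike.congr_fun hfg (Multiplicative.ofAdd a))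
  exact ZMod.injective_toCircle this

lemma card_le_of_injective_pairing {A B : Type*} [AddCommGroup A] [AddCommGroup B] [Finite A]
    [Finite B] (P : A →+ B →+ ZMod m) (hP : Function.Injective P) : Nat.card A ≤ Nat.card B := by
  have : Finite (B →+ ZMod m) := Finite.of_injective _ DFunLike.coe_injective
  exact (Nat.card_le_card_of_injective P hP).trans (card_addMonoidHom_zmod_le B)

variable {V : Type*} [AddCommGroup V] [Finite V] (B : V →+ V →+ ZMod m)

/-- `L` is maximal isotropic for the form `B`: it is its own orthogonal complement. -/
def IsLagrangian (L : AddSubgroup V) : Prop := ∀ v, v ∈ L ↔ ∀ w ∈ L, B w v = 0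

variable {B}

lemma form_swap (hB : ∀ v, B v v = 0) (v w : V) : B v w = -B w v := by
  have := hB (v + w)
  simp only [map_add, AddMonoidHom.add_apply, hB, zero_add, add_zero] at this
  exact eq_neg_of_add_eq_zero_right this

/-- A maximal isotropic subgroup is its own orthogonal complement. -/
lemma exists_isLagrangian (hB : ∀ v, B v v = 0) : ∃ L : AddSubgroup V, IsLagrangian B L := by
  have : Finite (AddSubgroup V) := Finite.of_injective _ SetLike.coe_injective
  obtain ⟨L, hL⟩ := Set.Finite.exists_maximal
    (Set.toFinite {L : AddSubgroup V | ∀ v ∈ L, ∀ w ∈ L, B w v = 0})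
    ⟨⊥, by simp⟩
  refine ⟨L, fun v => ⟨fun hv => hL.1 v hv, fun hv => ?_⟩⟩
  have hv' : ∀ w ∈ L, B v w = 0 := fun w hw => by rw [form_swap hB, hv w hw, neg_zero]
  have h2 : L ⊔ AddSubgroup.zmultiples v ≤ L := by
    refine hL.2 ?_ le_sup_left
    intro x hx y hy
    obtain ⟨x₁, hx₁, x₂, hx₂, rfl⟩ := AddSubgroup.mem_sup.1 hx
    obtain ⟨y₁, hy₁, y₂, hy₂, rfl⟩ := AddSubgroup.mem_sup.1 hy
    obtain ⟨a, rfl⟩ := AddSubgroup.mem_zmultiples_iff.1 hx₂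
    obtain ⟨b, rfl⟩ := AddSubgroup.mem_zmultiples_iff.1 hy₂
    simp [hL.1 x₁ hx₁ y₁ hy₁, hv _ hy₁, hv' _ hx₁, hB]
  exact h2 (AddSubgroup.mem_sup_right (AddSubgroup.mem_zmultiples v))

/-- The square of the index of a Lagrangian subgroup is the order of the quotient by the radical. -/
lemma IsLagrangian.index_sq (hB : ∀ v, B v v = 0) {L : AddSubgroup V} (hL : IsLagrangian B L) :
    Nat.card B.range = L.index ^ 2 := by
  have hfin : Finite (V →+ ZMod m) := Finite.of_injective _ DFunLike.coe_injective
  -- evaluation is a perfect pairing between `V ⧸ L` and the image of `L` in the dual of `V`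
  let P : V ⧸ L →+ L.map B →+ ZMod m := QuotientAddGroup.lift L
    (AddMonoidHom.mk' (fun v => (AddMonoidHom.eval v).comp (L.map B).subtype)
      (fun v w => by ext x; simp)) (by
      intro v hv
      ext ⟨_, w, hw, rfl⟩
      exact (hL v).1 hv w hw)
  have hP (v : V) (φ : L.map B) : P (QuotientAddGroup.mk v) φ = φ.1 v := rfl
  have hP1 : Function.Injective P := by
    rw [injective_iff_map_eq_zero]
    intro x hx
    induction x using QuotientAddGroup.induction_on with
    | H v =>
      rw [QuotientAddGroup.eq_zero_iff, hL]
      intro w hw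
      have := DFunLike.congr_fun hx ⟨B w, w, hw, rfl⟩
      rwa [hP] at this
  have hP2 : Function.Injective P.flip := by
    rw [injective_iff_map_eq_zero]
    intro φ hφ
    refine Subtype.ext (AddMonoidHom.ext fun v => ?_)
    have := DFunLike.congr_fun hφ (QuotientAddGroup.mk v)
    rwa [AddMonoidHom.flip_apply, hP] at this
  have hcard : Nat.card (L.map B) = L.index :=
    le_antisymm (card_le_of_injective_pairing P.flip hP2) (card_le_of_injective_pairing P hP1)
  have hker : B.ker ≤ L := fun v hv => by
    rw [hL]
    intro w _
    rw [form_swap hB, AddMonoidHom.mem_ker.1 hv]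
    simp
  have h1 : Nat.card B.range * Nat.card B.ker = Nat.card V := by
    rw [← Nat.card_congr (QuotientAddGroup.quotientKerEquivRange B).toEquiv,
      ← AddSubgroup.card_eq_card_quotient_mul_card_addSubgroup]
  have h2 : Nat.card (L.map B) * Nat.card B.ker = Nat.card L := by
    have e1 : (B.comp L.subtype).range = L.map B := by
      rw [AddMonoidHom.range_comp, AddSubgroup.range_subtype]
    have e2 : Nat.card (B.comp L.subtype).ker = Nat.card B.ker :=
      Nat.card_congr ⟨fun x => ⟨x.1.1, x.2⟩, fun x => ⟨⟨x.1, hker x.2⟩, x.2⟩, fun _ => rfl,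
        fun _ => rfl⟩
    rw [← e1, ← e2,
      ← Nat.card_congr (QuotientAddGroup.quotientKerEquivRange (B.comp L.subtype)).toEquiv,
      ← AddSubgroup.card_eq_card_quotient_mul_card_addSubgroup]
  have h3 : L.index * Nat.card L = Nat.card V := AddSubgroup.index_mul_card L
  have hk : 0 < Nat.card B.ker := Nat.card_pos
  refine Nat.eq_of_mul_eq_mul_right hk ?_
  rw [h1, ← h3, ← h2, hcard, sq, mul_assoc]

end Lagrangian

section CharacterExtension

/-- The circle is a quotient of `ℝ`, hence divisible, hence injective as an abelian group. -/
lemma baer_circle : Module.Baer ℤ (Additive Circle) := by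
  let f : ℝ →+ Additive Circle := AddMonoidHom.mk' (fun x => Additive.ofMul (Circle.exp x))
    (fun x y => by rw [Circle.exp_add]; rfl)
  have hf : Function.Surjective f := fun z => by
    refine ⟨Complex.arg (z.toMul : ℂ), ?_⟩
    change Additive.ofMul (Circle.exp (Complex.arg (z.toMul : ℂ))) = z
    rw [Circle.exp_arg]
    rfl
  have : DivisibleBy (Additive Circle) ℤ := hf.divisibleBy f (fun a n => map_zsmul f n a)
  exact Module.Baer.of_divisible _

/-- A circle-valued character of a subgroup that is trivial on commutators of the ambient group
extends to the whole group: it descends to a subgroup of the abelianization. -/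
lemma exists_character_extension {G : Type*} [Group G] (Λ : Subgroup G) (ψ : Λ →* Circle)
    (hψ : ∀ k : Λ, (k : G) ∈ commutator G → ψ k = 1) :
    ∃ χ : G →* Circle, ∀ k : Λ, χ k = ψ k := by
  let f : Λ →* Abelianization G := Abelianization.of.comp Λ.subtype
  have hker : f.ker ≤ ψ.ker := fun k hk => by
    refine hψ k ?_
    rw [← Abelianization.ker_of]
    exact hk
  let ψ' : f.range →* Circle :=
    (QuotientGroup.lift f.ker ψ hker).comp (QuotientGroup.quotientKerEquivRange f).symm.toMonoidHom
  have hψ' (k : Λ) : ψ' ⟨f k, k, rfl⟩ = ψ k := by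
    have : (QuotientGroup.quotientKerEquivRange f).symm ⟨f k, k, rfl⟩ = QuotientGroup.mk k := by
      rw [MulEquiv.symm_apply_eq]; rfl
    simp only [ψ', MonoidHom.comp_apply]
    change QuotientGroup.lift f.ker ψ hker
      ((QuotientGroup.quotientKerEquivRange f).symm ⟨f k, k, rfl⟩) = ψ k
    rw [this]; rfl
  obtain ⟨χ, hχ⟩ := baer_circle.extension_property_addMonoidHom f.range.subtype.toAdditive
    f.range.subtype_injective ψ'.toAdditive
  refine ⟨(MonoidHom.toAdditive.symm χ).comp Abelianization.of, fun k => ?_⟩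
  rw [← hψ' k]
  exact congrArg Additive.toMul
    (DFunLike.congr_fun hχ (Additive.ofMul (⟨f k, k, rfl⟩ : f.range)))

end CharacterExtension

section Frames

variable {G : Type*} [Group G] {E F : Type*} [NormedAddCommGroup E] [InnerProductSpace ℂ E]
  [NormedAddCommGroup F] [InnerProductSpace ℂ F]

lemma map_mul_apply (ρ : G →* (E ≃ₗᵢ[ℂ] E)) (g h : G) (x : E) : ρ (g * h) x = ρ g (ρ h x) := by
  rw [map_mul]; rfl

lemma map_one_apply (ρ : G →* (E ≃ₗᵢ[ℂ] E)) (x : E) : ρ 1 x = x := by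
  rw [map_one]; rfl

lemma map_apply_map_inv_apply (ρ : G →* (E ≃ₗᵢ[ℂ] E)) (g : G) (x : E) : ρ g (ρ g⁻¹ x) = x := by
  rw [← map_mul_apply, mul_inv_cancel, map_one_apply]

lemma map_inv_apply_map_apply (ρ : G →* (E ≃ₗᵢ[ℂ] E)) (g : G) (x : E) : ρ g⁻¹ (ρ g x) = x := by
  rw [← map_mul_apply, inv_mul_cancel, map_one_apply]

/-- The operators of two elements `g` and `h` in a unitary representation commute up to the scalar
`β g h`. -/
def CommutesVia (ρ : G →* (E ≃ₗᵢ[ℂ] E)) (β : G → G → Circle) : Prop :=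
  ∀ g h x, ρ g (ρ h x) = (β g h : ℂ) • ρ h (ρ g x)

/-- `x` is a unit vector that is a joint eigenvector of the operators of the subgroup `Λ`, with
character `χ`. -/
def IsEigen (ρ : G →* (E ≃ₗᵢ[ℂ] E)) (Λ : Subgroup G) (χ : Λ →* Circle) (x : E) : Prop :=
  ‖x‖ = 1 ∧ ∀ k : Λ, ρ k x = (χ k : ℂ) • x

/-- `Λ` is its own orthogonal complement for the commutation factor `β`. -/
def IsSelfOrthogonal (β : G → G → Circle) (Λ : Subgroup G) : Prop :=
  ∀ g, g ∈ Λ ↔ ∀ h ∈ Λ, β h g = 1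

variable {ρ : G →* (E ≃ₗᵢ[ℂ] E)} {β : G → G → Circle} {Λ : Subgroup G}

lemma exists_character_of_eigenvector {x : E} (hx : ‖x‖ = 1)
    (h : ∀ k ∈ Λ, ∃ z : ℂ, ρ k x = z • x) : ∃ χ : Λ →* Circle, IsEigen ρ Λ χ x := by
  have hx0 : x ≠ 0 := by rintro rfl; simp at hx
  choose z hz using fun k : Λ => h k k.2
  have hz1 (k : Λ) : ‖z k‖ = 1 := by
    have := congrArg norm (hz k)
    rwa [LinearIsometryEquiv.norm_map, norm_smul, hx, mul_one, eq_comm] at this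
  refine ⟨MonoidHom.mk' (fun k => ⟨z k, mem_sphere_zero_iff_norm.2 (hz1 k)⟩) fun k l => ?_, hx, hz⟩
  refine Subtype.ext (smul_left_injective ℂ hx0 ?_)
  change z (k * l) • x = (z k * z l) • x
  rw [← hz, Subgroup.coe_mul, map_mul_apply, hz l, map_smul, hz k,
    smul_smul, mul_comm]

/-- Commuting operators on a non-zero finite-dimensional invariant subspace have a joint
eigenvector: on a minimal invariant subspace they are all scalar. -/
lemma exists_joint_eigenvector [FiniteDimensional ℂ E] (hρ : CommutesVia ρ β)
    (hΛ : IsSelfOrthogonal β Λ) {U : Submodule ℂ E} (hU : U ≠ ⊥)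
    (hinv : ∀ g, ∀ y ∈ U, ρ g y ∈ U) :
    ∃ y ∈ U, ‖y‖ = 1 ∧ ∀ k ∈ Λ, ∃ z : ℂ, ρ k y = z • y := by
  obtain ⟨W, ⟨hW0, hWU, hWinv⟩, hmin⟩ := IsArtinian.set_has_minimal
    {W : Submodule ℂ E | W ≠ ⊥ ∧ W ≤ U ∧ ∀ g ∈ Λ, ∀ y ∈ W, ρ g y ∈ W}
    ⟨U, hU, le_rfl, fun g _ => hinv g⟩
  obtain ⟨y, hy, hy0⟩ := W.ne_bot_iff.1 hW0
  have hscal : ∀ k ∈ Λ, ∃ z : ℂ, ∀ w ∈ W, ρ k w = z • w := by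
    intro k hk
    let T : Module.End ℂ W :=
      ((ρ k).toLinearEquiv : E →ₗ[ℂ] E).restrict (fun w hw => hWinv k hk w hw)
    have : Nontrivial W := Submodule.nontrivial_iff_ne_bot.2 hW0
    obtain ⟨z, hz⟩ := Module.End.exists_eigenvalue T
    obtain ⟨⟨v, hvW⟩, hv, hv0⟩ := hz.exists_hasEigenvector
    have hv' : ρ k v = z • v := congrArg Subtype.val (Module.End.mem_eigenspace_iff.1 hv)
    refine ⟨z, fun w hw => ?_⟩
    let W' : Submodule ℂ E :=
      W ⊓ LinearMap.ker (((ρ k).toLinearEquiv : E →ₗ[ℂ] E) - z • LinearMap.id)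
    have hmem (u : E) : u ∈ W' ↔ u ∈ W ∧ ρ k u = z • u := by
      simp [W', sub_eq_zero]
    have hW' : W' = W := by
      by_contra hne
      refine hmin W' ⟨?_, inf_le_left.trans hWU, ?_⟩ (lt_of_le_of_ne inf_le_left hne)
      · refine (Submodule.ne_bot_iff _).2 ⟨v, (hmem v).2 ⟨hvW, hv'⟩, fun h => hv0 ?_⟩
        exact Subtype.ext h
      · intro g hg u hu
        obtain ⟨hu1, hu2⟩ := (hmem u).1 hu
        refine (hmem _).2 ⟨hWinv g hg u hu1, ?_⟩
        rw [hρ k g, (hΛ g).1 hg k hk, hu2, map_smul]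
        simp
    exact ((hmem w).1 (hW' ▸ hw)).2
  have hny : (‖y‖ : ℂ) ≠ 0 := by simpa using hy0
  refine ⟨(‖y‖ : ℂ)⁻¹ • y, U.smul_mem _ (hWU hy), ?_, fun k hk => ?_⟩
  · rw [norm_smul, norm_inv, Complex.norm_real, norm_norm]
    exact inv_mul_cancel₀ (by simpa using hy0)
  · obtain ⟨z, hz⟩ := hscal k hk
    exact ⟨z, by rw [map_smul, hz y hy, smul_comm]⟩

/-- The translates of a joint eigenvector by different cosets belong to different characters of
`Λ`, and are therefore orthogonal. -/
lemma IsEigen.inner_eq_zero (hρ : CommutesVia ρ β) (hΛ : IsSelfOrthogonal β Λ) {χ : Λ →* Circle}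
    {x : E} (hx : IsEigen ρ Λ χ x) {g : G} (hg : g ∉ Λ) : inner ℂ x (ρ g x) = 0 := by
  have : ∃ h ∈ Λ, β h g ≠ 1 := by
    by_contra! h
    exact hg ((hΛ g).2 h)
  obtain ⟨h, hh, hne⟩ := this
  have h1 : inner ℂ x (ρ g x) = (β h g : ℂ) * inner ℂ x (ρ g x) := by
    have e := (ρ h).inner_map_map x (ρ g x)
    have hχ : (starRingEnd ℂ) (χ ⟨h, hh⟩ : ℂ) * (χ ⟨h, hh⟩ : ℂ) = 1 := by
      rw [mul_comm, Complex.mul_conj]; simp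
    rw [hρ h g, hx.2 ⟨h, hh⟩, map_smul, inner_smul_left, inner_smul_right, inner_smul_right] at e
    calc inner ℂ x (ρ g x) = _ := e.symm
      _ = ((starRingEnd ℂ) (χ ⟨h, hh⟩ : ℂ) * (χ ⟨h, hh⟩ : ℂ)) *
          ((β h g : ℂ) * inner ℂ x (ρ g x)) := by ring
      _ = _ := by rw [hχ, one_mul]
  have h2 : (1 - (β h g : ℂ)) * inner ℂ x (ρ g x) = 0 := by linear_combination h1
  rcases mul_eq_zero.1 h2 with h3 | h3
  · exact absurd (Subtype.ext (by simpa using (sub_eq_zero.1 h3).symm)) hne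
  · exact h3

/-- A family of joint eigenvectors of `Λ` that generate pairwise orthogonal subrepresentations. -/
structure Frame {κ : Type*} (ρ : G →* (E ≃ₗᵢ[ℂ] E)) (Λ : Subgroup G) (χ : κ → Λ →* Circle)
    (x : κ → E) : Prop where
  eigen : ∀ b, IsEigen ρ Λ (χ b) (x b)
  orth : ∀ b b', b ≠ b' → ∀ g, inner ℂ (x b) (ρ g (x b')) = 0

/-- The translates of the vectors of a frame by representatives of the cosets of `Λ`. Other
representatives would change them by scalars only. -/
noncomputable def frameVec {κ : Type*} (ρ : G →* (E ≃ₗᵢ[ℂ] E)) (Λ : Subgroup G) (x : κ → E)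
    (y : κ × G ⧸ Λ) : E := ρ y.2.out (x y.1)

variable {κ : Type*} {χ : κ → Λ →* Circle} {x : κ → E}

lemma inner_map_eq (g h : G) (y z : E) : inner ℂ (ρ g y) (ρ h z) = inner ℂ y (ρ (g⁻¹ * h) z) := by
  rw [← (ρ g).inner_map_map y, ← map_mul_apply, mul_inv_cancel_left]

lemma Frame.orthonormal (hρ : CommutesVia ρ β) (hΛ : IsSelfOrthogonal β Λ)
    (hx : Frame ρ Λ χ x) : Orthonormal ℂ (frameVec ρ Λ x) := by
  refine ⟨fun y => ?_, ?_⟩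
  · rw [frameVec, LinearIsometryEquiv.norm_map, (hx.eigen y.1).1]
  · rintro ⟨b, c⟩ ⟨b', c'⟩ hne
    simp only [frameVec]
    rw [inner_map_eq]
    by_cases hb : b = b'
    · subst hb
      refine (hx.eigen b).inner_eq_zero hρ hΛ fun h => hne ?_
      rw [← QuotientGroup.eq, QuotientGroup.out_eq', QuotientGroup.out_eq'] at h
      rw [h]
    · exact hx.orth b b' hb _

lemma out_inv_mul_mem (g : G) (c : G ⧸ Λ) :
    (QuotientGroup.mk (g * c.out) : G ⧸ Λ).out⁻¹ * (g * c.out) ∈ Λ := by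
  rw [← QuotientGroup.eq, QuotientGroup.out_eq']

/-- The operators act on the vectors of a frame by monomial matrices. -/
lemma Frame.map_frameVec (hx : Frame ρ Λ χ x) (g : G) (b : κ) (c : G ⧸ Λ) :
    ρ g (frameVec ρ Λ x (b, c)) =
      (χ b ⟨_, out_inv_mul_mem g c⟩ : ℂ) •
        frameVec ρ Λ x (b, QuotientGroup.mk (g * c.out)) := by
  simp only [frameVec]
  rw [← map_smul, ← (hx.eigen b).2, ← map_mul_apply, ← map_mul_apply, mul_inv_cancel_left]

/-- A maximal frame spans: otherwise the orthogonal complement of its span contains a further joint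
eigenvector. Hence the dimension is a multiple of the index of `Λ`. -/
theorem exists_frame [FiniteDimensional ℂ E] [Fintype (G ⧸ Λ)] (hρ : CommutesVia ρ β)
    (hΛ : IsSelfOrthogonal β Λ) :
    ∃ (s : ℕ) (χ : Fin s → Λ →* Circle) (x : Fin s → E), Frame ρ Λ χ x ∧
      s * Fintype.card (G ⧸ Λ) = Module.finrank ℂ E := by
  let P (s : ℕ) : Prop := ∃ (χ : Fin s → Λ →* Circle) (x : Fin s → E), Frame ρ Λ χ x
  have hbound {s : ℕ} (hs : P s) : s * Fintype.card (G ⧸ Λ) ≤ Module.finrank ℂ E := by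
    obtain ⟨χ, x, hx⟩ := hs
    have := (hx.orthonormal hρ hΛ).linearIndependent.fintype_card_le_finrank
    rwa [Fintype.card_prod, Fintype.card_fin] at this
  have hpos : 0 < Fintype.card (G ⧸ Λ) := Fintype.card_pos_iff.2 ⟨QuotientGroup.mk 1⟩
  obtain ⟨s, ⟨χ, x, hx⟩, hs⟩ : ∃ s, P s ∧ ¬P (s + 1) := by
    by_contra! h
    have hall (s : ℕ) : P s := by
      induction s with
      | zero => exact ⟨Fin.elim0, Fin.elim0, ⟨fun b => b.elim0, fun b => b.elim0⟩⟩
      | succ s ih => exact h s ih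
    have h1 := hbound (hall (Module.finrank ℂ E + 1))
    have h2 := Nat.le_mul_of_pos_right (Module.finrank ℂ E + 1) hpos
    omega
  refine ⟨s, χ, x, hx, ?_⟩
  by_contra hne
  let S : Submodule ℂ E := Submodule.span ℂ (Set.range (frameVec ρ Λ x))
  have hfr : Module.finrank ℂ S = s * Fintype.card (G ⧸ Λ) := by
    rw [finrank_span_eq_card (hx.orthonormal hρ hΛ).linearIndependent, Fintype.card_prod,
      Fintype.card_fin]
  have hSinv (g : G) : ∀ y ∈ S, ρ g y ∈ S := by
    intro y hy
    induction hy using Submodule.span_induction with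
    | mem y hy =>
      obtain ⟨⟨b, c⟩, rfl⟩ := hy
      rw [hx.map_frameVec]
      exact S.smul_mem _ (Submodule.subset_span ⟨_, rfl⟩)
    | zero => rw [map_zero]; exact S.zero_mem
    | add y z _ _ hy hz => rw [map_add]; exact S.add_mem hy hz
    | smul a y _ hy => rw [map_smul]; exact S.smul_mem _ hy
  have hSinv' (g : G) : ∀ y ∈ Sᗮ, ρ g y ∈ Sᗮ := by
    intro y hy
    rw [Submodule.mem_orthogonal] at hy ⊢
    intro u hu
    have := inner_map_eq (ρ := ρ) (g⁻¹) 1 u y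
    rw [map_one_apply, inv_inv, mul_one] at this
    rw [← this]
    exact hy _ (hSinv _ u hu)
  have hSbot : Sᗮ ≠ ⊥ := by
    intro h
    rw [Submodule.orthogonal_eq_bot_iff] at h
    rw [h, finrank_top] at hfr
    exact hne hfr.symm
  obtain ⟨y, hyS, hy1, hyk⟩ := exists_joint_eigenvector hρ hΛ hSbot hSinv'
  obtain ⟨χ', hχ'⟩ := exists_character_of_eigenvector hy1 hyk
  have hxS (b : Fin s) (g : G) : ρ g (x b) ∈ S := by
    have h1 : x b ∈ S := by
      have h2 := hSinv ((QuotientGroup.mk 1 : G ⧸ Λ).out⁻¹) _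
        (Submodule.subset_span ⟨(b, QuotientGroup.mk 1), rfl⟩)
      rwa [frameVec, ← map_mul_apply, inv_mul_cancel, map_one_apply] at h2
    exact hSinv g _ h1
  refine hs ⟨Fin.snoc χ χ', Fin.snoc x y, ⟨fun b => ?_, fun b b' => ?_⟩⟩
  · refine Fin.lastCases ?_ (fun b => ?_) b
    · simpa using hχ'
    · simpa using hx.eigen b
  · refine Fin.lastCases ?_ (fun b => ?_) b
    · refine Fin.lastCases (fun h => absurd rfl h) (fun b' _ g => ?_) b'
      simp only [Fin.snoc_last, Fin.snoc_castSucc]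
      exact Submodule.inner_left_of_mem_orthogonal (hxS b' g) hyS
    · refine Fin.lastCases (fun _ g => ?_) (fun b' hbb g => ?_) b'
      · simp only [Fin.snoc_last, Fin.snoc_castSucc]
        have := hxS b 1
        rw [map_one_apply] at this
        exact Submodule.inner_right_of_mem_orthogonal this (hSinv' g y hyS)
      · simp only [Fin.snoc_castSucc]
        exact hx.orth b b' (fun h => hbb (by rw [h])) g

/-- The orthonormal basis given by a frame of full dimension. -/
noncomputable def Frame.basis [Fintype κ] [Fintype (G ⧸ Λ)] [FiniteDimensional ℂ E]
    (hρ : CommutesVia ρ β) (hΛ : IsSelfOrthogonal β Λ) (hx : Frame ρ Λ χ x)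
    (hcard : Fintype.card κ * Fintype.card (G ⧸ Λ) = Module.finrank ℂ E) :
    OrthonormalBasis (κ × G ⧸ Λ) ℂ E :=
  OrthonormalBasis.mk (hx.orthonormal hρ hΛ) (by
    refine (LinearIndependent.span_eq_top_of_card_eq_finrank'
      (hx.orthonormal hρ hΛ).linearIndependent ?_).ge
    rw [Fintype.card_prod, hcard])

lemma Frame.basis_apply [Fintype κ] [Fintype (G ⧸ Λ)] [FiniteDimensional ℂ E]
    (hρ : CommutesVia ρ β) (hΛ : IsSelfOrthogonal β Λ) (hx : Frame ρ Λ χ x)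
    (hcard : Fintype.card κ * Fintype.card (G ⧸ Λ) = Module.finrank ℂ E) (y : κ × G ⧸ Λ) :
    hx.basis hρ hΛ hcard y = frameVec ρ Λ x y := by
  rw [Frame.basis, OrthonormalBasis.coe_mk]

/-- Two representations that have frames of full dimension with the same characters are unitarily
equivalent. -/
theorem Frame.exists_intertwiner [Fintype κ] [Fintype (G ⧸ Λ)] [FiniteDimensional ℂ E]
    [FiniteDimensional ℂ F] {ρ' : G →* (F ≃ₗᵢ[ℂ] F)} {x' : κ → F}
    (hρ : CommutesVia ρ β) (hρ' : CommutesVia ρ' β) (hΛ : IsSelfOrthogonal β Λ)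
    (hx : Frame ρ Λ χ x) (hx' : Frame ρ' Λ χ x')
    (hcard : Fintype.card κ * Fintype.card (G ⧸ Λ) = Module.finrank ℂ E)
    (hcard' : Fintype.card κ * Fintype.card (G ⧸ Λ) = Module.finrank ℂ F) :
    ∃ U : E ≃ₗᵢ[ℂ] F, ∀ g y, U (ρ g y) = ρ' g (U y) := by
  classical
  let b := hx.basis hρ hΛ hcard
  let b' := hx'.basis hρ' hΛ hcard'
  let U : E ≃ₗᵢ[ℂ] F := b.equiv b' (Equiv.refl _)
  have hU (i : κ × G ⧸ Λ) : U (frameVec ρ Λ x i) = frameVec ρ' Λ x' i := by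
    have := b.equiv_apply_basis b' (Equiv.refl _) i
    simpa only [b, b', Frame.basis_apply, Equiv.refl_apply] using this
  refine ⟨U, fun g y => ?_⟩
  have h : ((U.toLinearEquiv : E →ₗ[ℂ] F) ∘ₗ ((ρ g).toLinearEquiv : E →ₗ[ℂ] E)) =
      ((ρ' g).toLinearEquiv : F →ₗ[ℂ] F) ∘ₗ (U.toLinearEquiv : E →ₗ[ℂ] F) := by
    refine b.toBasis.ext fun i => ?_
    obtain ⟨i, c⟩ := i
    simp only [OrthonormalBasis.coe_toBasis, LinearMap.comp_apply, b, Frame.basis_apply]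
    change U (ρ g _) = ρ' g (U _)
    rw [hx.map_frameVec, map_smul, hU, hU, hx'.map_frameVec]
  exact LinearMap.congr_fun h y

end Frames

/-! ### Representations with prescribed commutation relations -/

section Twisted

variable {n m : ℕ} [NeZero m] {E : Type*} [NormedAddCommGroup E] [InnerProductSpace ℂ E]

/-- A tuple of unitary operators that commute up to the roots of unity prescribed by `D`. -/
def IsTwisted (D : Matrix (Fin n) (Fin n) (ZMod m)) (A : Fin n → (E ≃ₗᵢ[ℂ] E)) : Prop :=
  ∀ i j x, A i (A j x) = (ZMod.toCircle (D i j) : ℂ) • A j (A i x)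

/-- The bilinear form with matrix `D`. -/
def form (D : Matrix (Fin n) (Fin n) (ZMod m)) :
    (Fin n → ZMod m) →+ (Fin n → ZMod m) →+ ZMod m :=
  AddMonoidHom.mk' (fun v => AddMonoidHom.mk' (fun w => v ⬝ᵥ D *ᵥ w)
    (fun w w' => by rw [Matrix.mulVec_add, dotProduct_add]))
    (fun v v' => by ext w; simp [add_dotProduct])

lemma form_apply (D : Matrix (Fin n) (Fin n) (ZMod m)) (v w : Fin n → ZMod m) :
    form D v w = v ⬝ᵥ D *ᵥ w := rfl

/-- The exponents modulo `m` of the generators in a word. -/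
def expHom (n m : ℕ) : FreeGroup (Fin n) →* Multiplicative (Fin n → ZMod m) :=
  FreeGroup.lift fun i => Multiplicative.ofAdd (Pi.single i 1)

lemma expHom_surjective : Function.Surjective (expHom n m) := by
  intro v
  refine ⟨(List.ofFn fun i => FreeGroup.of i ^ (v.toAdd i).val).prod, ?_⟩
  rw [map_list_prod, List.map_ofFn, List.prod_ofFn]
  refine Multiplicative.toAdd.injective ?_
  rw [toAdd_prod]
  funext j
  have hpow (i : Fin n) : (expHom n m (FreeGroup.of i ^ (v.toAdd i).val)).toAdd j =
      if j = i then v.toAdd i else 0 := by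
    rw [map_pow, expHom, FreeGroup.lift_apply_of, toAdd_pow, toAdd_ofAdd, Pi.smul_apply,
      Pi.single_apply, nsmul_eq_mul, ZMod.natCast_zmod_val, mul_ite, mul_one, mul_zero]
  rw [Finset.sum_apply]
  exact (Finset.sum_congr rfl fun i _ => hpow i).trans (by simp)

/-- The scalar up to which the operators of two words commute. -/
noncomputable def commFactor (D : Matrix (Fin n) (Fin n) (ZMod m)) (g h : FreeGroup (Fin n)) :
    Circle :=
  ZMod.toCircle (form D (expHom n m g).toAdd (expHom n m h).toAdd)

variable {D : Matrix (Fin n) (Fin n) (ZMod m)}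

lemma commFactor_of_of (i j : Fin n) :
    commFactor D (FreeGroup.of i) (FreeGroup.of j) = ZMod.toCircle (D i j) := by
  simp [commFactor, expHom, form_apply]

lemma commFactor_mul_left (g g' h : FreeGroup (Fin n)) :
    commFactor D (g * g') h = commFactor D g h * commFactor D g' h := by
  simp [commFactor, AddChar.map_add_eq_mul]

lemma commFactor_one_left (h : FreeGroup (Fin n)) : commFactor D 1 h = 1 := by
  simp [commFactor]

lemma commFactor_inv_mul (g h : FreeGroup (Fin n)) :
    commFactor D g⁻¹ h * commFactor D g h = 1 := by
  rw [← commFactor_mul_left, inv_mul_cancel, commFactor_one_left]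

lemma commFactor_swap (hD : IsAlt D) (g h : FreeGroup (Fin n)) :
    commFactor D g h * commFactor D h g = 1 := by
  rw [commFactor, commFactor, form_swap (B := form D) (fun v => hD.dotProduct_mulVec_self v),
    ← AddChar.map_add_eq_mul, neg_add_cancel, AddChar.map_zero_eq_one]

/-- Commutation relations with the generators extend to all words. -/
lemma commutes_of_forall_generator {ρ : FreeGroup (Fin n) →* (E ≃ₗᵢ[ℂ] E)}
    {h : FreeGroup (Fin n)}
    (hof : ∀ i x, ρ (FreeGroup.of i) (ρ h x) =
      (commFactor D (FreeGroup.of i) h : ℂ) • ρ h (ρ (FreeGroup.of i) x))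
    (g : FreeGroup (Fin n)) (x : E) :
    ρ g (ρ h x) = (commFactor D g h : ℂ) • ρ h (ρ g x) := by
  have hinv (g : FreeGroup (Fin n))
      (hg : ∀ x, ρ g (ρ h x) = (commFactor D g h : ℂ) • ρ h (ρ g x)) (x : E) :
      ρ g⁻¹ (ρ h x) = (commFactor D g⁻¹ h : ℂ) • ρ h (ρ g⁻¹ x) := by
    apply (ρ g).injective
    rw [map_apply_map_inv_apply, map_smul, hg, smul_smul, map_apply_map_inv_apply,
      ← Circle.coe_mul, commFactor_inv_mul, Circle.coe_one, one_smul]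
  induction g using FreeGroup.induction_on generalizing x with
  | C1 => simp [commFactor_one_left]
  | of i => exact hof i x
  | inv_of i _ => exact hinv _ (hof i) x
  | mul g g' hg hg' =>
    rw [map_mul_apply, hg', map_smul, hg, smul_smul, map_mul_apply, commFactor_mul_left,
      Circle.coe_mul, mul_comm]

lemma IsTwisted.commutesVia (hD : IsAlt D) {A : Fin n → (E ≃ₗᵢ[ℂ] E)} (hA : IsTwisted D A) :
    CommutesVia (FreeGroup.lift A) (commFactor D) := by
  intro g h x
  refine commutes_of_forall_generator (fun i x => ?_) g x
  have := commutes_of_forall_generator (D := D) (ρ := FreeGroup.lift A) (h := FreeGroup.of i)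
    (fun j x => by
      rw [commFactor_of_of, FreeGroup.lift_apply_of, FreeGroup.lift_apply_of]
      exact hA j i x) h x
  rw [this, smul_smul, ← Circle.coe_mul, commFactor_swap hD, Circle.coe_one, one_smul]

lemma card_range_form (hD : IsAlt D) : Nat.card (form D).range = imCard D := by
  have h1 : Nat.card (form D).range * Nat.card (form D).ker = Nat.card (Fin n → ZMod m) := by
    rw [← Nat.card_congr (QuotientAddGroup.quotientKerEquivRange (form D)).toEquiv,
      ← AddSubgroup.card_eq_card_quotient_mul_card_addSubgroup]
  have h2 := card_ker_mul_imCard D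
  have h3 : Nat.card (form D).ker = Nat.card (LinearMap.ker D.mulVecLin) := by
    refine Nat.card_congr (Equiv.subtypeEquivRight fun v => ?_)
    rw [AddMonoidHom.mem_ker, LinearMap.mem_ker, Matrix.mulVecLin_apply]
    constructor
    · intro h
      funext i
      have := DFunLike.congr_fun h (Pi.single i 1)
      rw [form_apply, hD.dotProduct_mulVec_swap, single_dotProduct, one_mul] at this
      simpa using this
    · intro h
      refine AddMonoidHom.ext fun w => ?_
      rw [form_apply, hD.dotProduct_mulVec_swap, h, dotProduct_zero, neg_zero,
        AddMonoidHom.zero_apply]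
  rw [Nat.card_fun, Nat.card_eq_fintype_card (α := Fin n), ← h2, h3, mul_comm] at h1
  exact Nat.eq_of_mul_eq_mul_left Nat.card_pos h1

/-- The words whose exponents lie in a Lagrangian subgroup form a self-orthogonal subgroup, of
index the square root of the order of the row space. -/
theorem exists_isSelfOrthogonal (hD : IsAlt D) :
    ∃ Λ : Subgroup (FreeGroup (Fin n)), IsSelfOrthogonal (commFactor D) Λ ∧ Finite (_ ⧸ Λ) ∧
      Nat.card (rowSpace (D.map (incl m))) = Nat.card (_ ⧸ Λ) ^ 2 := by
  have hB : ∀ v, form D v v = 0 := fun v => hD.dotProduct_mulVec_self v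
  obtain ⟨L, hL⟩ := exists_isLagrangian hB
  have hindex : (L.toSubgroup.comap (expHom n m)).index = L.index := by
    rw [Subgroup.index_comap_of_surjective (f := expHom n m) _ expHom_surjective]
    rfl
  refine ⟨L.toSubgroup.comap (expHom n m), fun g => ?_, ?_, ?_⟩
  · refine (hL (expHom n m g).toAdd).trans ⟨fun h k hk => ?_, fun h w hw => ?_⟩
    · rw [commFactor, h _ hk, AddChar.map_zero_eq_one]
    · obtain ⟨k, hk⟩ := expHom_surjective (n := n) (m := m) (Multiplicative.ofAdd w)
      have h1 := h k (by rw [Subgroup.mem_comap, hk]; exact hw)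
      rw [commFactor, hk, ← AddChar.map_zero_eq_one (ZMod.toCircle (N := m))] at h1
      exact ZMod.injective_toCircle h1
  · refine Nat.finite_of_card_ne_zero ?_
    change (L.toSubgroup.comap (expHom n m)).index ≠ 0
    rw [hindex]
    exact AddSubgroup.index_ne_zero_of_finite
  · rw [hD.card_rowSpace NeZero.one_le, ← card_range_form hD, hL.index_sq hB, ← hindex]
    rfl

/-- The dimension of a representation with the relations of `D` is a multiple of `σ(D)`, the index of
a self-orthogonal subgroup. -/
theorem IsTwisted.sigmaDvd [FiniteDimensional ℂ E] (hD : IsAlt D) {A : Fin n → (E ≃ₗᵢ[ℂ] E)}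
    (hA : IsTwisted D A) : SigmaDvd (D.map (incl m)) (Module.finrank ℂ E) := by
  obtain ⟨Λ, hΛ, hfin, hcard⟩ := exists_isSelfOrthogonal hD
  have := Fintype.ofFinite (FreeGroup (Fin n) ⧸ Λ)
  obtain ⟨s, χ, x, -, hs⟩ := exists_frame (hA.commutesVia hD) hΛ
  rw [sigmaDvd_iff]
  exact ⟨_, hcard, s, by rw [← hs, Nat.card_eq_fintype_card, mul_comm]⟩

end Twisted

section Existence

variable {n m : ℕ} [NeZero m] {D : Matrix (Fin n) (Fin n) (ZMod m)}

/-- A translation of functions on a finite group followed by multiplication with a function of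
absolute value one. -/
noncomputable def shiftPhase {V : Type*} [AddGroup V] [Fintype V] (e : V) (z : V → Circle) :
    EuclideanSpace ℂ V ≃ₗᵢ[ℂ] EuclideanSpace ℂ V :=
  LinearIsometry.toLinearIsometryEquiv
    { toFun := fun f => WithLp.toLp 2 fun u => (z u : ℂ) * f (u + e)
      map_add' := fun f g => by ext u; simp [mul_add]
      map_smul' := fun c f => by ext u; simp [mul_left_comm]
      norm_map' := fun f => by
        simp only [LinearMap.coe_mk, AddHom.coe_mk, EuclideanSpace.norm_eq, norm_mul,
          Circle.norm_coe, one_mul]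
        congr 1
        exact Equiv.sum_comp (Equiv.addRight e) (fun u => ‖f u‖ ^ 2) } rfl

lemma shiftPhase_apply {V : Type*} [AddGroup V] [Fintype V] (e : V) (z : V → Circle)
    (f : EuclideanSpace ℂ V) (u : V) : shiftPhase e z f u = (z u : ℂ) * f (u + e) := rfl

/-- Some representation with the commutation relations prescribed by `D`, on functions on
`(ℤ/m)^n`: the `i`-th operator is translation by the `i`-th basis vector, with a phase that only
depends on the coordinates before the `i`-th. -/
lemma exists_isTwisted_functions (hD : IsAlt D) :
    ∃ A : Fin n → (EuclideanSpace ℂ (Fin n → ZMod m) ≃ₗᵢ[ℂ] EuclideanSpace ℂ (Fin n → ZMod m)),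
      IsTwisted D A := by
  let φ (i : Fin n) (u : Fin n → ZMod m) : ZMod m := ∑ l, if l < i then D l i * u l else 0
  have hφ (i j : Fin n) (u : Fin n → ZMod m) :
      φ i (u + Pi.single j 1) = φ i u + if j < i then D j i else 0 := by
    have : (if j < i then D j i else 0) =
        ∑ l, if l < i then D l i * (Pi.single j 1 : Fin n → ZMod m) l else 0 := by
      rw [Finset.sum_eq_single j]
      · simp
      · intro l _ hl; simp [hl]
      · simp
    rw [this, ← Finset.sum_add_distrib]
    refine Finset.sum_congr rfl fun l _ => ?_
    split_ifs <;> simp [mul_add]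
  refine ⟨fun i => shiftPhase (Pi.single i 1) fun u => ZMod.toCircle (φ i u), fun i j f => ?_⟩
  ext u
  have key : φ i u + φ j (u + Pi.single i 1) = D i j + (φ j u + φ i (u + Pi.single j 1)) := by
    rw [hφ, hφ]
    rcases lt_trichotomy i j with h | h | h
    · rw [if_pos h, if_neg h.not_gt]; ring
    · subst h
      rw [if_neg (lt_irrefl i), hD.2]; ring
    · rw [if_neg h.not_gt, if_pos h, hD.1 i j]; ring
  have key' := congrArg (fun a => (ZMod.toCircle a : ℂ)) key
  simp only [AddChar.map_add_eq_mul, Circle.coe_mul] at key'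
  rw [PiLp.smul_apply, smul_eq_mul, shiftPhase_apply, shiftPhase_apply, shiftPhase_apply,
    shiftPhase_apply, add_right_comm u (Pi.single j 1), ← mul_assoc, key']
  ring

variable {E : Type*} [NormedAddCommGroup E] [InnerProductSpace ℂ E] [FiniteDimensional ℂ E]

/-- The restriction of a unitary operator to an invariant subspace. -/
noncomputable def restrictIsometry (A : E ≃ₗᵢ[ℂ] E) (S : Submodule ℂ E) (h : ∀ y ∈ S, A y ∈ S) :
    S ≃ₗᵢ[ℂ] S :=
  LinearIsometry.toLinearIsometryEquiv
    { toLinearMap := (A.toLinearEquiv : E →ₗ[ℂ] E).restrict h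
      norm_map' := fun y => A.norm_map y } rfl

/-- A direct sum of copies of a representation, in coordinates. -/
lemma IsTwisted.exists_copies {B : Fin n → (E ≃ₗᵢ[ℂ] E)} (hB : IsTwisted D B) (s : ℕ) {d : ℕ}
    (hd : s * Module.finrank ℂ E = d) :
    ∃ A : Fin n → (EuclideanSpace ℂ (Fin d) ≃ₗᵢ[ℂ] EuclideanSpace ℂ (Fin d)), IsTwisted D A := by
  let C (i : Fin n) : PiLp 2 (fun _ : Fin s => E) ≃ₗᵢ[ℂ] PiLp 2 (fun _ : Fin s => E) :=
    LinearIsometryEquiv.piLpCongrRight 2 fun _ => B i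
  have hC : IsTwisted D C := fun i j z => by
    ext1 b
    exact hB i j (z b)
  have hdim : Module.finrank ℂ (PiLp 2 (fun _ : Fin s => E)) = d := by
    rw [(WithLp.linearEquiv 2 ℂ (Fin s → E)).finrank_eq, Module.finrank_pi_fintype]
    simpa using hd
  let e : PiLp 2 (fun _ : Fin s => E) ≃ₗᵢ[ℂ] EuclideanSpace ℂ (Fin d) :=
    ((stdOrthonormalBasis ℂ _).reindex (finCongr hdim)).repr
  refine ⟨fun i => (e.symm.trans (C i)).trans e, fun i j z => ?_⟩
  simp only [LinearIsometryEquiv.trans_apply, LinearIsometryEquiv.symm_apply_apply]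
  rw [hC i j, map_smul]

/-- If `σ(D)` divides `d`, the relations of `D` have a representation of dimension `d`: a direct
sum of copies of the representation generated by a joint eigenvector in an arbitrary one. -/
theorem exists_isTwisted_of_sigmaDvd (hD : IsAlt D) {d : ℕ}
    (hd : SigmaDvd (D.map (incl m)) d) :
    ∃ A : Fin n → (EuclideanSpace ℂ (Fin d) ≃ₗᵢ[ℂ] EuclideanSpace ℂ (Fin d)), IsTwisted D A := by
  obtain ⟨Λ, hΛ, hfin, hcard⟩ := exists_isSelfOrthogonal hD
  have := Fintype.ofFinite (FreeGroup (Fin n) ⧸ Λ)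
  obtain ⟨A, hA⟩ := exists_isTwisted_functions hD
  have hρ := hA.commutesVia hD
  have hne : (⊤ : Submodule ℂ (EuclideanSpace ℂ (Fin n → ZMod m))) ≠ ⊥ := top_ne_bot
  obtain ⟨y, -, hy1, hyk⟩ := exists_joint_eigenvector hρ hΛ hne (fun _ _ _ => trivial)
  obtain ⟨χ, hχ⟩ := exists_character_of_eigenvector hy1 hyk
  have hx : Frame (FreeGroup.lift A) Λ (fun _ : Unit => χ) (fun _ => y) :=
    ⟨fun _ => hχ, fun b b' h => absurd (Subsingleton.elim b b') h⟩
  let S := Submodule.span ℂ (Set.range (frameVec (FreeGroup.lift A) Λ fun _ : Unit => y))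
  have hS (g) : ∀ z ∈ S, FreeGroup.lift A g z ∈ S := by
    intro z hz
    induction hz using Submodule.span_induction with
    | mem z hz =>
      obtain ⟨⟨b, c⟩, rfl⟩ := hz
      rw [hx.map_frameVec]
      exact S.smul_mem _ (Submodule.subset_span ⟨_, rfl⟩)
    | zero => rw [map_zero]; exact S.zero_mem
    | add z w _ _ hz hw => rw [map_add]; exact S.add_mem hz hw
    | smul a z _ hz => rw [map_smul]; exact S.smul_mem _ hz
  have hfr : Module.finrank ℂ S = Fintype.card (FreeGroup (Fin n) ⧸ Λ) := by
    rw [finrank_span_eq_card (hx.orthonormal hρ hΛ).linearIndependent, Fintype.card_prod,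
      Fintype.card_unit, one_mul]
  obtain ⟨σ, hσ, s, rfl⟩ := sigmaDvd_iff.1 hd
  rw [hcard, Nat.card_eq_fintype_card] at hσ
  have hσ' := Nat.pow_left_injective (n := 2) (by norm_num) hσ
  let B (i : Fin n) : S ≃ₗᵢ[ℂ] S := restrictIsometry (A i) S (fun z hz => by
    have := hS (FreeGroup.of i) z hz
    rwa [FreeGroup.lift_apply_of] at this)
  have hB : IsTwisted (E := S) D B := by
    intro i j z
    exact Subtype.ext (hA i j z)
  exact hB.exists_copies s (by rw [hfr, hσ', mul_comm])

end Existence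

section Twisting

variable {G : Type*} [Group G] {E F : Type*} [NormedAddCommGroup E] [InnerProductSpace ℂ E]
  [NormedAddCommGroup F] [InnerProductSpace ℂ F]
  {ρ : G →* (E ≃ₗᵢ[ℂ] E)} {ρ' : G →* (F ≃ₗᵢ[ℂ] F)} {β : G → G → Circle} {Λ : Subgroup G}

open scoped commutatorElement in
lemma CommutesVia.map_commutatorElement (hρ : CommutesVia ρ β) (g h : G) (x : E) :
    ρ ⁅g, h⁆ x = (β g h : ℂ) • x := by
  rw [commutatorElement_def, mul_assoc, mul_assoc, map_mul_apply, map_mul_apply, hρ g h,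
    map_mul_apply, map_apply_map_inv_apply, map_apply_map_inv_apply]

/-- Products of commutators act by scalars that depend on the commutation factor only. -/
lemma CommutesVia.map_commutator (hρ : CommutesVia ρ β) (hρ' : CommutesVia ρ' β) {g : G}
    (hg : g ∈ commutator G) :
    ∃ z : Circle, (∀ x, ρ g x = (z : ℂ) • x) ∧ ∀ x, ρ' g x = (z : ℂ) • x := by
  rw [commutator_eq_closure] at hg
  induction hg using Subgroup.closure_induction with
  | mem g hg =>
    obtain ⟨a, b, rfl⟩ := hg
    exact ⟨β a b, hρ.map_commutatorElement a b, hρ'.map_commutatorElement a b⟩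
  | one => exact ⟨1, by simp, by simp⟩
  | mul g h _ _ hg hh =>
    obtain ⟨z, h1, h2⟩ := hg
    obtain ⟨w, h3, h4⟩ := hh
    exact ⟨z * w, fun x => by rw [map_mul_apply, h3, map_smul, h1, smul_smul, Circle.coe_mul,
      mul_comm], fun x => by rw [map_mul_apply, h4, map_smul, h2, smul_smul, Circle.coe_mul,
      mul_comm]⟩
  | inv g _ hg =>
    obtain ⟨z, h1, h2⟩ := hg
    have hz : (z : ℂ) * ((z⁻¹ : Circle) : ℂ) = 1 := by rw [← Circle.coe_mul]; simp
    refine ⟨z⁻¹, fun x => (ρ g).injective ?_, fun x => (ρ' g).injective ?_⟩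
    · rw [map_apply_map_inv_apply, h1, smul_smul, hz, one_smul]
    · rw [map_apply_map_inv_apply, h2, smul_smul, hz, one_smul]

/-- The characters of joint eigenvectors in two representations with the same commutation factor
differ by a character of the whole group: commutators act by the same scalars in both. -/
lemma exists_character_ratio (hρ : CommutesVia ρ β) (hρ' : CommutesVia ρ' β)
    {χ χ' : Λ →* Circle} {x : E} {x' : F} (hx : IsEigen ρ Λ χ x) (hx' : IsEigen ρ' Λ χ' x') :
    ∃ lam : G →* Circle, ∀ k : Λ, χ' k = lam k * χ k := by
  obtain ⟨lam, hlam⟩ := exists_character_extension Λ (χ' / χ) (by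
    intro k hk
    obtain ⟨z, h1, h2⟩ := hρ.map_commutator hρ' hk
    have e1 : χ k = z := Subtype.ext (smul_left_injective ℂ
      (by rintro rfl; simpa using hx.1 : x ≠ 0) ((hx.2 k).symm.trans (h1 x)))
    have e2 : χ' k = z := Subtype.ext (smul_left_injective ℂ
      (by rintro rfl; simpa using hx'.1 : x' ≠ 0) ((hx'.2 k).symm.trans (h2 x')))
    rw [MonoidHom.div_apply, e1, e2, div_self'])
  exact ⟨lam, fun k => by rw [hlam, MonoidHom.div_apply, div_mul_cancel]⟩

variable {κ : Type*} {χ : κ → Λ →* Circle} {x : κ → E}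

/-- Multiplying a representation by operators that are scalar on the blocks of a frame multiplies
the characters of the frame. -/
lemma Frame.twist (hx : Frame ρ Λ χ x) {lam : κ → G →* Circle} {M ρ'' : G →* (E ≃ₗᵢ[ℂ] E)}
    (hM : ∀ g b, M g (x b) = (lam b g : ℂ) • x b) (hρ'' : ∀ g y, ρ'' g y = ρ g (M g y)) :
    Frame ρ'' Λ (fun b => (lam b).comp Λ.subtype * χ b) x := by
  refine ⟨fun b => ⟨(hx.eigen b).1, fun k => ?_⟩, fun b b' hb g => ?_⟩
  · rw [hρ'', hM, map_smul, (hx.eigen b).2, smul_smul]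
    simp
  · rw [hρ'', hM, map_smul, inner_smul_right, hx.orth b b' hb, mul_zero]

end Twisting

/-! ### Paths of tuples of unitary matrices -/

section Operators

variable {ι : Type*} [Fintype ι] [DecidableEq ι]

/-- Unitary matrices as unitary operators. -/
noncomputable def toOperator :
    Matrix.unitaryGroup ι ℂ ≃* (EuclideanSpace ℂ ι ≃ₗᵢ[ℂ] EuclideanSpace ℂ ι) :=
  (Unitary.mapEquiv
    { toMulEquiv := (Matrix.toEuclideanCLM (n := ι) (𝕜 := ℂ)).toRingEquiv.toMulEquiv
      map_star' := map_star (Matrix.toEuclideanCLM (n := ι) (𝕜 := ℂ)) }).toMulEquiv.trans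
    Unitary.linearIsometryEquiv

lemma toOperator_apply (A : Matrix.unitaryGroup ι ℂ) (x : EuclideanSpace ℂ ι) :
    toOperator A x = WithLp.toLp 2 ((A : Matrix ι ι ℂ) *ᵥ x.ofLp) := rfl

lemma toOperator_mul_apply (A B : Matrix.unitaryGroup ι ℂ) (x : EuclideanSpace ℂ ι) :
    toOperator (A * B) x = toOperator A (toOperator B x) := by
  rw [map_mul]; rfl

/-- The diagonal unitary matrices. -/
noncomputable def diagonalUnitary : (ι → Circle) →* Matrix.unitaryGroup ι ℂ where
  toFun z := ⟨Matrix.diagonal fun i => (z i : ℂ), by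
    rw [Matrix.mem_unitaryGroup_iff, Matrix.star_eq_conjTranspose, Matrix.diagonal_conjTranspose,
      Matrix.diagonal_mul_diagonal, ← Matrix.diagonal_one]
    congr 1
    funext i
    simp [Complex.mul_conj]⟩
  map_one' := Subtype.ext (by simp)
  map_mul' z w := Subtype.ext (by simp)

lemma coe_diagonalUnitary (z : ι → Circle) :
    (diagonalUnitary z : Matrix ι ι ℂ) = Matrix.diagonal fun i => (z i : ℂ) := rfl

lemma continuous_diagonalUnitary : Continuous (diagonalUnitary (ι := ι)) := by
  refine Continuous.subtype_mk (Continuous.matrix_diagonal ?_) _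
  fun_prop

lemma coe_diagonalUnitary_const_mul (z : Circle) (A : Matrix.unitaryGroup ι ℂ) :
    ((diagonalUnitary (fun _ => z) * A : Matrix.unitaryGroup ι ℂ) : Matrix ι ι ℂ) =
      (z : ℂ) • (A : Matrix ι ι ℂ) := by
  rw [Submonoid.coe_mul, coe_diagonalUnitary, Matrix.smul_eq_diagonal_mul]

lemma toOperator_diagonalUnitary_single (z : ι → Circle) (a : ι) :
    toOperator (diagonalUnitary z) (EuclideanSpace.single a 1) =
      (z a : ℂ) • EuclideanSpace.single a 1 := by
  rw [toOperator_apply, coe_diagonalUnitary]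
  ext i
  by_cases h : i = a
  · subst h; simp [Matrix.mulVec_diagonal]
  · simp [Matrix.mulVec_diagonal, h]

/-- Unitary matrices that are diagonal in an orthonormal basis. -/
lemma exists_diagonal_in_basis (b : OrthonormalBasis ι ℂ (EuclideanSpace ℂ ι)) :
    ∃ P : (ι → Circle) →* Matrix.unitaryGroup ι ℂ, Continuous P ∧
      ∀ z a, toOperator (P z) (b a) = (z a : ℂ) • b a := by
  let V := toOperator.symm b.repr
  have hV : toOperator V = b.repr := toOperator.apply_symm_apply _
  refine ⟨(MulAut.conj V⁻¹).toMonoidHom.comp diagonalUnitary, ?_, fun z a => ?_⟩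
  · change Continuous fun z => V⁻¹ * diagonalUnitary z * V⁻¹⁻¹
    have := continuous_diagonalUnitary (ι := ι)
    fun_prop
  · change toOperator (V⁻¹ * diagonalUnitary z * V⁻¹⁻¹) (b a) = _
    rw [inv_inv, toOperator_mul_apply, toOperator_mul_apply, hV, b.repr_self,
      toOperator_diagonalUnitary_single, map_smul, map_inv, hV]
    congr 1
    exact b.repr_symm_single a

end Operators

section PathConnected

variable {ι : Type*} [Fintype ι] [DecidableEq ι]

lemma joined_diagonalUnitary_mul (z : ι → Circle) (u : Matrix.unitaryGroup ι ℂ) :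
    Joined u (diagonalUnitary z * u) := by
  have hz : z = fun i => Circle.exp (Complex.arg (z i)) := funext fun i => (Circle.exp_arg _).symm
  refine ⟨⟨⟨fun t => diagonalUnitary (fun i => Circle.exp (t * Complex.arg (z i))) * u, ?_⟩,
    ?_, ?_⟩⟩
  · exact (continuous_diagonalUnitary.comp (by fun_prop)).mul continuous_const
  · have : diagonalUnitary (fun _ : ι => (1 : Circle)) = 1 := map_one diagonalUnitary
    simp [this]
  · simp

open scoped Matrix.Norms.L2Operator in
/-- The unitary group is path connected: after multiplication with a scalar, `-1` is not an
eigenvalue, so that the matrix has a logarithm. -/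
lemma joined_one_unitaryGroup (u : Matrix.unitaryGroup ι ℂ) : Joined 1 u := by
  have hfin : (spectrum ℂ (u : Matrix ι ι ℂ)).Finite := Matrix.finite_spectrum _
  have hinj : Function.Injective (fun z : Circle => (-(z : ℂ))) := fun z w h =>
    Subtype.ext (neg_injective h)
  have hinf : Infinite Circle := by
    rw [← not_finite_iff_infinite]
    intro
    have := Nat.card_le_card_of_injective _
      (ZMod.injective_toCircle (N := Nat.card Circle + 1))
    rw [Nat.card_zmod] at this
    omega
  obtain ⟨z, hz⟩ : ∃ z : Circle, -(z : ℂ) ∉ spectrum ℂ (u : Matrix ι ι ℂ) := by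
    by_contra! h
    exact (hfin.subset (Set.range_subset_iff.2 h)).not_infinite
      (Set.infinite_range_of_injective hinj)
  let v := diagonalUnitary (fun _ => z⁻¹) * u
  have hv : ‖(v : Matrix ι ι ℂ) - 1‖ < 2 := by
    rw [Unitary.norm_sub_one_lt_two_iff v.2]
    have h1 : (v : Matrix ι ι ℂ) = Circle.toUnits z⁻¹ • (u : Matrix ι ι ℂ) :=
      coe_diagonalUnitary_const_mul z⁻¹ u
    have h2 : (-1 : ℂ) = Circle.toUnits z⁻¹ • (-(z : ℂ)) := by
      rw [Units.smul_def]; simp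
    rw [h1, h2, spectrum.smul_mem_smul_iff]
    exact hz
  have h3 : Joined u v := joined_diagonalUnitary_mul _ u
  have h4 : Joined (1 : Matrix.unitaryGroup ι ℂ) v := Unitary.joined _ _ hv
  exact h4.trans h3.symm

end PathConnected

section Center

variable {m : ℕ} [NeZero m]

open scoped Matrix.Norms.L2Operator in
/-- The unitary matrices span all matrices, so central ones commute with all matrices. -/
lemma exists_scalar_of_mem_center {A : Matrix.unitaryGroup (Fin m) ℂ}
    (hA : A ∈ Subgroup.center (Matrix.unitaryGroup (Fin m) ℂ)) :
    ∃ z : Circle, A = diagonalUnitary fun _ => z := by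
  have hcomm (B : Matrix (Fin m) (Fin m) ℂ) : Commute B (A : Matrix (Fin m) (Fin m) ℂ) := by
    have hB : B ∈ Submodule.span ℂ (unitary (Matrix (Fin m) (Fin m) ℂ) : Set _) := by
      rw [CStarAlgebra.span_unitary]; trivial
    induction hB using Submodule.span_induction with
    | mem B hB => exact congrArg Subtype.val (Subgroup.mem_center_iff.1 hA ⟨B, hB⟩)
    | zero => exact Commute.zero_left _
    | add B C _ _ h1 h2 => exact h1.add_left h2
    | smul a B _ h => exact h.smul_left a
  obtain ⟨z, hz⟩ := Matrix.mem_range_scalar_of_commute_single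
    (M := (A : Matrix (Fin m) (Fin m) ℂ)) fun i j _ => hcomm _
  have hz' : (A : Matrix (Fin m) (Fin m) ℂ) = Matrix.diagonal fun _ => z := hz.symm
  have h1 := Matrix.mem_unitaryGroup_iff.1 A.2
  rw [hz', Matrix.star_eq_conjTranspose, Matrix.diagonal_conjTranspose,
    Matrix.diagonal_mul_diagonal] at h1
  have h2 := congrFun (congrFun h1 0) 0
  simp [Complex.mul_conj] at h2
  refine ⟨⟨z, mem_sphere_zero_iff_norm.2 ?_⟩, Subtype.ext hz'⟩
  rw [Complex.normSq_eq_norm_sq] at h2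
  exact (pow_eq_one_iff_of_nonneg (norm_nonneg z) two_ne_zero).1 h2

lemma diagonalUnitary_const_mem_center (z : Circle) :
    (diagonalUnitary fun _ => z) ∈ Subgroup.center (Matrix.unitaryGroup (Fin m) ℂ) := by
  refine Subgroup.mem_center_iff.2 fun A => Subtype.ext ?_
  rw [coe_diagonalUnitary_const_mul, Submonoid.coe_mul, coe_diagonalUnitary]
  ext i j
  simp [mul_comm]

lemma exists_toCircle_eq {z : Circle} (hz : z ^ m = 1) : ∃ d : ZMod m, ZMod.toCircle d = z := by
  obtain ⟨k, -, hk⟩ := (Complex.isPrimitiveRoot_exp m (NeZero.ne m)).eq_pow_of_pow_eq_one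
    (congrArg Subtype.val hz : (z : ℂ) ^ m = 1)
  refine ⟨k, Subtype.ext ?_⟩
  rw [← hk, ← Complex.exp_nat_mul]
  have := ZMod.toCircle_natCast (N := m) k
  rw [this]
  congr 1
  ring

end Center

section Components

variable {n m : ℕ} [NeZero m]

/-- A tuple of unitary matrices with the commutation relations prescribed by `D`. -/
def HasRelations (D : Matrix (Fin n) (Fin n) (ZMod m))
    (A : Fin n → Matrix.unitaryGroup (Fin m) ℂ) : Prop :=
  ∀ i j, A i * A j = diagonalUnitary (fun _ => ZMod.toCircle (D i j)) * (A j * A i)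

variable {D D' : Matrix (Fin n) (Fin n) (ZMod m)} {A A' : Fin n → Matrix.unitaryGroup (Fin m) ℂ}

lemma toOperator_scalar_mul (z : Circle) (A : Matrix.unitaryGroup (Fin m) ℂ)
    (x : EuclideanSpace ℂ (Fin m)) :
    toOperator (diagonalUnitary (fun _ => z) * A) x = (z : ℂ) • toOperator A x := by
  rw [toOperator_apply, coe_diagonalUnitary_const_mul, Matrix.smul_mulVec]
  rfl

lemma hasRelations_iff : HasRelations D A ↔ IsTwisted D (fun i => toOperator (A i)) := by
  refine forall_congr' fun i => forall_congr' fun j => ?_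
  rw [← toOperator.injective.eq_iff]
  refine ⟨fun h x => ?_, fun h => LinearIsometryEquiv.ext fun x => ?_⟩
  · rw [← toOperator_mul_apply, h, toOperator_scalar_mul, toOperator_mul_apply]
  · rw [toOperator_mul_apply, toOperator_scalar_mul, toOperator_mul_apply, h]

lemma diagonalUnitary_const_injective :
    Function.Injective fun z : Circle => diagonalUnitary fun _ : Fin m => z := by
  intro z w h
  have := congrFun (congrFun (congrArg Subtype.val h) 0) 0
  exact Subtype.ext (by simpa [coe_diagonalUnitary] using this)

lemma HasRelations.comm_eq (h : HasRelations D A) (i j : Fin n) :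
    A i * A j * (A i)⁻¹ * (A j)⁻¹ = diagonalUnitary fun _ => ZMod.toCircle (D i j) := by
  rw [h i j]; group

lemma HasRelations.mem_BU (h : HasRelations D A) : A ∈ BU n m := fun i j => by
  rw [h.comm_eq]
  exact diagonalUnitary_const_mem_center _

lemma HasRelations.unique (h : HasRelations D A) (h' : HasRelations D' A) : D = D' := by
  ext i j
  exact ZMod.injective_toCircle
    (diagonalUnitary_const_injective ((h.comm_eq i j).symm.trans (h'.comm_eq i j)))

lemma HasRelations.isAlt (h : HasRelations D A) : IsAlt D := by
  refine ⟨fun i j => ?_, fun i => ?_⟩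
  · have h1 : diagonalUnitary (fun _ : Fin m => ZMod.toCircle (D i j)) *
        diagonalUnitary (fun _ => ZMod.toCircle (D j i)) = 1 := by
      rw [← h.comm_eq, ← h.comm_eq]; group
    rw [← map_mul] at h1
    have h2 := diagonalUnitary_const_injective (m := m)
      (a₁ := ZMod.toCircle (D i j) * ZMod.toCircle (D j i)) (a₂ := 1)
      (h1.trans (map_one diagonalUnitary).symm)
    rw [← AddChar.map_add_eq_mul, ← AddChar.map_zero_eq_one (ZMod.toCircle (N := m))] at h2
    exact eq_neg_of_add_eq_zero_left (ZMod.injective_toCircle h2)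
  · have h1 := h.comm_eq i i
    have h2 := diagonalUnitary_const_injective (m := m) (a₁ := ZMod.toCircle (D i i)) (a₂ := 1)
      (h1.symm.trans (by
        rw [mul_inv_cancel_right, mul_inv_cancel]; exact (map_one diagonalUnitary).symm))
    rw [← AddChar.map_zero_eq_one (ZMod.toCircle (N := m))] at h2
    exact ZMod.injective_toCircle h2

/-- The scalar commutators have determinant one, so they are `m`-th roots of unity. -/
lemma exists_hasRelations (hA : A ∈ BU n m) : ∃ D : Matrix (Fin n) (Fin n) (ZMod m),
    HasRelations D A := by
  have h (i j : Fin n) : ∃ d : ZMod m,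
      A i * A j = diagonalUnitary (fun _ => ZMod.toCircle d) * (A j * A i) := by
    obtain ⟨z, hz⟩ := exists_scalar_of_mem_center (hA i j)
    have hz' : A i * A j = diagonalUnitary (fun _ => z) * (A j * A i) := by
      rw [← hz]; group
    have hdet := congrArg (fun u : Matrix.unitaryGroup (Fin m) ℂ =>
      (u : Matrix (Fin m) (Fin m) ℂ).det) hz'
    simp only [Submonoid.coe_mul, Matrix.det_mul, coe_diagonalUnitary, Matrix.det_diagonal,
      Finset.prod_const, Finset.card_univ, Fintype.card_fin] at hdet
    have hne (u : Matrix.unitaryGroup (Fin m) ℂ) : (u : Matrix (Fin m) (Fin m) ℂ).det ≠ 0 := by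
      have := Matrix.det_of_mem_unitary u.2
      intro h0
      rw [h0] at this
      simpa using this.1
    have hzm : (z : ℂ) ^ m = 1 := by
      refine mul_right_cancel₀ (mul_ne_zero (hne (A j)) (hne (A i))) ?_
      rw [← hdet, one_mul, mul_comm]
    obtain ⟨d, hd⟩ := exists_toCircle_eq (z := z) (Subtype.ext (by simpa using hzm))
    exact ⟨d, by rw [hd]; exact hz'⟩
  choose D hD using h
  exact ⟨D, hD⟩

lemma HasRelations.sigmaDvd (h : HasRelations D A) : SigmaDvd (D.map (incl m)) m := by
  have := (hasRelations_iff.1 h).sigmaDvd h.isAlt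
  rwa [finrank_euclideanSpace_fin] at this

lemma exists_hasRelations_of_sigmaDvd (hD : IsAlt D) (h : SigmaDvd (D.map (incl m)) m) :
    ∃ A : Fin n → Matrix.unitaryGroup (Fin m) ℂ, HasRelations D A := by
  obtain ⟨B, hB⟩ := exists_isTwisted_of_sigmaDvd hD h
  refine ⟨fun i => toOperator.symm (B i), hasRelations_iff.2 ?_⟩
  simpa only [MulEquiv.apply_symm_apply] using hB

/-- Conjugate tuples are joined by a path of tuples with the same relations. -/
lemma HasRelations.joinedIn_conj (h : HasRelations D A) (u : Matrix.unitaryGroup (Fin m) ℂ) :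
    JoinedIn {A | HasRelations D A} A fun i => u * A i * u⁻¹ := by
  obtain ⟨γ⟩ := joined_one_unitaryGroup u
  refine ⟨⟨⟨fun t i => γ t * A i * (γ t)⁻¹, by fun_prop⟩, ?_, ?_⟩, fun t i j => ?_⟩
  · simp
  · simp
  · have hc := Subgroup.mem_center_iff.1
      (diagonalUnitary_const_mem_center (m := m) (ZMod.toCircle (D i j))) (γ t)
    change γ t * A i * (γ t)⁻¹ * (γ t * A j * (γ t)⁻¹) =
      diagonalUnitary (fun _ => ZMod.toCircle (D i j)) *
        (γ t * A j * (γ t)⁻¹ * (γ t * A i * (γ t)⁻¹))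
    calc γ t * A i * (γ t)⁻¹ * (γ t * A j * (γ t)⁻¹) = γ t * (A i * A j) * (γ t)⁻¹ := by group
      _ = γ t * diagonalUnitary (fun _ => ZMod.toCircle (D i j)) * (A j * A i) * (γ t)⁻¹ := by
        rw [h i j]; group
      _ = _ := by rw [hc]; group

section Twist

variable {G : Type*} [Group G] {ρ : G →* (EuclideanSpace ℂ (Fin m) ≃ₗᵢ[ℂ] EuclideanSpace ℂ (Fin m))}
  {β : G → G → Circle} {Λ : Subgroup G} {κ : Type*} {χ : κ → Λ →* Circle}
  {x : κ → EuclideanSpace ℂ (Fin m)}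

/-- The unitary operators that are scalar on each block of a frame form a torus, and they commute with
the representation. -/
lemma Frame.exists_blockScalar [Fintype κ] [Fintype (G ⧸ Λ)] (hρ : CommutesVia ρ β)
    (hΛ : IsSelfOrthogonal β Λ) (hx : Frame ρ Λ χ x)
    (hcard : Fintype.card κ * Fintype.card (G ⧸ Λ) = m) :
    ∃ P : (κ → Circle) →* Matrix.unitaryGroup (Fin m) ℂ, Continuous P ∧
      (∀ z b, toOperator (P z) (x b) = (z b : ℂ) • x b) ∧
      ∀ z g y, toOperator (P z) (ρ g y) = ρ g (toOperator (P z) y) := by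
  classical
  let σ : κ × G ⧸ Λ ≃ Fin m := Fintype.equivFinOfCardEq (by rw [Fintype.card_prod, hcard])
  let B := hx.basis hρ hΛ (by rw [hcard, finrank_euclideanSpace_fin])
  obtain ⟨P, hP, hPB⟩ := exists_diagonal_in_basis (B.reindex σ)
  let ε : (κ → Circle) →* (Fin m → Circle) :=
    { toFun := fun z a => z (σ.symm a).1
      map_one' := rfl
      map_mul' := fun _ _ => rfl }
  have hB (z : κ → Circle) (b : κ) (c : G ⧸ Λ) : toOperator (P (ε z)) (frameVec ρ Λ x (b, c)) =
      (z b : ℂ) • frameVec ρ Λ x (b, c) := by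
    have := hPB (ε z) (σ (b, c))
    rw [OrthonormalBasis.reindex_apply, Equiv.symm_apply_apply, Frame.basis_apply] at this
    rw [this]
    simp [ε]
  have hcomm (z : κ → Circle) (g : G) (y) :
      toOperator (P (ε z)) (ρ g y) = ρ g (toOperator (P (ε z)) y) := by
    have h : ((toOperator (P (ε z))).toLinearEquiv.toLinearMap ∘ₗ
        (ρ g).toLinearEquiv.toLinearMap) =
        (ρ g).toLinearEquiv.toLinearMap ∘ₗ (toOperator (P (ε z))).toLinearEquiv.toLinearMap := by
      refine B.toBasis.ext fun ⟨b, c⟩ => ?_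
      simp only [OrthonormalBasis.coe_toBasis, LinearMap.comp_apply, B, Frame.basis_apply]
      change toOperator (P (ε z)) (ρ g _) = ρ g (toOperator (P (ε z)) _)
      rw [hx.map_frameVec, map_smul, hB, hB, map_smul, hx.map_frameVec, smul_comm]
    exact LinearMap.congr_fun h y
  refine ⟨P.comp ε, hP.comp (continuous_pi fun a => continuous_apply _), fun z b => ?_, hcomm⟩
  have h1 : x b = ρ (QuotientGroup.mk 1 : G ⧸ Λ).out⁻¹
      (frameVec ρ Λ x (b, QuotientGroup.mk 1)) := (map_inv_apply_map_apply _ _ _).symm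
  rw [MonoidHom.comp_apply, h1, hcomm, hB, map_smul]

end Twist

/-- The tuples with relations `D` form a path connected space: twisting by characters makes the
characters of two frames equal, and then the tuples are conjugate. -/
theorem HasRelations.joinedIn (h : HasRelations D A) (h' : HasRelations D A') :
    JoinedIn {A | HasRelations D A} A A' := by
  have hD := h.isAlt
  obtain ⟨Λ, hΛ, hfin, -⟩ := exists_isSelfOrthogonal hD
  have := Fintype.ofFinite (FreeGroup (Fin n) ⧸ Λ)
  have hρ := (hasRelations_iff.1 h).commutesVia hD
  have hρ' := (hasRelations_iff.1 h').commutesVia hD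
  obtain ⟨s, χ, x, hx, hs⟩ := exists_frame hρ hΛ
  obtain ⟨s', χ', x', hx', hs'⟩ := exists_frame hρ' hΛ
  obtain rfl : s = s' :=
    Nat.eq_of_mul_eq_mul_right (Fintype.card_pos_iff.2 ⟨QuotientGroup.mk 1⟩) (hs.trans hs'.symm)
  choose lam hlam using fun b => exists_character_ratio hρ hρ' (hx.eigen b) (hx'.eigen b)
  have hsm : Fintype.card (Fin s) * Fintype.card (FreeGroup (Fin n) ⧸ Λ) = m := by
    rw [Fintype.card_fin, hs, finrank_euclideanSpace_fin]
  obtain ⟨P, hPc, hPx, hPρ⟩ := hx.exists_blockScalar hρ hΛ hsm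
  -- twisted tuples have the same relations
  have hcommP (z : Fin s → Circle) (i : Fin n) : P z * A i = A i * P z := by
    apply toOperator.injective
    ext1 y
    have := hPρ z (FreeGroup.of i) y
    rw [FreeGroup.lift_apply_of] at this
    rw [toOperator_mul_apply, toOperator_mul_apply, this]
  have htwist (z : Fin n → Fin s → Circle) : HasRelations D fun i => A i * P (z i) := by
    intro i j
    have hP : P (z i) * P (z j) = P (z j) * P (z i) := by rw [← map_mul, mul_comm, map_mul]
    calc A i * P (z i) * (A j * P (z j)) = A i * (P (z i) * A j) * P (z j) := by group
      _ = A i * A j * (P (z i) * P (z j)) := by rw [hcommP]; group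
      _ = diagonalUnitary (fun _ => ZMod.toCircle (D i j)) * (A j * (A i * P (z j)) * P (z i)) := by
        rw [h i j, hP]; group
      _ = _ := by rw [← hcommP]; group
  let z (i : Fin n) (b : Fin s) : Circle := lam b (FreeGroup.of i)
  have hjoin : JoinedIn {A | HasRelations D A} A fun i => A i * P (z i) := by
    refine ⟨⟨⟨fun t i => A i * P fun b => Circle.exp (t * Complex.arg (z i b)), ?_⟩, ?_, ?_⟩,
      fun t => htwist fun i b => Circle.exp (t * Complex.arg (z i b))⟩
    · refine continuous_pi fun i => continuous_const.mul (hPc.comp ?_)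
      fun_prop
    · have h1 : P (fun _ => 1) = 1 := map_one P
      simp [h1]
    · simp
  -- the twisted tuple has a frame with the same characters as the second tuple
  have hρ'' := (hasRelations_iff.1 (htwist z)).commutesVia hD
  let M : FreeGroup (Fin n) →* (EuclideanSpace ℂ (Fin m) ≃ₗᵢ[ℂ] EuclideanSpace ℂ (Fin m)) :=
    (toOperator.toMonoidHom.comp P).comp (MonoidHom.pi lam)
  have hM (g) (y) : M g y = toOperator (P fun b => lam b g) y := rfl
  have hprod (g : FreeGroup (Fin n)) (y : EuclideanSpace ℂ (Fin m)) :
      FreeGroup.lift (fun i => toOperator (A i * P (z i))) g y =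
        FreeGroup.lift (fun i => toOperator (A i)) g (M g y) := by
    let ρM : FreeGroup (Fin n) →* (EuclideanSpace ℂ (Fin m) ≃ₗᵢ[ℂ] EuclideanSpace ℂ (Fin m)) :=
      MonoidHom.mk' (fun g => FreeGroup.lift (fun i => toOperator (A i)) g * M g) fun g k => by
        ext1 y
        change FreeGroup.lift (fun i => toOperator (A i)) (g * k) (M (g * k) y) =
          FreeGroup.lift (fun i => toOperator (A i)) g (M g
            (FreeGroup.lift (fun i => toOperator (A i)) k (M k y)))
        have hMρ : M g (FreeGroup.lift (fun i => toOperator (A i)) k (M k y)) =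
            FreeGroup.lift (fun i => toOperator (A i)) k (M g (M k y)) := hPρ _ k _
        rw [map_mul_apply, map_mul_apply, hMρ]
    have : FreeGroup.lift (fun i => toOperator (A i * P (z i))) = ρM := by
      refine FreeGroup.ext_hom _ _ fun i => ?_
      rw [FreeGroup.lift_apply_of, map_mul]
      change _ = FreeGroup.lift (fun i => toOperator (A i)) (FreeGroup.of i) *
        M (FreeGroup.of i)
      rw [FreeGroup.lift_apply_of]
      rfl
    rw [this]
    rfl
  have hx'' := hx.twist (lam := lam) (M := M) (fun g b => by rw [hM, hPx]) hprod
  have hχ : (fun b => (lam b).comp Λ.subtype * χ b) = χ' := by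
    funext b
    ext1 k
    exact (hlam b k).symm
  rw [hχ] at hx''
  obtain ⟨U, hU⟩ := hx''.exists_intertwiner hρ'' hρ' hΛ hx'
    (by rw [hsm, finrank_euclideanSpace_fin]) (by rw [hsm, finrank_euclideanSpace_fin])
  have hconj : (fun i => toOperator.symm U * (A i * P (z i)) * (toOperator.symm U)⁻¹) = A' := by
    funext i
    rw [mul_inv_eq_iff_eq_mul]
    apply toOperator.injective
    ext1 y
    have := hU (FreeGroup.of i) y
    rw [FreeGroup.lift_apply_of, FreeGroup.lift_apply_of] at this
    rw [toOperator_mul_apply _ (A i * P (z i)), toOperator_mul_apply (A' i),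
      MulEquiv.apply_symm_apply, this]
  rw [← hconj]
  exact hjoin.trans ((htwist z).joinedIn_conj _)

/-- The relations do not change along a path, since the scalar commutators vary continuously in
the finite set of `m`-th roots of unity. -/
lemma HasRelations.eq_of_joinedIn (h : HasRelations D A) (h' : HasRelations D' A')
    (hj : JoinedIn (BU n m) A A') : D = D' := by
  obtain ⟨γ, hγ⟩ := hj
  choose f hf using fun t => exists_hasRelations (hγ t)
  have hf0 : f 0 = D := (hf 0).unique (by rw [γ.source]; exact h)
  have hf1 : f 1 = D' := (hf 1).unique (by rw [γ.target]; exact h')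
  rw [← hf0, ← hf1]
  ext i j
  let S : Set ℂ := Set.range fun d : ZMod m => (ZMod.toCircle d : ℂ)
  have hS : IsTotallyDisconnected S := (Set.finite_range _).countable.isTotallyDisconnected
  have heq : (fun t => (ZMod.toCircle (f t i j) : ℂ)) = fun t =>
      ((γ t i * γ t j * (γ t i)⁻¹ * (γ t j)⁻¹ : Matrix.unitaryGroup (Fin m) ℂ) :
        Matrix (Fin m) (Fin m) ℂ) 0 0 := by
    funext t
    rw [(hf t).comm_eq, coe_diagonalUnitary, Matrix.diagonal_apply_eq]
  have hcont : Continuous fun t => (ZMod.toCircle (f t i j) : ℂ) := by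
    rw [heq]
    have hc : Continuous fun t => γ t i * γ t j * (γ t i)⁻¹ * (γ t j)⁻¹ := by fun_prop
    exact (continuous_subtype_val.comp hc).matrix_elem 0 0
  have := hS _ (by rintro _ ⟨t, rfl⟩; exact ⟨_, rfl⟩) (isPreconnected_range hcont)
    ⟨0, rfl⟩ ⟨1, rfl⟩
  exact ZMod.injective_toCircle (Subtype.ext this)

/-- The path components correspond to the matrices that `N` counts: the relations are constant on a
component, they determine it, and those with `σ(D) ∣ m` occur. -/
theorem card_zerothHomotopy_BU : Nat.card (ZerothHomotopy (BU n m)) = N n m := by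
  choose f hf using fun A : BU n m => exists_hasRelations A.2
  refine Nat.card_eq_of_bijective (Quotient.lift (fun A => ⟨f A, (hf A).isAlt, (hf A).sigmaDvd⟩)
    fun A A' h => Subtype.ext ?_) ⟨fun x y => ?_, fun D => ?_⟩
  · exact (hf A).eq_of_joinedIn (hf A') (joinedIn_iff_joined A.2 A'.2 |>.2 h)
  · induction x using Quotient.inductionOn with | h A => ?_
    induction y using Quotient.inductionOn with | h A' => ?_
    intro h
    have h1 : f A = f A' := congrArg Subtype.val h
    refine Quotient.sound ?_
    have h2 := (h1 ▸ hf A).joinedIn (hf A')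
    exact (joinedIn_iff_joined A.2 A'.2).1 (h2.mono fun _ h => h.mem_BU)
  · obtain ⟨A, hA⟩ := exists_hasRelations_of_sigmaDvd D.2.1 D.2.2
    exact ⟨Quotient.mk _ ⟨A, hA.mem_BU⟩, Subtype.ext ((hf _).unique hA)⟩

end Components

end AlmostCommuting

theorem mainTheorem6 (n : ℕ) (hn : 1 ≤ n) :
    (∀ p k : ℕ, p.Prime → 1 ≤ k →
      (∀ α ∈ AlmostCommuting.J n k,
        (Nat.card {D : Matrix (Fin n) (Fin n) (ZMod (p ^ k)) //
            D ∈ AlmostCommuting.T n (ZMod (p ^ k)) ∧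
            AlmostCommuting.Congruent (AlmostCommuting.Dalpha n p k α.2.parts) D} : ℚ) =
          AlmostCommuting.Np n p α.2.parts) ∧
      (AlmostCommuting.N n (p ^ k) : ℚ) =
        1 + ∑ α ∈ AlmostCommuting.J n k, AlmostCommuting.Np n p α.2.parts) ∧
    (∀ m₁ m₂ : ℕ, 1 ≤ m₁ → 1 ≤ m₂ → Nat.Coprime m₁ m₂ →
      (∀ D₁ ∈ AlmostCommuting.T n (ZMod m₁), ∀ D₂ ∈ AlmostCommuting.T n (ZMod m₂),
        (∃ D ∈ AlmostCommuting.T n (ZMod (m₁ * m₂)),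
          D.map (AlmostCommuting.incl (m₁ * m₂)) =
            D₁.map (AlmostCommuting.incl m₁) + D₂.map (AlmostCommuting.incl m₂)) ∧
        AlmostCommuting.sigma
            (D₁.map (AlmostCommuting.incl m₁) + D₂.map (AlmostCommuting.incl m₂)) =
          AlmostCommuting.sigma (D₁.map (AlmostCommuting.incl m₁)) *
            AlmostCommuting.sigma (D₂.map (AlmostCommuting.incl m₂))) ∧
      AlmostCommuting.N n (m₁ * m₂) = AlmostCommuting.N n m₁ * AlmostCommuting.N n m₂) ∧
    (∀ (r : ℕ) (p k : Fin r → ℕ) (m : ℕ), (∀ i, (p i).Prime) → Function.Injective p →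
      (∀ i, 1 ≤ k i) → m = ∏ i, p i ^ k i →
      Nat.card (ZerothHomotopy (AlmostCommuting.BU n m)) = AlmostCommuting.N n m ∧
      (AlmostCommuting.N n m : ℚ) =
        ∏ i, (1 + ∑ α ∈ AlmostCommuting.J n (k i), AlmostCommuting.Np n (p i) α.2.parts)) := by
  refine ⟨fun p k hp _ => ?_, fun m₁ m₂ h₁ h₂ h => ⟨fun D₁ hD₁ D₂ hD₂ => ⟨?_, ?_⟩, ?_⟩, ?_⟩
  · have : Fact p.Prime := ⟨hp⟩
    exact ⟨fun α hα => AlmostCommuting.card_congruent_Dalpha hα, AlmostCommuting.N_prime_pow⟩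
  · exact AlmostCommuting.exists_mem_T_map_eq_add h₁ h₂ h hD₁ hD₂
  · exact AlmostCommuting.sigma_add h D₁ D₂
  · exact AlmostCommuting.N_mul h₁ h₂ h
  · rintro r p k m hp hinj - rfl
    have : NeZero (∏ i, p i ^ k i) :=
      ⟨Finset.prod_ne_zero_iff.2 fun i _ => pow_ne_zero _ (hp i).ne_zero⟩
    exact ⟨AlmostCommuting.card_zerothHomotopy_BU,
      AlmostCommuting.N_prod Finset.univ p k hp hinj⟩
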